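/- Theorem 4.5 (singular support of a formal graded ring). Let $R=\bigoplus_{n\in\mathbb Z}R_n$ be a Noetherian commutative $\mathbb Z$-graded ring, considered as a DG algebra with zero differential (gradings are homological). Thus a DG $R$-module is a graded right $R$-module $M$ with an additive map $d$ of degree $-1$ such that $d^2=0$ and $d(xa)=d(x)a$; it is *coefficient-finitely generated* if its homology $H_*(M)$ is a finitely generated $R$-module. Let $D(R)$ be the derived category of DG $R$-modules (the localization at the quasi-isomorphisms), call an object $X$ of it *small* if $\bigoplus_j\mathrm{Hom}(X,Y_j)\to\mathrm{Hom}(X,\coprod_jY_j)$ is bijective for each family $(Y_j)$, let $D^b(R)\subseteq D(R)$ be the full subcategory of coefficient-finitely generated DG modules, and let the singularity category $D_{\mathrm{sg}}(R)$ be the Verdier quotient of $D^b(R)$ by the small objects; its objects are those of $D^b(R)$. For a homogeneous prime ideal $\mathfrak p$ let $R_{(\mathfrak p)}$ be the $\mathbb Z$-graded ring obtained from $R$ by inverting all homogeneous elements outside $\mathfrak p$, again with zero differential. The *singular support* $\mathrm{Supp}_{\mathrm{sg}}(M)$ of a coefficient-finitely generated DG module $M$ is the set of the homogeneous primes $\mathfrak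 p$ of $R$ for which $M\otimes_RR_{(\mathfrak p)}$ is not a small object of $D(R_{(\mathfrak p)})$, and $$\mathrm{Supp}\,D_{\mathrm{sg}}(R)=\bigcup_{M\in D_{\mathrm{sg}}(R)}\mathrm{Supp}_{\mathrm{sg}}(M).$$ Let $\mathrm{Spec}^h(R)$ be the set of homogeneous prime ideals of $R$, and let $\mathrm{Sing}(R)$ be the set of the prime ideals $\mathfrak p$ of $R$ for which the ordinary (ungraded) local ring $R_{\mathfrak p}$ is not regular. Then $$\mathrm{Supp}\,D_{\mathrm{sg}}(R)=\mathrm{Sing}(R)\cap\mathrm{Spec}^h(R).$$ -/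

import Mathlib

open CategoryTheory CategoryTheory.Limits
open scoped TensorProduct

universe u

/-! ## DG modules over a graded ring with zero differential -/

/-- Let `A` be a commutative `ℤ`-graded ring, considered as a DG algebra with zero differential.
A (right) DG `A`-module is a `ℤ`-graded `A`-module with an additive endomorphism `d` of degree `-1`
(all gradings are homological) such that `d ∘ d = 0` and `d (x a) = d x a + (-1)^|x| x (d a)`;
as `d a = 0` for all `a` in `A`, the Leibniz rule says that `d` is `A`-linear.
(Replacing `d x` by `(-1)^|x| d x` turns right DG modules into left ones, so the choice of side
does not matter.) -/
structure DGModule {A : Type u} [CommRing A] (𝒜 : ℤ → AddSubgroup A) [GradedRing 𝒜] where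
  /-- the underlying module (the direct sum of all the graded pieces) -/
  carrier : Type u
  [addCommGroup : AddCommGroup carrier]
  [module : Module A carrier]
  /-- the graded pieces -/
  grading : ℤ → AddSubgroup carrier
  isInternal : DirectSum.IsInternal grading
  smul_mem : ∀ ⦃i j : ℤ⦄ ⦃a : A⦄ ⦃x : carrier⦄,
    a ∈ 𝒜 i → x ∈ grading j → a • x ∈ grading (i + j)
  /-- the differential -/
  d : carrier →ₗ[A] carrier
  d_mem : ∀ ⦃n : ℤ⦄ ⦃x : carrier⦄, x ∈ grading n → d x ∈ grading (n - 1)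
  d_d : ∀ x : carrier, d (d x) = 0

namespace DGModule

attribute [instance] DGModule.addCommGroup DGModule.module

section Basic

variable {A : Type u} [CommRing A] {𝒜 : ℤ → AddSubgroup A} [GradedRing 𝒜]

/-- Morphisms of DG modules: `A`-linear maps of degree `0` that commute with the differentials. -/
@[ext]
structure Hom (M N : DGModule 𝒜) where
  toLinearMap : M.carrier →ₗ[A] N.carrier
  map_mem : ∀ ⦃n : ℤ⦄ ⦃x : M.carrier⦄, x ∈ M.grading n → toLinearMap x ∈ N.grading n
  map_d : ∀ x : M.carrier, toLinearMap (M.d x) = N.d (toLinearMap x)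

/-- The category of DG modules. -/
instance : Category (DGModule 𝒜) where
  Hom := Hom
  id M := ⟨LinearMap.id, fun _ _ h => h, fun _ => rfl⟩
  comp f g := ⟨g.toLinearMap ∘ₗ f.toLinearMap, fun _ _ h => g.map_mem (f.map_mem h),
    fun x => by simp [f.map_d, g.map_d]⟩

/-- The cycles of a DG module. -/
def cycles (M : DGModule 𝒜) : Submodule A M.carrier := LinearMap.ker M.d

/-- The boundaries of a DG module, as a submodule of the cycles. -/
def boundaries (M : DGModule 𝒜) : Submodule A M.cycles := (LinearMap.range M.d).submoduleOf M.cycles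

/-- The coefficients of a DG module: its total homology `⨁ n, H_n(M)`, as an `A`-module. -/
abbrev homology (M : DGModule 𝒜) : Type u := M.cycles ⧸ M.boundaries

/-- The map induced on cycles by a morphism of DG modules. -/
def Hom.cyclesMap {M N : DGModule 𝒜} (f : Hom M N) : M.cycles →ₗ[A] N.cycles :=
  f.toLinearMap.restrict fun x (hx : M.d x = 0) => show N.d (f.toLinearMap x) = 0 by
    rw [← f.map_d, hx, map_zero]

/-- The map induced on homology by a morphism of DG modules. -/
def Hom.homologyMap {M N : DGModule 𝒜} (f : Hom M N) : M.homology →ₗ[A] N.homology :=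
  Submodule.mapQ M.boundaries N.boundaries f.cyclesMap fun x hx => by
    obtain ⟨y, hy⟩ : ∃ y, M.d y = x.1 := hx
    exact ⟨f.toLinearMap y, by rw [← f.map_d, hy]; rfl⟩

/-- `M` is coefficient-finitely generated: its homology is finitely generated over `A`. -/
def CoefficientFinite (M : DGModule 𝒜) : Prop := Module.Finite A M.homology

theorem prod_isInternal {X Y : Type*} [AddCommGroup X] [AddCommGroup Y] {𝒳 : ℤ → AddSubgroup X}
    {𝒴 : ℤ → AddSubgroup Y} (hX : DirectSum.IsInternal 𝒳) (hY : DirectSum.IsInternal 𝒴) :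
    DirectSum.IsInternal fun n : ℤ => (𝒳 n).prod (𝒴 (n - 1)) := by
  classical
  let _ := hX.chooseDecomposition
  let _ := hY.chooseDecomposition
  refine ⟨(injective_iff_map_eq_zero _).mpr fun z hz => ?_, fun ⟨x, y⟩ => ?_⟩
  · rw [DirectSum.coeAddMonoidHom_eq_dfinsuppSum, DFinsupp.sum] at hz
    ext n : 2
    by_cases hn : n ∈ z.support
    · have h1 := congrArg (fun w => ((DirectSum.decompose 𝒳 w.1 n : 𝒳 _) : X)) hz
      have h2 := congrArg (fun w => ((DirectSum.decompose 𝒴 w.2 (n - 1) : 𝒴 _) : Y)) hz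
      simp only [Prod.fst_sum, Prod.snd_sum, DirectSum.decompose_sum, DirectSum.sum_apply,
        AddSubmonoidClass.coe_finsetSum, Prod.fst_zero, Prod.snd_zero, DirectSum.decompose_zero,
        DirectSum.zero_apply, ZeroMemClass.coe_zero] at h1 h2
      rw [Finset.sum_eq_single_of_mem n hn fun j _ hjn =>
        DirectSum.decompose_of_mem_ne 𝒳 (z j).2.1 hjn,
        DirectSum.decompose_of_mem_same 𝒳 (z n).2.1] at h1
      rw [Finset.sum_eq_single_of_mem n hn fun j _ hjn =>
        DirectSum.decompose_of_mem_ne 𝒴 (z j).2.2 (by omega),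
        DirectSum.decompose_of_mem_same 𝒴 (z n).2.2] at h2
      exact Prod.ext h1 h2
    · simpa using hn
  · suffices h : (x, (0 : Y)) ∈ (DirectSum.coeAddMonoidHom fun n : ℤ =>
          (𝒳 n).prod (𝒴 (n - 1))).range ∧
        ((0 : X), y) ∈ (DirectSum.coeAddMonoidHom fun n : ℤ => (𝒳 n).prod (𝒴 (n - 1))).range by
      simpa using add_mem h.1 h.2
    constructor
    · induction x using DirectSum.Decomposition.inductionOn 𝒳 with
      | zero => exact zero_mem _
      | @homogeneous j x =>
        exact ⟨DirectSum.of (fun n : ℤ => (𝒳 n).prod (𝒴 (n - 1))) j ⟨(x, 0), x.2, zero_mem _⟩,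
          DirectSum.coeAddMonoidHom_of _ _ _⟩
      | add x x' h h' => simpa using add_mem h h'
    · induction y using DirectSum.Decomposition.inductionOn 𝒴 with
      | zero => exact zero_mem _
      | @homogeneous j y =>
        exact ⟨DirectSum.of (fun n : ℤ => (𝒳 n).prod (𝒴 (n - 1))) (j + 1)
          ⟨(0, y), zero_mem _, by simp⟩, DirectSum.coeAddMonoidHom_of _ _ _⟩
      | add y y' h h' => simpa using add_mem h h'

/-- The mapping cone of a morphism `f : M ⟶ N` of DG modules: `N ⊕ M[1]`, whose degree `n` part is
`N_n ⊕ M_{n-1}`, with differential `(y, x) ↦ (d y + f x, - d x)`. -/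
def cone {M N : DGModule 𝒜} (f : Hom M N) : DGModule 𝒜 where
  carrier := N.carrier × M.carrier
  grading n := (N.grading n).prod (M.grading (n - 1))
  isInternal := prod_isInternal N.isInternal M.isInternal
  smul_mem i j a x ha hx := ⟨N.smul_mem ha hx.1, by
    have := M.smul_mem ha hx.2
    rwa [show i + (j - 1) = i + j - 1 by ring] at this⟩
  d := ((N.d ∘ₗ LinearMap.fst A _ _) + f.toLinearMap ∘ₗ LinearMap.snd A _ _).prod
    (-(M.d ∘ₗ LinearMap.snd A _ _))
  d_mem n x hx := ⟨add_mem (N.d_mem hx.1) (f.map_mem hx.2), neg_mem (M.d_mem hx.2)⟩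
  d_d x := by simp [N.d_d, M.d_d, f.map_d]

end Basic

variable {A : Type u} [CommRing A] (𝒜 : ℤ → AddSubgroup A) [GradedRing 𝒜]

/-- The quasi-isomorphisms of DG modules. -/
def quasiIso : MorphismProperty (DGModule 𝒜) := fun _ _ f => Function.Bijective (Hom.homologyMap f)

/-- The derived category `D(A)`: the localization of the category of DG modules with respect to the
quasi-isomorphisms. -/
abbrev Derived : Type (u + 1) := (quasiIso 𝒜).Localization

/-- A DG module, as an object of the derived category. -/
abbrev toDerived (M : DGModule 𝒜) : Derived 𝒜 := (quasiIso 𝒜).Q.obj M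

variable {𝒜} in
/-- The DG module that underlies an object of the derived category (the objects of `D(A)` are the DG
modules). -/
def Derived.toDGModule (X : Derived 𝒜) : DGModule 𝒜 :=
  (Localization.Construction.objEquiv (quasiIso 𝒜)).symm X

end DGModule

/-- Small (compact) objects of a category of triangulated type: `X` is small if each morphism from
`X` to a coproduct `∐ j, Y j` factors through the canonical map `∐ j ∈ F, Y j ⟶ ∐ j, Y j`
for some finite set `F` of indices.  (In an additive category this says that
`⨁ j, Hom(X, Y j) → Hom(X, ∐ j, Y j)` is bijective; it is injective in any case.) -/
def IsSmallObject {D : Type*} [Category D] (X : D) : Prop :=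
  ∀ (J : Type u) (Y : J → D) (c : Cofan Y) (_ : IsColimit c) (f : X ⟶ c.pt),
    ∃ (F : Finset J) (cF : Cofan fun j : F => Y j) (hcF : IsColimit cF) (g : X ⟶ cF.pt),
      g ≫ Cofan.IsColimit.desc hcF (fun j : F => c.inj (j : J)) = f

/-! ## The singularity category -/

section SingularityCategory

variable {A : Type u} [CommRing A] (𝒜 : ℤ → AddSubgroup A) [GradedRing 𝒜]

/-- The bounded derived category `Dᵇ(A)`: the full subcategory of `D(A)` on the
coefficient-finitely generated DG modules. -/
abbrev BoundedDerived : Type (u + 1) :=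
  ObjectProperty.FullSubcategory fun X : DGModule.Derived 𝒜 => X.toDGModule.CoefficientFinite

/-- The morphisms of `D(A)` whose cone is small: those isomorphic to a morphism that comes from a
morphism of DG modules with a small mapping cone. -/
def smallCone : MorphismProperty (DGModule.Derived 𝒜) := fun _ _ g =>
  ∃ (M N : DGModule 𝒜) (f : M ⟶ N), IsSmallObject.{u} (DGModule.toDerived 𝒜 (DGModule.cone f)) ∧
    Nonempty (Arrow.mk ((DGModule.quasiIso 𝒜).Q.map f) ≅ Arrow.mk g)

/-- The morphisms of `Dᵇ(A)` whose cone is small. -/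
def boundedSmallCone : MorphismProperty (BoundedDerived 𝒜) :=
  (smallCone 𝒜).inverseImage (ObjectProperty.ι _)

/-- The singularity category `D_sg(A)`: the Verdier quotient of `Dᵇ(A)` by the small objects, i.e.
the localization of `Dᵇ(A)` at the morphisms with small cone. -/
abbrev SingularityCategory : Type (u + 1) := (boundedSmallCone 𝒜).Localization

variable {𝒜} in
/-- The (coefficient-finitely generated) DG module that underlies an object of the singularity
category. -/
noncomputable def SingularityCategory.toDGModule (X : SingularityCategory 𝒜) : DGModule 𝒜 :=
  ((Localization.Construction.objEquiv (boundedSmallCone 𝒜)).symm X).obj.toDGModule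

end SingularityCategory

/-! ## Homogeneous localization -/

section Localization

variable {A : Type u} [CommRing A] (𝒜 : ℤ → AddSubgroup A)

/-- The degree `n` part of a localization `f : M → S⁻¹M` of a graded module, for a
multiplicative set `S` of homogeneous elements: the fractions `m / s` with `s ∈ S` homogeneous of
some degree `i` and `m ∈ M` homogeneous of degree `n + i`. -/
def localizationGrading (S : Submonoid A) {M M' : Type*} [AddCommGroup M] [Module A M]
    [AddCommGroup M'] [Module A M'] (f : M →ₗ[A] M') [GradedRing 𝒜] (ℳ : ℤ → AddSubgroup M)
    (hℳ : ∀ ⦃i j : ℤ⦄ ⦃a : A⦄ ⦃x : M⦄, a ∈ 𝒜 i → x ∈ ℳ j → a • x ∈ ℳ (i + j)) (n : ℤ) :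
    AddSubgroup M' where
  carrier := {y | ∃ i : ℤ, ∃ s ∈ S, s ∈ 𝒜 i ∧ ∃ m ∈ ℳ (n + i), s • y = f m}
  zero_mem' := ⟨0, 1, S.one_mem, SetLike.GradedOne.one_mem, 0, zero_mem _, by simp⟩
  add_mem' := by
    rintro y y' ⟨i, s, hs, hsi, m, hm, h⟩ ⟨i', s', hs', hsi', m', hm', h'⟩
    refine ⟨i + i', s * s', S.mul_mem hs hs', SetLike.GradedMul.mul_mem hsi hsi',
      s' • m + s • m', add_mem ?_ ?_, ?_⟩
    · have := hℳ hsi' hm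
      rwa [show i' + (n + i) = n + (i + i') by ring] at this
    · have := hℳ hsi hm'
      rwa [show i + (n + i') = n + (i + i') by ring] at this
    · rw [smul_add, map_add, map_smul, map_smul, ← h, ← h', mul_smul, mul_smul, smul_comm s s' y]
  neg_mem' := by
    rintro y ⟨i, s, hs, hsi, m, hm, h⟩
    exact ⟨i, s, hs, hsi, -m, neg_mem hm, by simp [h]⟩

variable [GradedRing 𝒜] {S : Submonoid A}
  {M M' : Type*} [AddCommGroup M] [Module A M] [AddCommGroup M'] [Module A M'] (f : M →ₗ[A] M')
  {ℳ : ℤ → AddSubgroup M}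
  (hℳ : ∀ ⦃i j : ℤ⦄ ⦃a : A⦄ ⦃x : M⦄, a ∈ 𝒜 i → x ∈ ℳ j → a • x ∈ ℳ (i + j))

theorem localizationGrading_common_denominator (v : ℤ → M') (T : Finset ℤ)
    (hv : ∀ n ∈ T, v n ∈ localizationGrading 𝒜 S f ℳ hℳ n) :
    ∃ i : ℤ, ∃ s ∈ S, s ∈ 𝒜 i ∧ ∃ m : ℤ → M, ∀ n ∈ T, m n ∈ ℳ (n + i) ∧ s • v n = f (m n) := by
  classical
  induction T using Finset.induction_on with
  | empty => exact ⟨0, 1, S.one_mem, SetLike.GradedOne.one_mem, 0, by simp⟩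
  | insert k T hk ih =>
    obtain ⟨i, s, hs, hsi, m, hm⟩ := ih fun n hn => hv n (Finset.mem_insert_of_mem hn)
    obtain ⟨i', s', hs', hsi', m', hm', h'⟩ := hv k (Finset.mem_insert_self k T)
    refine ⟨i + i', s * s', S.mul_mem hs hs', SetLike.GradedMul.mul_mem hsi hsi',
      fun n => if n = k then s • m' else s' • m n, fun n hn => ?_⟩
    by_cases hnk : n = k
    · subst hnk
      have := hℳ hsi hm'
      rw [show i + (n + i') = n + (i + i') by ring] at this
      simpa [mul_smul, h'] using this
    · have hnT : n ∈ T := (Finset.mem_insert.mp hn).resolve_left hnk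
      have := hℳ hsi' (hm n hnT).1
      rw [show i' + (n + i) = n + (i + i') by ring] at this
      simp only [hnk, if_false, map_smul, ← (hm n hnT).2]
      exact ⟨this, by rw [mul_smul, smul_comm]⟩

/-- The localization of a graded module at homogeneous elements is again graded. -/
theorem localizationGrading_isInternal [IsLocalizedModule S f]
    (hS : ∀ s ∈ S, SetLike.IsHomogeneousElem 𝒜 s) (hint : DirectSum.IsInternal ℳ) :
    DirectSum.IsInternal (localizationGrading 𝒜 S f ℳ hℳ) := by
  classical
  let _ := hint.chooseDecomposition
  have hinj : ∀ s ∈ S, ∀ y : M', s • y = 0 → y = 0 := fun s hs y h =>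
    IsLocalizedModule.smul_injective f (⟨s, hs⟩ : S) (by simpa [Submonoid.smul_def] using h)
  refine ⟨(injective_iff_map_eq_zero _).mpr fun x hx => ?_, fun y => ?_⟩
  · obtain ⟨i, s, hs, hsi, m, hm⟩ := localizationGrading_common_denominator 𝒜 f hℳ
      (fun n => (x n : M')) x.support fun n _ => (x n).2
    rw [DirectSum.coeAddMonoidHom_eq_dfinsuppSum, DFinsupp.sum] at hx
    have h1 : f (∑ n ∈ x.support, m n) = 0 := by
      rw [map_sum, ← Finset.sum_congr rfl fun n hn => (hm n hn).2, ← Finset.smul_sum, hx, smul_zero]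
    obtain ⟨⟨c, hc⟩, hcm⟩ := (IsLocalizedModule.eq_zero_iff S f).mp h1
    obtain ⟨k, hck⟩ := hS c hc
    change c • ∑ n ∈ x.support, m n = 0 at hcm
    rw [Finset.smul_sum] at hcm
    ext n
    by_cases hn : n ∈ x.support
    · have hmem : ∀ j ∈ x.support, c • m j ∈ ℳ (k + (j + i)) := fun j hj => hℳ hck (hm j hj).1
      have h2 := congrArg (fun z => ((DirectSum.decompose ℳ z (k + (n + i)) : ℳ _) : M)) hcm
      simp only [DirectSum.decompose_sum, DirectSum.decompose_zero, DirectSum.sum_apply,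
        AddSubmonoidClass.coe_finsetSum, DirectSum.zero_apply, ZeroMemClass.coe_zero] at h2
      rw [Finset.sum_eq_single_of_mem n hn fun j hj hjn =>
        DirectSum.decompose_of_mem_ne ℳ (hmem j hj) (by omega),
        DirectSum.decompose_of_mem_same ℳ (hmem n hn)] at h2
      have h3 : c • s • (x n : M') = 0 := by rw [(hm n hn).2, ← map_smul, h2, map_zero]
      simpa using hinj s hs _ (hinj c hc _ h3)
    · simpa using hn
  · obtain ⟨⟨m, s, hs⟩, h⟩ := IsLocalizedModule.surj S f y
    obtain ⟨i, hsi⟩ := hS s hs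
    change s • y = f m at h
    suffices ∀ (m : M) (y : M'), s • y = f m →
        y ∈ (DirectSum.coeAddMonoidHom (localizationGrading 𝒜 S f ℳ hℳ)).range from this m y h
    intro m
    induction m using DirectSum.Decomposition.inductionOn ℳ with
    | zero => exact fun y h => by rw [hinj s hs y (by simpa using h)]; exact zero_mem _
    | @homogeneous j m =>
      refine fun y h => ⟨DirectSum.of (fun n => localizationGrading 𝒜 S f ℳ hℳ n) (j - i)
        ⟨y, i, s, hs, hsi, m, ?_, h⟩, DirectSum.coeAddMonoidHom_of _ _ _⟩
      rw [sub_add_cancel]; exact m.2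
    | add m m' ih ih' =>
      intro y h
      have hy : ∀ m : M, s • IsLocalizedModule.mk' f m (⟨s, hs⟩ : S) = f m := fun m =>
        IsLocalizedModule.mk'_cancel' f m (⟨s, hs⟩ : S)
      have : y = IsLocalizedModule.mk' f m (⟨s, hs⟩ : S) +
          IsLocalizedModule.mk' f m' (⟨s, hs⟩ : S) := by
        rw [← sub_eq_zero]
        exact hinj s hs _ (by rw [smul_sub, smul_add, hy, hy, h, map_add, sub_self])
      rw [this]
      exact add_mem (ih _ (hy m)) (ih' _ (hy m'))

theorem localizationGrading_smul_mem [Module (Localization S) M']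
    [IsScalarTower A (Localization S) M'] ⦃i j : ℤ⦄ ⦃a : Localization S⦄ ⦃y : M'⦄
    (ha : a ∈ localizationGrading 𝒜 S (Algebra.linearMap A (Localization S)) 𝒜
      (fun _ _ _ _ h h' => SetLike.GradedMul.mul_mem h h') i)
    (hy : y ∈ localizationGrading 𝒜 S f ℳ hℳ j) :
    a • y ∈ localizationGrading 𝒜 S f ℳ hℳ (i + j) := by
  obtain ⟨k, s, hs, hsk, b, hb, h⟩ := ha
  obtain ⟨l, t, ht, htl, m, hm, h'⟩ := hy
  refine ⟨k + l, s * t, S.mul_mem hs ht, SetLike.GradedMul.mul_mem hsk htl, b • m, ?_, ?_⟩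
  · have := hℳ hb hm
    rwa [show i + k + (j + l) = i + j + (k + l) by ring] at this
  · rw [mul_smul, smul_comm t a y, h', ← smul_assoc, h, Algebra.linearMap_apply,
      algebraMap_smul, map_smul]

end Localization

section AtPrime

variable {A : Type u} [CommRing A] (𝒜 : ℤ → AddSubgroup A) [GradedRing 𝒜] (p : Ideal A) [p.IsPrime]

/-- The multiplicative set of homogeneous elements outside a prime ideal `p`. -/
def homogeneousCompl : Submonoid A := SetLike.homogeneousSubmonoid 𝒜 ⊓ p.primeCompl

/-- The homogeneous localization `A_p` of a graded ring at a (homogeneous) prime `p`: all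
homogeneous elements outside `p` are inverted, and all degrees are kept. -/
abbrev GradedLocalization : Type u := Localization (homogeneousCompl 𝒜 p)

/-- The grading of `A_p`. -/
def GradedLocalization.grading : ℤ → AddSubgroup (GradedLocalization 𝒜 p) :=
  localizationGrading 𝒜 (homogeneousCompl 𝒜 p) (Algebra.linearMap A (GradedLocalization 𝒜 p)) 𝒜
    fun _ _ _ _ h h' => SetLike.GradedMul.mul_mem h h'

noncomputable instance : GradedRing (GradedLocalization.grading 𝒜 p) where
  one_mem := ⟨0, 1, one_mem _, SetLike.GradedOne.one_mem, 1,
    by simpa using SetLike.GradedOne.one_mem (A := 𝒜), by simp⟩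
  mul_mem _ _ _ _ h h' := localizationGrading_smul_mem 𝒜 _ _ h h'
  toDecomposition := (localizationGrading_isInternal 𝒜 (S := homogeneousCompl 𝒜 p) _ _
    (fun _ h => h.1) (DirectSum.Decomposition.isInternal 𝒜)).chooseDecomposition

/-- The DG `A_p`-module `M ⊗_A A_p`, with differential `d ⊗ A_p`.  Since `A_p` is flat over `A`,
this functor preserves quasi-isomorphisms and so it also is the derived tensor product. -/
noncomputable def DGModule.localization (M : DGModule 𝒜) :
    DGModule (GradedLocalization.grading 𝒜 p) where
  carrier := GradedLocalization 𝒜 p ⊗[A] M.carrier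
  grading := localizationGrading 𝒜 (homogeneousCompl 𝒜 p)
    (TensorProduct.mk A (GradedLocalization 𝒜 p) M.carrier 1) M.grading M.smul_mem
  isInternal := localizationGrading_isInternal 𝒜 (S := homogeneousCompl 𝒜 p) _ _
    (fun _ h => h.1) M.isInternal
  smul_mem _ _ _ _ h h' := localizationGrading_smul_mem 𝒜 _ _ h h'
  d := M.d.baseChange (GradedLocalization 𝒜 p)
  d_mem := by
    rintro n x ⟨i, s, hs, hsi, m, hm, h⟩
    refine ⟨i, s, hs, hsi, M.d m, ?_, ?_⟩
    · have := M.d_mem hm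
      rwa [show n + i - 1 = n - 1 + i by ring] at this
    · rw [← LinearMap.map_smul_of_tower, h]
      simp
  d_d x := by
    rw [← LinearMap.comp_apply, ← LinearMap.baseChange_comp,
      show M.d ∘ₗ M.d = 0 from LinearMap.ext M.d_d, LinearMap.baseChange_zero, LinearMap.zero_apply]

end AtPrime

/-! ## Supports -/

section Support

variable {R : Type u} [CommRing R] (𝒜 : ℤ → AddSubgroup R) [GradedRing 𝒜]

/-- The homogeneous spectrum: the set of homogeneous prime ideals of a graded ring. -/
def homogeneousSpectrum : Set (PrimeSpectrum R) := {p | p.asIdeal.IsHomogeneous 𝒜}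

/-- The singular support of a DG module `M`: the set of homogeneous primes `p` for which
`M ⊗_R R_p` is not a small object of `D(R_p)`. -/
def singularSupport (M : DGModule 𝒜) : Set (PrimeSpectrum R) :=
  {p | p ∈ homogeneousSpectrum 𝒜 ∧
    ¬ IsSmallObject.{u} (DGModule.toDerived _ (M.localization 𝒜 p.asIdeal))}

/-- The support of the singularity category of `R`: the union of the singular supports of all its
objects, which are the coefficient-finitely generated DG modules. -/
def singularityCategorySupport : Set (PrimeSpectrum R) :=
  ⋃ X : SingularityCategory 𝒜, singularSupport 𝒜 X.toDGModule

/-- The singular locus of a Noetherian commutative ring: the set of the primes `p` for which the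
(ungraded) local ring `R_p` is not regular. -/
def singularLocus (R : Type u) [CommRing R] : Set (PrimeSpectrum R) :=
  {p | ¬ IsRegularLocalRing (Localization.AtPrime p.asIdeal)}

end Support

/-!
For a homogeneous prime `p` of `R`, write `A = R_(p)` for the homogeneous localization and `m` for
the extension of `p` to `A`. The homogeneous elements of `A` outside `m` are units, and the
ungraded localization `A_m` is `R_p` (`GradedLocalization.isUnit_of_notMem_extension`,
`GradedLocalization.nonempty_localization_ringEquiv`). So everything comes down to the statement
that `A_m` is regular if and only if all coefficient-finitely generated DG `A`-modules (or just
`A ⧸ m`) are small in `D(A)`.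

Morphisms in `D(A)` are controlled by K-projective DG modules: if `P` is K-projective, morphisms
from `P` in `D(A)` are homotopy classes of morphisms of DG modules (`KProjective.exists_map_eq`,
`KProjective.homotopic`). Semifree DG modules are K-projective, and each DG module has a semifree
resolution (`Cell.quasiIso_resolutionMap`). Direct sums are therefore coproducts in `D(A)`
(`nonempty_isColimit_derivedCofan`), and a K-projective DG module that is finitely generated as a
module is small (`KProjective.isSmallObject`).

If `A_m` is regular, then `H(N)_m` has finite projective dimension for each DG module `N` with
finitely generated homology. By induction on this projective dimension, `N` has a finitely generated
K-projective resolution, so it is small (`exists_finite_kProjective_resolution`). The induction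
step covers `N` by a free DG module `F` that is surjective on homology: the homology of the cone of
`F ⟶ N` is the syzygy of `H(N)`. In the initial case `H(N)_m` is projective. For an irredundant
set of homogeneous generators of `H(N)`, all coefficients of relations lie in `m`, because
homogeneous elements outside `m` are units; hence the relations vanish in the localization at `m`
by Nakayama's lemma, and thus they vanish, as homogeneous elements are not killed by elements
outside `m`. So `H(N)` is free and `F ⟶ N` is a quasi-isomorphism.

Conversely, let `N` be a graded module with zero differential that is small in `D(A)`. The total
complex `P` of a graded free resolution of `N` is K-projective and quasi-isomorphic to `N`. For
each `j`, the resolution gives a morphism from `P` to a shift of the `j`-th syzygy `Z j` of `N`, and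
together these form a morphism from `P` to the direct sum of the shifted syzygies. As `P` is small,
almost all of its components are null-homotopic. A null-homotopy of the component at `j + 1` is a
retraction of the inclusion of `Z (j + 1)` in a free module, so `Z (j + 1)` is projective and `N` has
finite projective dimension (`exists_pdLE_of_isSmallObject`). For `N = A ⧸ m`, Serre's criterion
(`isRegularLocalRing_of_pdLE_residueField`) shows that `A_m` is regular.

The two facts about regular local rings, namely that all finitely generated modules have finite
projective dimension and Serre's converse, are proved by induction on the number of generators of
the maximal ideal, passing to the quotient by an element of `𝔪 ∖ 𝔪²`.
-/

/-! ### Projective dimension -/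

section ProjectiveDimension

variable {S : Type u} [CommRing S]

variable (S) in
/-- The `S`-module `M` has projective dimension at most `n`. -/
abbrev PdLE (M : Type u) [AddCommGroup M] [Module S M] (n : ℕ) : Prop :=
  HasProjectiveDimensionLE (ModuleCat.of S M) n

variable {K F M N : Type u} [AddCommGroup K] [Module S K] [AddCommGroup F] [Module S F]
  [AddCommGroup M] [Module S M] [AddCommGroup N] [Module S N]

theorem pdLE_zero_iff : PdLE S M 0 ↔ Module.Projective S M := by
  rw [PdLE, ← projective_iff_hasProjectiveDimensionLE_zero, ← IsProjective.iff_projective]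

theorem PdLE.of_equiv {n : ℕ} (h : PdLE S M n) (e : M ≃ₗ[S] N) : PdLE S N n :=
  hasProjectiveDimensionLT_of_iso e.toModuleIso (n + 1)

theorem PdLE.of_retract {n : ℕ} (h : PdLE S N n) (i : M →ₗ[S] N) (r : N →ₗ[S] M)
    (hri : r ∘ₗ i = LinearMap.id) : PdLE S M n :=
  Retract.hasProjectiveDimensionLT (Y := ModuleCat.of S N)
    ⟨ModuleCat.ofHom i, ModuleCat.ofHom r, by
      rw [← ModuleCat.ofHom_comp, hri]; rfl⟩ (n + 1)

theorem PdLE.mono {m n : ℕ} (h : PdLE S M m) (hmn : m ≤ n) : PdLE S M n :=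
  hasProjectiveDimensionLT_of_ge _ (m + 1) (n + 1) (by omega)

theorem pdLE_succ_iff_of_exact [Module.Projective S F] {n : ℕ} {i : K →ₗ[S] F} {f : F →ₗ[S] M}
    (hi : Function.Injective i) (hif : Function.Exact i f) (hf : Function.Surjective f) :
    PdLE S M (n + 1) ↔ PdLE S K n := by
  let T : ShortComplex (ModuleCat.{u} S) :=
    ShortComplex.mk (ModuleCat.ofHom i) (ModuleCat.ofHom f) (by
      rw [← ModuleCat.ofHom_comp, hif.linearMap_comp_eq_zero]; rfl)
  have hT : T.ShortExact :=
    { exact := (ShortComplex.ShortExact.moduleCat_exact_iff_function_exact _).mpr hif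
      mono_f := (ModuleCat.mono_iff_injective _).mpr hi
      epi_g := (ModuleCat.epi_iff_surjective _).mpr hf }
  exact hT.hasProjectiveDimensionLT_X₃_iff n ((IsProjective.iff_projective F).mp inferInstance)

theorem pdLE_succ_iff [Module.Projective S F] {n : ℕ} {f : F →ₗ[S] M}
    (hf : Function.Surjective f) : PdLE S M (n + 1) ↔ PdLE S (LinearMap.ker f) n :=
  pdLE_succ_iff_of_exact (Submodule.injective_subtype _)
    (LinearMap.exact_subtype_ker_map f) hf

/-- Flat base change does not increase the projective dimension. -/
theorem PdLE.baseChange (T : Type u) [CommRing T] [Algebra S T] [Module.Flat S T] {n : ℕ}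
    (h : PdLE S M n) : PdLE T (T ⊗[S] M) n := by
  induction n generalizing M with
  | zero =>
    have := pdLE_zero_iff.mp h
    exact pdLE_zero_iff.mpr inferInstance
  | succ n ih =>
    let f : (M →₀ S) →ₗ[S] M := Finsupp.linearCombination S id
    have hf : Function.Surjective f := Finsupp.linearCombination_id_surjective S M
    refine (pdLE_succ_iff_of_exact (i := (LinearMap.ker f).subtype.baseChange T)
      (f := f.baseChange T) ?_ ?_ ?_).mpr (ih ((pdLE_succ_iff hf).mp h))
    · exact Module.Flat.lTensor_preserves_injective_linearMap _ (Submodule.injective_subtype _)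
    · have hex := Module.Flat.lTensor_exact T (N := LinearMap.ker f) (LinearMap.exact_subtype_ker_map f)
      exact hex
    · exact LinearMap.lTensor_surjective T hf

end ProjectiveDimension

/-! ### Quotients of local rings by elements of the maximal ideal -/

section LocalQuotient

open IsLocalRing Pointwise

variable {S : Type u} [CommRing S] [IsLocalRing S]

theorem map_maximalIdeal_quotient {x : S} [IsLocalRing (S ⧸ Ideal.span {x})] :
    (maximalIdeal S).map (Ideal.Quotient.mk (Ideal.span {x})) =
      maximalIdeal (S ⧸ Ideal.span {x}) := by
  have hmax := Ideal.comap_isMaximal_of_surjective (Ideal.Quotient.mk (Ideal.span {x}))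
    Ideal.Quotient.mk_surjective (K := maximalIdeal (S ⧸ Ideal.span {x}))
  rw [← IsLocalRing.eq_maximalIdeal hmax,
    Ideal.map_comap_of_surjective _ Ideal.Quotient.mk_surjective]

theorem isLocalRing_quotient_span_singleton {x : S} (hx : x ∈ maximalIdeal S) :
    IsLocalRing (S ⧸ Ideal.span {x}) :=
  have : Nontrivial (S ⧸ Ideal.span {x}) :=
    Ideal.Quotient.nontrivial_iff.mpr (by rwa [Ne, Ideal.span_singleton_eq_top])
  IsLocalRing.of_surjective' (Ideal.Quotient.mk _) Ideal.Quotient.mk_surjective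

variable [IsNoetherianRing S]

/-- Reduction modulo a regular element preserves the projective dimension: a finitely generated
module `M` is free if and only if `M ⧸ xM` is, and reduction preserves short exact sequences of
modules on which `x` is regular. -/
theorem pdLE_quotSMulTop_iff {x : S} (hx : x ∈ maximalIdeal S) (hxS : IsSMulRegular S x)
    {M : Type u} [AddCommGroup M] [Module S M] [Module.Finite S M] (hxM : IsSMulRegular M x)
    {n : ℕ} : PdLE (S ⧸ Ideal.span {x}) (QuotSMulTop x M) n ↔ PdLE S M n := by
  have hntS : Nontrivial (S ⧸ Ideal.span {x}) :=
    Ideal.Quotient.nontrivial_iff.mpr (by rwa [Ne, Ideal.span_singleton_eq_top])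
  have hloc : IsLocalRing (S ⧸ Ideal.span {x}) :=
    IsLocalRing.of_surjective' (Ideal.Quotient.mk _) Ideal.Quotient.mk_surjective
  induction n generalizing M with
  | zero =>
    have hfp : Module.FinitePresentation S M := Module.finitePresentation_of_finite S M
    have hfin : Module.Finite (S ⧸ Ideal.span {x}) (QuotSMulTop x M) :=
      Module.Finite.of_restrictScalars_finite S _ _
    rw [pdLE_zero_iff, pdLE_zero_iff]
    have key := Module.free_quotSMulTop_iff_free S M (x := x)
      (IsLocalRing.maximalIdeal_le_jacobson _ hx) hxM
    constructor
    · intro h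
      have hfp' : Module.FinitePresentation (S ⧸ Ideal.span {x}) (QuotSMulTop x M) :=
        Module.finitePresentation_of_finite _ _
      have := key.mp Module.free_of_flat_of_isLocalRing
      infer_instance
    · intro h
      have := key.mpr Module.free_of_flat_of_isLocalRing
      infer_instance
  | succ n ih =>
    obtain ⟨k, f, hf⟩ := Module.Finite.exists_fin' S M
    have hxF : IsSMulRegular (Fin k → S) x := fun a b h =>
      funext fun i => hxS (congrFun h i)
    have hxK : IsSMulRegular (LinearMap.ker f) x :=
      hxF.of_injective (LinearMap.ker f).subtype (Submodule.injective_subtype _)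
    refine Iff.trans ?_ ((ih hxK).trans (pdLE_succ_iff hf).symm)
    have hsurj : Function.Surjective (algebraMap S (S ⧸ Ideal.span {x})) :=
      Ideal.Quotient.mk_surjective
    let i' := (QuotSMulTop.map x (LinearMap.ker f).subtype).extendScalarsOfSurjective hsurj
    let f' := (QuotSMulTop.map x f).extendScalarsOfSurjective hsurj
    refine pdLE_succ_iff_of_exact (i := i') (f := f') ?_ ?_ ?_
    · have h0 : Function.Exact (0 : (⊥ : Submodule S M) →ₗ[S] LinearMap.ker f)
          (LinearMap.ker f).subtype :=
        (LinearMap.exact_zero_iff_injective _ _).mpr (Submodule.injective_subtype _)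
      have h1 := QuotSMulTop.map_first_exact_on_four_term_exact_of_isSMulRegular_last
        h0 (LinearMap.exact_subtype_ker_map f) hxM
      rw [map_zero] at h1
      exact (LinearMap.exact_zero_iff_injective _ _).mp h1
    · exact QuotSMulTop.map_exact x (LinearMap.exact_subtype_ker_map f) hf
    · exact QuotSMulTop.map_surjective x hf

/-- Prime avoidance gives an element of `𝔪 ∖ 𝔪²` outside finitely many primes different
from `𝔪`. -/
theorem exists_mem_maximalIdeal_notMem_sq (hm : maximalIdeal S ≠ ⊥) {P : Set (Ideal S)}
    (hP : P.Finite) (hprime : ∀ p ∈ P, p.IsPrime) (hne : maximalIdeal S ∉ P) :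
    ∃ x ∈ maximalIdeal S, x ∉ maximalIdeal S ^ 2 ∧ ∀ p ∈ P, x ∉ p := by
  have hlt : ¬ maximalIdeal S ≤ maximalIdeal S ^ 2 := fun h => hm <| by
    refine Submodule.eq_bot_of_le_smul_of_le_jacobson_bot (maximalIdeal S) _
      (IsNoetherian.noetherian _) ?_ (IsLocalRing.maximalIdeal_le_jacobson _)
    rwa [smul_eq_mul, ← sq]
  by_contra! hcon
  have hsub : (maximalIdeal S : Set S) ⊆ ⋃ I ∈ insert (maximalIdeal S ^ 2) P, ((id I : Ideal S) : Set S) := by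
    intro x hx
    by_cases hx2 : x ∈ maximalIdeal S ^ 2
    · exact Set.mem_biUnion (Set.mem_insert _ _) hx2
    · obtain ⟨p, hp, hxp⟩ := hcon x hx hx2
      exact Set.mem_biUnion (Set.mem_insert_of_mem _ hp) hxp
  obtain ⟨I, hI, hle⟩ := (Ideal.subset_union_prime_finite (hP.insert _) (maximalIdeal S ^ 2)
    (maximalIdeal S ^ 2) (fun i hi h _ => hprime i (hi.resolve_left h))).mp hsub
  rcases hI with rfl | hI
  · exact hlt hle
  · have := hprime I hI
    have hI' : I = maximalIdeal S :=
      le_antisymm (IsLocalRing.le_maximalIdeal this.ne_top) hle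
    exact hne (hI' ▸ hI)

theorem spanFinrank_maximalIdeal_le_quotient_add_one {x : S} (hx : x ∈ maximalIdeal S)
    [IsLocalRing (S ⧸ Ideal.span {x})] :
    (maximalIdeal S).spanFinrank ≤ (maximalIdeal (S ⧸ Ideal.span {x})).spanFinrank + 1 := by
  classical
  obtain ⟨s, hs, hspan⟩ := (IsNoetherian.noetherian
    (maximalIdeal (S ⧸ Ideal.span {x}))).exists_span_finset_card_eq_spanFinrank
  obtain ⟨g, hg⟩ := (Ideal.Quotient.mk_surjective (I := Ideal.span {x})).hasRightInverse
  -- Lifts of generators of the maximal ideal of the quotient generate `𝔪`, together with `x`.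
  have key : Submodule.span S ((insert x (s.image g) : Finset S) : Set S) = maximalIdeal S := by
    apply le_antisymm
    · rw [Submodule.span_le]
      intro y hy
      rw [Finset.coe_insert, Finset.coe_image, Set.mem_insert_iff] at hy
      rcases hy with rfl | ⟨z, hz, rfl⟩
      · exact hx
      · have : z ∈ maximalIdeal (S ⧸ Ideal.span {x}) := hspan ▸ Submodule.subset_span hz
        rw [← hg z, ← map_maximalIdeal_quotient] at this
        obtain ⟨w, hw, hwz⟩ := (Ideal.mem_map_iff_of_surjective _ Ideal.Quotient.mk_surjective).mp this
        rw [Ideal.Quotient.eq] at hwz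
        have hle : Ideal.span {x} ≤ maximalIdeal S := by
          rwa [Ideal.span_singleton_le_iff_mem]
        exact (Submodule.sub_mem_iff_right _ hw).mp (hle hwz)
    · intro y hy
      have h1 : Ideal.Quotient.mk (Ideal.span {x}) y ∈ Ideal.span (s : Set (S ⧸ Ideal.span {x})) := by
        change _ ∈ Submodule.span _ _
        rw [hspan, ← map_maximalIdeal_quotient]
        exact Ideal.mem_map_of_mem _ hy
      have h2 : Ideal.span (s : Set (S ⧸ Ideal.span {x})) =
          (Ideal.span (g '' s)).map (Ideal.Quotient.mk (Ideal.span {x})) := by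
        rw [Ideal.map_span, ← Set.image_comp, show (⇑(Ideal.Quotient.mk (Ideal.span {x})) ∘ g) = id from
          funext hg, Set.image_id]
      rw [h2] at h1
      obtain ⟨w, hw, hwy⟩ := (Ideal.mem_map_iff_of_surjective _ Ideal.Quotient.mk_surjective).mp h1
      rw [Ideal.Quotient.eq] at hwy
      have h3 : Ideal.span (g '' s) ≤ Submodule.span S ((insert x (s.image g) : Finset S) : Set S) :=
        Submodule.span_mono (by rw [Finset.coe_insert, Finset.coe_image]; exact Set.subset_insert _ _)
      have h4 : Ideal.span {x} ≤ Submodule.span S ((insert x (s.image g) : Finset S) : Set S) :=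
        Submodule.span_mono (by simp)
      exact (Submodule.sub_mem_iff_right _ (h3 hw)).mp (h4 hwy)
  rw [← key]
  refine (Submodule.spanFinrank_span_le_ncard_of_finite (Finset.finite_toSet _)).trans ?_
  rw [Set.ncard_coe_finset, ← hs]
  exact (Finset.card_insert_le _ _).trans (Nat.succ_le_succ Finset.card_image_le)

theorem spanFinrank_maximalIdeal_quotient_add_one_le {x : S} (hx : x ∈ maximalIdeal S)
    (hx2 : x ∉ maximalIdeal S ^ 2) [IsLocalRing (S ⧸ Ideal.span {x})] :
    (maximalIdeal (S ⧸ Ideal.span {x})).spanFinrank + 1 ≤ (maximalIdeal S).spanFinrank := by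
  classical
  -- Extend the class of `x` to a basis of the cotangent space, and lift it to generators of `𝔪`.
  let c := (maximalIdeal S).toCotangent
  have hc0 : c ⟨x, hx⟩ ≠ 0 := fun h => hx2 ((Ideal.toCotangent_eq_zero _ _).mp h)
  have hli : LinearIndepOn (ResidueField S) id ({c ⟨x, hx⟩} : Set (CotangentSpace S)) :=
    LinearIndepOn.singleton hc0
  let B := hli.extend (Set.subset_univ _)
  let b : Module.Basis B (ResidueField S) (CotangentSpace S) := Module.Basis.extend hli
  have hB : B.Finite := Module.Finite.finite_basis b
  have hcard : B.ncard = (maximalIdeal S).spanFinrank := by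
    rw [spanFinrank_maximalIdeal_eq_finrank_cotangentSpace, Module.finrank_eq_nat_card_basis b]
    rfl
  have hxB : c ⟨x, hx⟩ ∈ B := hli.subset_extend _ rfl
  have hlift : ∀ v : CotangentSpace S, ∃ y, c y = v ∧ (v = c ⟨x, hx⟩ → y = ⟨x, hx⟩) := fun v => by
    by_cases hv : v = c ⟨x, hx⟩
    · exact ⟨_, hv.symm, fun _ => rfl⟩
    · obtain ⟨y, hy⟩ := (maximalIdeal S).toCotangent_surjective v
      exact ⟨y, hy, fun h => (hv h).elim⟩
  choose g hg hgx using hlift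
  have hspanB : Submodule.span (ResidueField S) (c '' (g '' B)) = ⊤ := by
    rw [← Set.image_comp, show (⇑c ∘ g) = id from funext hg, Set.image_id,
      ← b.span_eq]
    congr 1
    ext v
    simp [b, B]
  have hspan : Submodule.span S (g '' B) = ⊤ := CotangentSpace.span_image_eq_top_iff.mp hspanB
  have hspan' : Ideal.span ((fun v => (g v : S)) '' B) = maximalIdeal S := by
    have := congrArg (Submodule.map (maximalIdeal S).subtype) hspan
    rw [Submodule.map_span, Submodule.map_top, Submodule.range_subtype, ← Set.image_comp] at this
    exact this
  -- The lift of the basis vector of `x` is `x`, which vanishes in the quotient.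
  have key : maximalIdeal (S ⧸ Ideal.span {x}) = Submodule.span (S ⧸ Ideal.span {x})
      ((fun v => Ideal.Quotient.mk (Ideal.span {x}) (g v : S)) '' (B \ {c ⟨x, hx⟩})) := by
    have h := map_maximalIdeal_quotient (x := x)
    rw [← hspan', Ideal.map_span, ← Set.image_comp] at h
    refine h.symm.trans ?_
    apply le_antisymm
    · refine Submodule.span_le.mpr ?_
      rintro _ ⟨v, hv, rfl⟩
      by_cases hvx : v = c ⟨x, hx⟩
      · have : Ideal.Quotient.mk (Ideal.span {x}) (g v : S) = 0 := by
          rw [hgx v hvx]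
          exact Ideal.Quotient.eq_zero_iff_mem.mpr (Ideal.mem_span_singleton_self x)
        change Ideal.Quotient.mk (Ideal.span {x}) (g v : S) ∈ _
        rw [this]
        exact zero_mem _
      · exact Submodule.subset_span ⟨v, ⟨hv, hvx⟩, rfl⟩
    · exact Submodule.span_mono (Set.image_mono Set.sdiff_subset)
  rw [key, ← hcard, ← Set.ncard_sdiff_singleton_add_one hxB hB]
  have hfin : (B \ {c ⟨x, hx⟩}).Finite := hB.subset Set.sdiff_subset
  exact Nat.succ_le_succ ((Submodule.spanFinrank_span_le_ncard_of_finite (hfin.image _)).trans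
    (Set.ncard_image_le hfin))

end LocalQuotient

/-! ### Minimal generators and free covers -/

/-- A finitely generated module has an irredundant finite set of generators inside each
generating set. -/
theorem exists_irredundant_generators {S M : Type*} [Ring S] [AddCommGroup M] [Module S M]
    [Module.Finite S M] (P : Set M) (hP : Submodule.span S P = ⊤) :
    ∃ T : Finset M, (T : Set M) ⊆ P ∧ Submodule.span S (T : Set M) = ⊤ ∧
      ∀ t ∈ T, t ∉ Submodule.span S ((T : Set M) \ {t}) := by
  classical
  have hfg : (Submodule.span S P).FG := hP ▸ Module.Finite.fg_top
  rw [Submodule.fg_span_iff_fg_span_finset_subset] at hfg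
  have hex : ∃ n, ∃ T : Finset M, (T : Set M) ⊆ P ∧ Submodule.span S (T : Set M) = ⊤ ∧
      T.card = n := by
    obtain ⟨T, hT, hTP⟩ := hfg
    exact ⟨_, T, hT, hTP ▸ hP, rfl⟩
  obtain ⟨T, hT, hspan, hcard⟩ := Nat.find_spec hex
  refine ⟨T, hT, hspan, fun t ht hmem => ?_⟩
  refine Nat.find_min hex (m := (T.erase t).card) ?_ ⟨T.erase t, ?_, ?_, rfl⟩
  · rw [← hcard]
    exact Finset.card_erase_lt_of_mem ht
  · exact (Finset.coe_subset.mpr (Finset.erase_subset t T)).trans hT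
  · rw [Finset.coe_erase, eq_top_iff, ← hspan, Submodule.span_le]
    intro y hy
    by_cases hyt : y = t
    · exact hyt ▸ hmem
    · exact Submodule.subset_span ⟨hy, hyt⟩

section LocalRing

open IsLocalRing

variable {S : Type u} [CommRing S] [IsLocalRing S]

/-- A finitely generated module over a local ring has a finite free cover whose kernel is
contained in `𝔪F`. -/
theorem exists_minimal_cover (M : Type*) [AddCommGroup M] [Module S M] [Module.Finite S M] :
    ∃ (T : Finset M) (f : (T →₀ S) →ₗ[S] M), Function.Surjective f ∧
      ∀ x, f x = 0 → ∀ t, x t ∈ maximalIdeal S := by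
  classical
  obtain ⟨T, -, hspan, hirr⟩ := exists_irredundant_generators (S := S) (Set.univ : Set M)
    Submodule.span_univ
  refine ⟨T, Finsupp.linearCombination S Subtype.val, ?_, fun x hx t => ?_⟩
  · rw [← LinearMap.range_eq_top, Finsupp.range_linearCombination, Subtype.range_val]
    exact hspan
  · by_contra hu
    have hunit : IsUnit (x t) := by simpa using hu
    apply hirr t t.2
    rw [Finsupp.linearCombination_apply, Finsupp.sum,
      ← Finset.add_sum_erase _ _ (Finsupp.mem_support_iff.mpr hunit.ne_zero)] at hx
    rw [← Submodule.smul_mem_iff_of_isUnit _ hunit, eq_neg_of_add_eq_zero_left hx]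
    refine neg_mem (sum_mem fun s hs => Submodule.smul_mem _ _ (Submodule.subset_span ⟨s.2, ?_⟩))
    exact fun h => Finset.ne_of_mem_erase hs (Subtype.ext h)

variable [IsNoetherianRing S]

/-- If the maximal ideal is annihilated by a nonzero element `u`, then each finitely generated
module of finite projective dimension is projective: in projective dimension `1`, the kernel `K` of
a minimal free cover is free, and `uK = 0` because `K` is contained in `𝔪F`. -/
theorem projective_of_pdLE_of_socle {u : S} (hu : u ≠ 0) (hum : ∀ a ∈ maximalIdeal S, u * a = 0)
    {n : ℕ} {M : Type u} [AddCommGroup M] [Module S M] [Module.Finite S M] (h : PdLE S M n) :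
    Module.Projective S M := by
  suffices h1 : ∀ (M : Type u) [AddCommGroup M] [Module S M] [Module.Finite S M],
      PdLE S M 1 → Module.Projective S M by
    induction n generalizing M with
    | zero => exact pdLE_zero_iff.mp h
    | succ n ih =>
      obtain ⟨k, f, hf⟩ := Module.Finite.exists_fin' S M
      exact h1 M ((pdLE_succ_iff hf).mpr (pdLE_zero_iff.mpr (ih ((pdLE_succ_iff hf).mp h))))
  intro M _ _ _ h
  obtain ⟨T, f, hf, hker⟩ := exists_minimal_cover (S := S) M
  have hproj := pdLE_zero_iff.mp ((pdLE_succ_iff hf).mp h)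
  have hfp : Module.FinitePresentation S (LinearMap.ker f) :=
    Module.finitePresentation_of_finite S (LinearMap.ker f)
  have hfree : Module.Free S (LinearMap.ker f) :=
    Module.free_of_flat_of_isLocalRing (R := S) (P := LinearMap.ker f)
  have huker : ∀ x : LinearMap.ker f, u • x = 0 := fun x => by
    ext t
    exact hum _ (hker x.1 x.2 t)
  have hbot : LinearMap.ker f = ⊥ := by
    rw [Submodule.eq_bot_iff]
    intro x hx
    let b := Module.Free.chooseBasis S (LinearMap.ker f)
    have hx0 : b.repr ⟨x, hx⟩ = 0 := by
      ext i
      have := congrArg (fun y => b.repr y i) (huker (b i))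
      simp only [map_smul, Module.Basis.repr_self, map_zero, Finsupp.smul_apply,
        Finsupp.single_eq_same, smul_eq_mul, mul_one, Finsupp.coe_zero, Pi.zero_apply] at this
      exact (hu this).elim
    exact congrArg Subtype.val ((LinearEquiv.map_eq_zero_iff _).mp hx0)
  exact Module.Projective.of_equiv (LinearEquiv.ofBijective f ⟨LinearMap.ker_eq_bot.mp hbot, hf⟩)

theorem maximalIdeal_eq_bot_of_spanFinrank_eq_zero (h : (maximalIdeal S).spanFinrank = 0) :
    maximalIdeal S = ⊥ :=
  (Submodule.spanFinrank_eq_zero_iff_eq_bot (IsNoetherian.noetherian _)).mp h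

theorem ringKrullDim_le_quotient_add_one {x : S} (hx : x ∈ maximalIdeal S) :
    ringKrullDim S ≤ ringKrullDim (S ⧸ Ideal.span {x}) + 1 := by
  have := ringKrullDim_le_ringKrullDim_quotient_add_card {x} (R := S) (by
    rw [IsLocalRing.ringJacobson_eq_maximalIdeal]; simpa using hx)
  rwa [Finset.coe_singleton, Finset.card_singleton, Nat.cast_one] at this

end LocalRing

/-! ### Regular local rings and finite projective dimension -/

section RegularLocal

open IsLocalRing Pointwise

variable {S : Type u} [CommRing S] [IsRegularLocalRing S]

theorem IsRegularLocalRing.quotient_span_singleton {x : S}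
    (hx : x ∈ maximalIdeal S) (hx2 : x ∉ maximalIdeal S ^ 2) :
    IsRegularLocalRing (S ⧸ Ideal.span {x}) := by
  have := isLocalRing_quotient_span_singleton hx
  apply IsRegularLocalRing.of_spanFinrank_maximalIdeal_le
  have h1 : ((maximalIdeal (S ⧸ Ideal.span {x})).spanFinrank + 1 : WithBot ℕ∞) ≤
      ringKrullDim (S ⧸ Ideal.span {x}) + 1 := by
    refine le_trans ?_ (ringKrullDim_le_quotient_add_one hx)
    rw [← IsRegularLocalRing.spanFinrank_maximalIdeal (R := S)]
    exact_mod_cast spanFinrank_maximalIdeal_quotient_add_one_le hx hx2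
  simpa using (ENat.WithBot.add_le_add_natCast_right_iff (c := 1)).mp (by simpa using h1)

/-- Regular local rings are domains. -/
theorem IsRegularLocalRing.isDomain : IsDomain S := by
  induction h : (maximalIdeal S).spanFinrank generalizing S with
  | zero =>
    have := (IsLocalRing.isField_iff_maximalIdeal_eq).mpr
      (maximalIdeal_eq_bot_of_spanFinrank_eq_zero h)
    exact this.isDomain
  | succ n ih =>
    have hm : maximalIdeal S ≠ ⊥ := fun h0 => by simp [h0] at h
    have hmin : maximalIdeal S ∉ minimalPrimes S := fun hmem => by
      rw [← Ideal.height_eq_zero_iff] at hmem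
      have h1 := maximalIdeal_height_eq_ringKrullDim (R := S)
      rw [hmem, ← IsRegularLocalRing.spanFinrank_maximalIdeal, h] at h1
      exact absurd h1 (by norm_cast)
    obtain ⟨x, hx, hx2, hxp⟩ := exists_mem_maximalIdeal_notMem_sq hm
      (minimalPrimes.finite_of_isNoetherianRing S) (fun p hp => hp.isPrime) hmin
    have hreg := IsRegularLocalRing.quotient_span_singleton hx hx2
    have hlt := spanFinrank_maximalIdeal_quotient_add_one_le hx hx2
    have hle := spanFinrank_maximalIdeal_le_quotient_add_one hx
    have hdom : IsDomain (S ⧸ Ideal.span {x}) := ih (by omega)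
    have hprime : (Ideal.span {x}).IsPrime := (Ideal.Quotient.isDomain_iff_prime _).mp hdom
    obtain ⟨q, hq, hqx⟩ := Ideal.exists_minimalPrimes_le (bot_le (a := Ideal.span {x}))
    have hqprime := hq.isPrime
    -- A minimal prime `q` inside `(x)` does not contain `x`, so that `q = xq`.
    have hq0 : q = ⊥ := by
      refine Submodule.eq_bot_of_le_smul_of_le_jacobson_bot (maximalIdeal S) _
        (IsNoetherian.noetherian _) (fun y hy => ?_) (IsLocalRing.maximalIdeal_le_jacobson _)
      obtain ⟨z, rfl⟩ := Ideal.mem_span_singleton'.mp (hqx hy)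
      have hz := (hqprime.mem_or_mem hy).resolve_right (hxp q hq)
      rw [mul_comm]
      exact Submodule.smul_mem_smul hx hz
    have hbot : (⊥ : Ideal S).IsPrime := hq0 ▸ hqprime
    exact IsDomain.of_bot_isPrime S

/-- Finitely generated modules over a regular local ring have finite projective dimension. -/
theorem IsRegularLocalRing.exists_pdLE (M : Type u) [AddCommGroup M]
    [Module S M] [Module.Finite S M] : ∃ n, PdLE S M n := by
  induction h : (maximalIdeal S).spanFinrank generalizing S M with
  | zero =>
    have hf := (IsLocalRing.isField_iff_maximalIdeal_eq).mpr
      (maximalIdeal_eq_bot_of_spanFinrank_eq_zero h)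
    let _ := hf.toField
    refine ⟨0, pdLE_zero_iff.mpr ?_⟩
    exact Module.Projective.of_free
  | succ n ih =>
    have hm : maximalIdeal S ≠ ⊥ := fun h0 => by simp [h0] at h
    obtain ⟨x, hx, hx2, -⟩ := exists_mem_maximalIdeal_notMem_sq hm Set.finite_empty
      (by simp) (by simp)
    have hreg := IsRegularLocalRing.quotient_span_singleton hx hx2
    have hlt := spanFinrank_maximalIdeal_quotient_add_one_le hx hx2
    have hle := spanFinrank_maximalIdeal_le_quotient_add_one hx
    have hdom := IsRegularLocalRing.isDomain (S := S)
    have hx0 : x ≠ 0 := fun h0 => hx2 (h0 ▸ zero_mem _)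
    have hxS : IsSMulRegular S x := fun a b hab => mul_left_cancel₀ hx0 hab
    obtain ⟨k, f, hf⟩ := Module.Finite.exists_fin' S M
    -- The first syzygy of `M` is torsion-free, so its projective dimension can be computed
    -- modulo `x`.
    have hxK : IsSMulRegular (LinearMap.ker f) x := fun a b hab =>
      Subtype.ext (funext fun i => hxS (congrFun (congrArg Subtype.val hab) i))
    have hfin : Module.Finite (S ⧸ Ideal.span {x}) (QuotSMulTop x (LinearMap.ker f)) :=
      Module.Finite.of_restrictScalars_finite S _ _
    obtain ⟨e, he⟩ := ih (QuotSMulTop x (LinearMap.ker f))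
      (S := S ⧸ Ideal.span {x}) (by omega)
    exact ⟨e + 1, (pdLE_succ_iff hf).mpr ((pdLE_quotSMulTop_iff hx hxS hxK).mp he)⟩

end RegularLocal

section SerreCriterion

open IsLocalRing Pointwise

/-- Serre's criterion: a Noetherian local ring is regular if its residue field `k`, here given as a
nonzero cyclic module killed by the maximal ideal, has finite projective dimension. -/
theorem isRegularLocalRing_of_pdLE_residueField {S : Type u} [CommRing S] [IsLocalRing S]
    [IsNoetherianRing S] {k : Type u} [AddCommGroup k] [Module S k] {n : ℕ} (hk : PdLE S k n)
    (c : k) (hspan : ∀ y : k, ∃ a : S, a • c = y) (hmc : ∀ a ∈ maximalIdeal S, a • c = 0)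
    (hc : c ≠ 0) : IsRegularLocalRing S := by
  induction h : (maximalIdeal S).spanFinrank generalizing S k with
  | zero =>
    apply IsRegularLocalRing.of_spanFinrank_maximalIdeal_le
    rw [h]
    exact_mod_cast ringKrullDim_nonneg_of_nontrivial
  | succ r ih =>
    have hm : maximalIdeal S ≠ ⊥ := fun h0 => by simp [h0] at h
    let f : S →ₗ[S] k := LinearMap.toSpanSingleton S k c
    have hf : Function.Surjective f := hspan
    have hker : LinearMap.ker f = maximalIdeal S := by
      refine le_antisymm (fun a ha => ?_) hmc
      by_contra hu
      have hunit : IsUnit a := by simpa using hu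
      exact hc (hunit.smul_eq_zero.mp ha)
    have hfin : Module.Finite S k := Module.Finite.of_surjective f hf
    have hkm : ∀ a ∈ maximalIdeal S, ∀ y : k, a • y = 0 := fun a ha y => by
      obtain ⟨b, rfl⟩ := hspan y
      rw [smul_comm, hmc a ha, smul_zero]
    -- If `𝔪` is an associated prime of `S`, then `k` is projective, hence free, and `𝔪` vanishes.
    have hass : maximalIdeal S ∉ associatedPrimes S S := fun hmem => by
      obtain ⟨-, u, hu⟩ := isAssociatedPrime_iff.mp hmem
      have hu0 : u ≠ 0 := fun h0 => by
        have h1 : (1 : S) ∈ maximalIdeal S := by rw [hu, h0]; simp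
        exact (Ideal.ne_top_iff_one _).mp (maximalIdeal.isMaximal S).ne_top h1
      have hum : ∀ a ∈ maximalIdeal S, u * a = 0 := fun a ha => by
        rw [hu, Submodule.mem_colon_singleton] at ha
        simpa [mul_comm] using ha
      have hproj := projective_of_pdLE_of_socle hu0 hum hk
      have hfp : Module.FinitePresentation S k := Module.finitePresentation_of_finite _ _
      have hfree : Module.Free S k := Module.free_of_flat_of_isLocalRing
      refine hm ((Submodule.eq_bot_iff _).mpr fun a ha => ?_)
      let b := Module.Free.chooseBasis S k
      obtain ⟨i, hi⟩ : ∃ i, b.repr c i ≠ 0 := by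
        by_contra! hcon
        exact hc ((LinearEquiv.map_eq_zero_iff b.repr).mp (Finsupp.ext hcon))
      have := congrArg (fun y => b.repr y i) (hkm a ha (b i))
      simpa using this
    obtain ⟨x, hx, hx2, hxp⟩ := exists_mem_maximalIdeal_notMem_sq hm
      (associatedPrimes.finite S S) (fun p hp => hp.1) hass
    have hxreg : x ∈ nonZeroDivisors S := by
      by_contra hcon
      have h1 : x ∈ (nonZeroDivisors S : Set S)ᶜ := hcon
      rw [← biUnion_associatedPrimes_eq_compl_nonZeroDivisors, Set.mem_iUnion₂] at h1
      obtain ⟨p, hp, hxmem⟩ := h1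
      exact hxp p hp hxmem
    have hxS : IsSMulRegular S x :=
      Module.Flat.isSMulRegular_of_nonZeroDivisors hxreg
    have hloc := isLocalRing_quotient_span_singleton hx
    have hlt := spanFinrank_maximalIdeal_quotient_add_one_le hx hx2
    have hle := spanFinrank_maximalIdeal_le_quotient_add_one hx
    suffices hreg : IsRegularLocalRing (S ⧸ Ideal.span {x}) by
      apply IsRegularLocalRing.of_spanFinrank_maximalIdeal_le
      rw [← ringKrullDim_quotient_span_singleton_succ_eq_ringKrullDim hxS hx,
        ← IsRegularLocalRing.spanFinrank_maximalIdeal (R := S ⧸ Ideal.span {x})]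
      exact_mod_cast hle
    -- The residue field is a direct summand of `𝔪 / x𝔪`: the class of `x` spans a copy of it, and
    -- a linear form on the cotangent space with value `1` at `x` splits the inclusion.
    have hpdm : PdLE S (maximalIdeal S) n :=
      ((pdLE_succ_iff hf).mp (hk.mono (Nat.le_succ n))).of_equiv (LinearEquiv.ofEq _ _ hker)
    have hxm : IsSMulRegular (maximalIdeal S) x := fun a b hab =>
      Subtype.ext (hxS (congrArg Subtype.val hab))
    have hpdq := (pdLE_quotSMulTop_iff hx hxS hxm).mpr hpdm
    let xq : QuotSMulTop x (maximalIdeal S) := Submodule.Quotient.mk ⟨x, hx⟩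
    have hxq : ∀ a ∈ maximalIdeal S, a • xq = 0 := fun a ha => by
      rw [← Submodule.Quotient.mk_smul, Submodule.Quotient.mk_eq_zero]
      exact (Submodule.mem_smul_pointwise_iff_exists _ _ _).mpr
        ⟨⟨a, ha⟩, trivial, Subtype.ext (mul_comm x a)⟩
    have hle' : LinearMap.ker f ≤ LinearMap.ker (LinearMap.toSpanSingleton S _ xq) :=
      fun a ha => hxq a (hker ▸ ha)
    let i : k →ₗ[S] QuotSMulTop x (maximalIdeal S) :=
      (LinearMap.ker f).liftQ _ hle' ∘ₗ (f.quotKerEquivOfSurjective hf).symm.toLinearMap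
    have hic : i c = xq := by
      have h1 : (f.quotKerEquivOfSurjective hf).symm c = Submodule.Quotient.mk 1 := by
        rw [LinearEquiv.symm_apply_eq]
        exact (one_smul S c).symm
      change (LinearMap.ker f).liftQ _ hle' ((f.quotKerEquivOfSurjective hf).symm c) = xq
      rw [h1, Submodule.liftQ_apply]
      exact one_smul S xq
    obtain ⟨φ, hφ⟩ : ∃ φ : Module.Dual (ResidueField S) (CotangentSpace S),
        φ ((maximalIdeal S).toCotangent ⟨x, hx⟩) = 1 := by
      have hne : (maximalIdeal S).toCotangent ⟨x, hx⟩ ≠ 0 := fun h0 =>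
        hx2 ((Ideal.toCotangent_eq_zero _ _).mp h0)
      obtain ⟨ψ, hψ⟩ : ∃ ψ : Module.Dual (ResidueField S) (CotangentSpace S),
          ψ ((maximalIdeal S).toCotangent ⟨x, hx⟩) ≠ 0 := by
        by_contra! hcon
        exact hne ((Module.forall_dual_apply_eq_zero_iff (ResidueField S) _).mp hcon)
      exact ⟨(ψ ((maximalIdeal S).toCotangent ⟨x, hx⟩))⁻¹ • ψ, by simp [hψ]⟩
    let g : ResidueField S →ₗ[S] k := (maximalIdeal S).liftQ f hker.ge
    let ρ : maximalIdeal S →ₗ[S] k :=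
      g ∘ₗ φ.restrictScalars S ∘ₗ (maximalIdeal S).toCotangent
    let r : QuotSMulTop x (maximalIdeal S) →ₗ[S] k := (x • (⊤ : Submodule S (maximalIdeal S))).liftQ ρ
      fun y hy => by
        obtain ⟨z, -, rfl⟩ := (Submodule.mem_smul_pointwise_iff_exists _ _ _).mp hy
        rw [LinearMap.mem_ker, map_smul, hkm x hx]
    have hrx : r xq = c := by
      have : ρ ⟨x, hx⟩ = g (φ ((maximalIdeal S).toCotangent ⟨x, hx⟩)) := rfl
      change ρ ⟨x, hx⟩ = c
      rw [this, hφ]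
      exact one_smul S c
    have hkx : (x • (⊤ : Submodule S k)) ≤ LinearMap.ker i := fun y hy => by
      obtain ⟨z, -, rfl⟩ := (Submodule.mem_smul_pointwise_iff_exists _ _ _).mp hy
      rw [LinearMap.mem_ker, hkm x hx, map_zero]
    have hsurj : Function.Surjective (algebraMap S (S ⧸ Ideal.span {x})) :=
      Ideal.Quotient.mk_surjective
    let i' : QuotSMulTop x k →ₗ[S] QuotSMulTop x (maximalIdeal S) :=
      (x • (⊤ : Submodule S k)).liftQ i hkx
    let r' : QuotSMulTop x (maximalIdeal S) →ₗ[S] QuotSMulTop x k := Submodule.mkQ _ ∘ₗ r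
    have hri : ∀ y, r' (i' y) = y := fun y => by
      obtain ⟨y, rfl⟩ := Submodule.Quotient.mk_surjective _ y
      obtain ⟨a, rfl⟩ := hspan y
      change Submodule.Quotient.mk (r (i (a • c))) = _
      rw [map_smul, map_smul, hic, hrx]
    refine ih (k := QuotSMulTop x k)
      (hpdq.of_retract (i'.extendScalarsOfSurjective hsurj) (r'.extendScalarsOfSurjective hsurj)
        (LinearMap.ext hri)) (Submodule.Quotient.mk c) ?_ ?_ ?_ (by omega)
    · intro y
      obtain ⟨y, rfl⟩ := Submodule.Quotient.mk_surjective _ y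
      obtain ⟨a, rfl⟩ := hspan y
      exact ⟨Ideal.Quotient.mk _ a, rfl⟩
    · intro a ha
      rw [← map_maximalIdeal_quotient] at ha
      obtain ⟨b, hb, rfl⟩ := (Ideal.mem_map_iff_of_surjective _ Ideal.Quotient.mk_surjective).mp ha
      change Submodule.Quotient.mk (b • c) = _
      rw [hmc b hb, Submodule.Quotient.mk_zero]
    · intro h0
      rw [Submodule.Quotient.mk_eq_zero] at h0
      obtain ⟨z, -, hz⟩ := (Submodule.mem_smul_pointwise_iff_exists _ _ _).mp h0
      exact hc (by rw [← hz, hkm x hx])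

end SerreCriterion

/-! ### Gradings -/

section Internal

/-- A family of subgroups that spans a group `X` is internal if there are jointly injective
homomorphisms from `X` to graded groups that respect the degrees up to shifts. -/
theorem isInternal_of_jointly_injective {X : Type*} [AddCommGroup X] (𝒳 : ℤ → AddSubgroup X)
    {κ : Type*} {Y : κ → Type*} [∀ k, AddCommGroup (Y k)] (𝒴 : ∀ k, ℤ → AddSubgroup (Y k))
    (h𝒴 : ∀ k, DirectSum.IsInternal (𝒴 k)) (s : κ → ℤ) (e : ∀ k, X →+ Y k)
    (he : ∀ k n x, x ∈ 𝒳 n → e k x ∈ 𝒴 k (n + s k)) (hinj : ∀ x, (∀ k, e k x = 0) → x = 0)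
    (hspan : ∀ x, x ∈ ⨆ n, 𝒳 n) : DirectSum.IsInternal 𝒳 := by
  classical
  refine ⟨(injective_iff_map_eq_zero _).mpr fun z hz => ?_, fun x => ?_⟩
  · ext n : 2
    by_cases hn : n ∈ z.support
    · refine hinj _ fun k => ?_
      let _ := (h𝒴 k).chooseDecomposition
      rw [DirectSum.coeAddMonoidHom_eq_dfinsuppSum, DFinsupp.sum] at hz
      have h1 := congrArg (fun w => ((DirectSum.decompose (𝒴 k) (e k w) (n + s k) : 𝒴 k _) : Y k)) hz
      simp only [map_sum, map_zero, DirectSum.decompose_sum, DirectSum.sum_apply,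
        AddSubmonoidClass.coe_finsetSum, DirectSum.decompose_zero,
        DirectSum.zero_apply, ZeroMemClass.coe_zero] at h1
      rwa [Finset.sum_eq_single_of_mem n hn fun j _ hjn =>
        DirectSum.decompose_of_mem_ne (𝒴 k) (he k j _ (z j).2) (by omega),
        DirectSum.decompose_of_mem_same (𝒴 k) (he k n _ (z n).2)] at h1
    · simpa using hn
  · have h : (⨆ n, 𝒳 n) ≤ (DirectSum.coeAddMonoidHom 𝒳).range :=
      iSup_le fun n x hx => ⟨DirectSum.of (fun n => 𝒳 n) n ⟨x, hx⟩,
        DirectSum.coeAddMonoidHom_of _ _ _⟩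
    exact h (hspan x)

theorem iSup_eq_top_of_isInternal {X : Type*} [AddCommGroup X] {𝒳 : ℤ → AddSubgroup X}
    (h : DirectSum.IsInternal 𝒳) : ⨆ n, 𝒳 n = ⊤ := by
  classical
  rw [eq_top_iff]
  intro x _
  let _ := h.chooseDecomposition
  rw [← DirectSum.sum_support_decompose 𝒳 x]
  exact sum_mem fun n _ => AddSubgroup.mem_iSup_of_mem n (SetLike.coe_mem _)

theorem isInternal_shift {X : Type*} [AddCommGroup X] {𝒳 : ℤ → AddSubgroup X}
    (h : DirectSum.IsInternal 𝒳) (s : ℤ) : DirectSum.IsInternal fun n => 𝒳 (n + s) := by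
  refine isInternal_of_jointly_injective _ (fun _ : Unit => 𝒳) (fun _ => h) (fun _ => s)
    (fun _ => AddMonoidHom.id X) (fun _ _ _ hx => hx) (fun x hx => hx ()) fun x => ?_
  have hle : (⨆ n, 𝒳 n) ≤ ⨆ n, 𝒳 (n + s) := iSup_le fun n =>
    le_iSup_of_le (f := fun n => 𝒳 (n + s)) (n - s) (by simp)
  exact hle (iSup_eq_top_of_isInternal h ▸ AddSubgroup.mem_top x)

theorem prod_isInternal_shift {X Y : Type*} [AddCommGroup X] [AddCommGroup Y]
    {𝒳 : ℤ → AddSubgroup X} {𝒴 : ℤ → AddSubgroup Y} (hX : DirectSum.IsInternal 𝒳)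
    (hY : DirectSum.IsInternal 𝒴) (s : ℤ) :
    DirectSum.IsInternal fun n : ℤ => (𝒳 n).prod (𝒴 (n + s)) := by
  have h := DGModule.prod_isInternal hX (isInternal_shift hY (s + 1))
  have he : (fun n : ℤ => (𝒳 n).prod (𝒴 (n - 1 + (s + 1)))) =
      fun n : ℤ => (𝒳 n).prod (𝒴 (n + s)) :=
    funext fun n => by rw [show n - 1 + (s + 1) = n + s by ring]
  exact he ▸ h

end Internal

namespace DGModule

/-! ### Homogeneous components -/

section Components

variable {A : Type u} [CommRing A] {𝒜 : ℤ → AddSubgroup A} [GradedRing 𝒜]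

/-- The component of degree `n` of an element of a DG module. -/
noncomputable def proj (M : DGModule 𝒜) (n : ℤ) : M.carrier →+ M.carrier :=
  letI := M.isInternal.chooseDecomposition
  (M.grading n).subtype.comp ((DirectSum.component ℕ ℤ (fun i => M.grading i) n).toAddMonoidHom.comp
    (DirectSum.decomposeAddEquiv M.grading).toAddMonoidHom)

variable (M N : DGModule 𝒜)

theorem proj_mem (n : ℤ) (x : M.carrier) : M.proj n x ∈ M.grading n :=
  SetLike.coe_mem _

variable {M N}

theorem proj_of_mem {n : ℤ} {x : M.carrier} (hx : x ∈ M.grading n) : M.proj n x = x :=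
  letI := M.isInternal.chooseDecomposition
  DirectSum.decompose_of_mem_same M.grading hx

theorem proj_of_mem_ne {m n : ℤ} {x : M.carrier} (hx : x ∈ M.grading m) (h : m ≠ n) :
    M.proj n x = 0 :=
  letI := M.isInternal.chooseDecomposition
  DirectSum.decompose_of_mem_ne M.grading hx h

theorem iSup_grading (M : DGModule 𝒜) : ⨆ n, M.grading n = ⊤ :=
  iSup_eq_top_of_isInternal M.isInternal

@[elab_as_elim]
theorem homogeneous_induction {p : M.carrier → Prop} (x : M.carrier) (zero : p 0)
    (hom : ∀ n, ∀ y ∈ M.grading n, p y) (add : ∀ y z, p y → p z → p (y + z)) : p x :=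
  AddSubgroup.iSup_induction M.grading (C := p) (M.iSup_grading ▸ AddSubgroup.mem_top x) hom zero add

/-- Taking components commutes with additive maps of degree `s`. -/
theorem proj_map_of_degree {s : ℤ} (f : M.carrier →+ N.carrier)
    (hf : ∀ n, ∀ x ∈ M.grading n, f x ∈ N.grading (n + s)) (n : ℤ) (x : M.carrier) :
    N.proj (n + s) (f x) = f (M.proj n x) := by
  induction x using homogeneous_induction with
  | zero => simp
  | hom m y hy =>
    by_cases h : m = n
    · subst h
      rw [proj_of_mem hy, proj_of_mem (hf _ _ hy)]
    · rw [proj_of_mem_ne hy h, proj_of_mem_ne (hf _ _ hy) (by omega), map_zero]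
  | add y z hy hz => simp only [map_add, hy, hz]

theorem proj_d (n : ℤ) (x : M.carrier) : M.proj (n - 1) (M.d x) = M.d (M.proj n x) :=
  proj_map_of_degree (s := -1) M.d.toAddMonoidHom (fun _ _ hx => M.d_mem hx) n x

theorem Hom.proj_map (f : Hom M N) (n : ℤ) (x : M.carrier) :
    N.proj n (f.toLinearMap x) = f.toLinearMap (M.proj n x) := by
  simpa using proj_map_of_degree (s := 0) f.toLinearMap.toAddMonoidHom
    (fun _ _ hx => by simpa using f.map_mem hx) n x

theorem exists_finset_sum_proj (x : M.carrier) : ∃ s : Finset ℤ, x = ∑ n ∈ s, M.proj n x := by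
  classical
  let _ := M.isInternal.chooseDecomposition
  exact ⟨_, (DirectSum.sum_support_decompose M.grading x).symm⟩

theorem ext_proj {x y : M.carrier} (h : ∀ n, M.proj n x = M.proj n y) : x = y := by
  obtain ⟨s, hs⟩ := exists_finset_sum_proj (x - y)
  rw [← sub_eq_zero, hs]
  exact Finset.sum_eq_zero fun n _ => by rw [map_sub, h, sub_self]

end Components

/-! ### Shifts, direct sums and semifree DG modules -/

section Constructions

variable {A : Type u} [CommRing A] {𝒜 : ℤ → AddSubgroup A} [GradedRing 𝒜]

/-- The shift of a DG module by `s`, with the sign of the differential changed. -/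
abbrev shift (M : DGModule 𝒜) (s : ℤ) : DGModule 𝒜 where
  carrier := M.carrier
  grading n := M.grading (n + s)
  isInternal := isInternal_shift M.isInternal s
  smul_mem i j a x ha hx := by
    have := M.smul_mem ha hx
    rwa [← add_assoc] at this
  d := -M.d
  d_mem n x hx := by
    have := neg_mem (M.d_mem hx)
    rwa [show n + s - 1 = n - 1 + s by ring] at this
  d_d x := by simp [M.d_d]

section Coprod

variable {J : Type u} (Y : J → DGModule 𝒜)

/-- The direct sum of a family of DG modules. -/
noncomputable abbrev coprod : DGModule 𝒜 where
  carrier := DirectSum J fun j => (Y j).carrier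
  grading n :=
    { carrier := {x | ∀ j, x j ∈ (Y j).grading n}
      zero_mem' := fun j => zero_mem _
      add_mem' := fun hx hy j => add_mem (hx j) (hy j)
      neg_mem' := fun hx j => neg_mem (hx j) }
  isInternal := by
    classical
    refine isInternal_of_jointly_injective _ (fun j => (Y j).grading) (fun j => (Y j).isInternal)
      (fun _ => 0) (fun j => (DirectSum.component ℕ J (fun j => (Y j).carrier) j).toAddMonoidHom)
      (fun j n x hx => by rw [add_zero]; exact hx j) (fun x hx => DFinsupp.ext hx) fun x => ?_
    induction x using DirectSum.induction_on with
    | zero => exact zero_mem _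
    | of j y =>
      induction y using homogeneous_induction with
      | zero => simp
      | hom n y hy =>
        refine AddSubgroup.mem_iSup_of_mem n fun i => ?_
        by_cases h : j = i
        · subst h; rwa [DirectSum.of_eq_same]
        · rw [DirectSum.of_eq_of_ne _ _ _ (Ne.symm h)]; exact zero_mem _
      | add y z hy hz => rw [map_add]; exact add_mem hy hz
    | add x y hx hy => exact add_mem hx hy
  smul_mem i j a x ha hx k := (Y k).smul_mem ha (hx k)
  d := DirectSum.lmap fun j => (Y j).d
  d_mem n x hx j := by
    rw [DirectSum.lmap_apply]
    exact (Y j).d_mem (hx j)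
  d_d x := by
    refine DFinsupp.ext fun j => ?_
    rw [DirectSum.lmap_apply, DirectSum.lmap_apply, (Y j).d_d]
    rfl

theorem coprod_d_apply (x : (coprod Y).carrier) (j : J) : ((coprod Y).d x) j = (Y j).d (x j) :=
  DirectSum.lmap_apply _ _ _

open Classical in
/-- The inclusion of a summand. -/
noncomputable def coprodι (j : J) : Y j ⟶ coprod Y where
  toLinearMap := DirectSum.lof A J (fun j => (Y j).carrier) j
  map_mem n x hx i := by
    by_cases h : j = i
    · subst h; rwa [DirectSum.lof_apply]
    · rw [DirectSum.lof_eq_of, DirectSum.of_eq_of_ne _ _ _ (Ne.symm h)]; exact zero_mem _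
  map_d x := by
    refine DFinsupp.ext fun i => ?_
    rw [coprod_d_apply]
    by_cases h : j = i
    · subst h; rw [DirectSum.lof_apply, DirectSum.lof_apply]
    · rw [DirectSum.lof_eq_of, DirectSum.lof_eq_of, DirectSum.of_eq_of_ne _ _ _ (Ne.symm h),
        DirectSum.of_eq_of_ne _ _ _ (Ne.symm h), map_zero]

variable {Y}

open Classical in
theorem coprod_induction {p : (coprod Y).carrier → Prop} (x : (coprod Y).carrier) (zero : p 0)
    (ι : ∀ j y, p ((coprodι Y j).toLinearMap y)) (add : ∀ y z, p y → p z → p (y + z)) : p x :=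
  DirectSum.induction_on x zero ι add

open Classical in
/-- The linear map out of a direct sum with given restrictions to the summands. -/
noncomputable def coprodLift {X : Type*} [AddCommGroup X] [Module A X]
    (f : ∀ j, (Y j).carrier →ₗ[A] X) : (coprod Y).carrier →ₗ[A] X :=
  DirectSum.toModule A J X f

open Classical in
@[simp]
theorem coprodLift_ι {X : Type*} [AddCommGroup X] [Module A X]
    (f : ∀ j, (Y j).carrier →ₗ[A] X) (j : J) (y : (Y j).carrier) :
    coprodLift f ((coprodι Y j).toLinearMap y) = f j y :=
  DirectSum.toModule_lof A (φ := f) j y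

/-- Linear maps of degree `s` on the summands define a linear map of degree `s`. -/
theorem coprodLift_mem {N : DGModule 𝒜} {s : ℤ} (f : ∀ j, (Y j).carrier →ₗ[A] N.carrier)
    (hf : ∀ j n x, x ∈ (Y j).grading n → f j x ∈ N.grading (n + s)) (n : ℤ)
    (x : (coprod Y).carrier) (hx : x ∈ (coprod Y).grading n) :
    coprodLift f x ∈ N.grading (n + s) := by
  classical
  have hsum : coprodLift f x = ∑ j ∈ DFinsupp.support x, f j (x j) := by
    conv_lhs => rw [← DirectSum.sum_support_of x, map_sum]
    exact Finset.sum_congr rfl fun j _ => coprodLift_ι f j (x j)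
  rw [hsum]
  exact sum_mem fun j _ => hf j n _ (hx j)

/-- The morphism out of a direct sum with given restrictions to the summands. -/
noncomputable def coprodDesc {N : DGModule 𝒜} (f : ∀ j, Y j ⟶ N) : coprod Y ⟶ N where
  toLinearMap := coprodLift fun j => (f j).toLinearMap
  map_mem n x hx := by
    simpa using coprodLift_mem (s := 0) (fun j => (f j).toLinearMap)
      (fun j n x hx => by simpa using (f j).map_mem hx) n x hx
  map_d x := by
    induction x using coprod_induction with
    | zero => simp
    | ι j y => rw [← (coprodι Y j).map_d, coprodLift_ι, coprodLift_ι, (f j).map_d]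
    | add y z hy hz => simp only [map_add, hy, hz]

theorem ι_desc {N : DGModule 𝒜} (f : ∀ j, Y j ⟶ N) (j : J) : coprodι Y j ≫ coprodDesc f = f j :=
  Hom.ext (LinearMap.ext fun y => coprodLift_ι (fun j => (f j).toLinearMap) j y)

end Coprod

section Semifree

variable {J : Type u} (deg : J → ℤ)

variable (𝒜) in
/-- The elements of degree `n` of the free module on homogeneous generators of degrees `deg`. -/
def freeGrading (n : ℤ) : AddSubgroup (J →₀ A) where
  carrier := {x | ∀ j, x j ∈ 𝒜 (n - deg j)}
  zero_mem' := fun _ => zero_mem _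
  add_mem' := fun hx hy j => add_mem (hx j) (hy j)
  neg_mem' := fun hx j => neg_mem (hx j)

theorem single_mem_freeGrading {A : Type u} [CommRing A] {𝒜 : ℤ → AddSubgroup A} {J : Type u}
    (deg : J → ℤ) {n : ℤ} {j : J} {a : A} (ha : a ∈ 𝒜 (n - deg j)) :
    Finsupp.single j a ∈ freeGrading 𝒜 deg n := fun i => by
  classical
  rw [Finsupp.single_apply]
  split_ifs with h
  · exact h ▸ ha
  · exact zero_mem _

theorem freeGrading_isInternal : DirectSum.IsInternal (freeGrading 𝒜 deg) := by
  refine isInternal_of_jointly_injective _ (fun _ => 𝒜)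
    (fun _ => DirectSum.Decomposition.isInternal 𝒜) (fun j => - deg j)
    (fun j => Finsupp.applyAddHom j) (fun j n x hx => hx j) (fun x hx => Finsupp.ext hx) fun x => ?_
  induction x using Finsupp.induction_linear with
  | zero => exact zero_mem _
  | add x y hx hy => exact add_mem hx hy
  | single j a =>
    induction a using DirectSum.Decomposition.inductionOn 𝒜 with
    | zero => simp
    | @homogeneous i a =>
      exact AddSubgroup.mem_iSup_of_mem (i + deg j) (single_mem_freeGrading deg (by simp))
    | add a b ha hb => rw [Finsupp.single_add]; exact add_mem ha hb

theorem linearCombination_mem_grading {N : DGModule 𝒜} {φ : J → N.carrier} {s : ℤ}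
    (hφ : ∀ j, φ j ∈ N.grading (deg j + s)) {n : ℤ} {x : J →₀ A} (hx : x ∈ freeGrading 𝒜 deg n) :
    Finsupp.linearCombination A φ x ∈ N.grading (n + s) := by
  rw [Finsupp.linearCombination_apply]
  refine sum_mem fun j _ => ?_
  have := N.smul_mem (hx j) (hφ j)
  rwa [show n - deg j + (deg j + s) = n + s by ring] at this

/-- The DG module that is free as a graded module, on generators `e j` of degree `deg j`, with
differential `d (e j) = δ j`. -/
noncomputable abbrev semifree (δ : J → (J →₀ A)) (hδ : ∀ j, δ j ∈ freeGrading 𝒜 deg (deg j - 1))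
    (hδδ : ∀ j, Finsupp.linearCombination A δ (δ j) = 0) : DGModule 𝒜 where
  carrier := J →₀ A
  grading := freeGrading 𝒜 deg
  isInternal := freeGrading_isInternal deg
  smul_mem i j a x ha hx k := by
    have := SetLike.GradedMul.mul_mem ha (hx k)
    rwa [show i + (j - deg k) = i + j - deg k by ring] at this
  d := Finsupp.linearCombination A δ
  d_mem n x hx j := by
    rw [Finsupp.linearCombination_apply, Finsupp.sum_apply]
    refine sum_mem fun k _ => ?_
    have := SetLike.GradedMul.mul_mem (hx k) (hδ k j)
    rwa [show n - deg k + (deg k - 1 - deg j) = n - 1 - deg j by ring] at this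
  d_d x := by
    induction x using Finsupp.induction_linear with
    | zero => simp
    | add x y hx hy => simp only [map_add, hx, hy, add_zero]
    | single j a => rw [Finsupp.linearCombination_single, map_smul, hδδ, smul_zero]

variable {deg} {δ : J → (J →₀ A)} {hδ : ∀ j, δ j ∈ freeGrading 𝒜 deg (deg j - 1)}
  {hδδ : ∀ j, Finsupp.linearCombination A δ (δ j) = 0}

/-- The morphism out of a semifree DG module with given values on the generators. -/
noncomputable def semifreeDesc {N : DGModule 𝒜} (φ : J → N.carrier)
    (hφ : ∀ j, φ j ∈ N.grading (deg j))
    (hd : ∀ j, Finsupp.linearCombination A φ (δ j) = N.d (φ j)) :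
    semifree deg δ hδ hδδ ⟶ N where
  toLinearMap := Finsupp.linearCombination A φ
  map_mem n x hx := by
    simpa using linearCombination_mem_grading (s := 0) deg (fun j => by simpa using hφ j) hx
  map_d x := by
    change Finsupp.linearCombination A φ (Finsupp.linearCombination A δ x) = _
    induction x using Finsupp.induction_linear with
    | zero => simp
    | add x y hx hy => simp only [map_add, hx, hy]
    | single j a => simp only [Finsupp.linearCombination_single, map_smul, hd]

end Semifree

end Constructions

/-! ### Quasi-isomorphisms and acyclic cones -/

section QuasiIso

variable {A : Type u} [CommRing A] {𝒜 : ℤ → AddSubgroup A} [GradedRing 𝒜]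

/-- A morphism is a quasi-isomorphism if cycles that become boundaries are boundaries, and each
cycle of the target is the image of a cycle up to a boundary. -/
theorem quasiIso_iff {M N : DGModule 𝒜} (f : M ⟶ N) : quasiIso 𝒜 f ↔
    (∀ x, M.d x = 0 → (∃ y, N.d y = f.toLinearMap x) → ∃ x', M.d x' = x) ∧
      ∀ y, N.d y = 0 → ∃ x, M.d x = 0 ∧ ∃ y', N.d y' = y - f.toLinearMap x := by
  have hM : ∀ x : M.cycles, (Submodule.Quotient.mk x : M.homology) = 0 ↔ ∃ x', M.d x' = x.1 :=
    fun x => Submodule.Quotient.mk_eq_zero _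
  have hN : ∀ x : N.cycles, (Submodule.Quotient.mk x : N.homology) = 0 ↔ ∃ x', N.d x' = x.1 :=
    fun x => Submodule.Quotient.mk_eq_zero _
  have hf : ∀ x : M.cycles, Hom.homologyMap f (Submodule.Quotient.mk x) =
      Submodule.Quotient.mk (Hom.cyclesMap f x) := fun x => rfl
  have h1 : Function.Injective (Hom.homologyMap f) ↔
      ∀ x, M.d x = 0 → (∃ y, N.d y = f.toLinearMap x) → ∃ x', M.d x' = x := by
    rw [injective_iff_map_eq_zero]
    constructor
    · intro h x hx hy
      exact (hM ⟨x, hx⟩).mp (h _ ((hf _).trans ((hN _).mpr hy)))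
    · intro h x hx
      obtain ⟨x, rfl⟩ := Submodule.Quotient.mk_surjective _ x
      exact (hM x).mpr (h x.1 x.2 ((hN _).mp ((hf x).symm.trans hx)))
  have h2 : Function.Surjective (Hom.homologyMap f) ↔
      ∀ y, N.d y = 0 → ∃ x, M.d x = 0 ∧ ∃ y', N.d y' = y - f.toLinearMap x := by
    constructor
    · intro h y hy
      obtain ⟨x, hx⟩ := h (Submodule.Quotient.mk ⟨y, hy⟩)
      obtain ⟨x, rfl⟩ := Submodule.Quotient.mk_surjective _ x
      refine ⟨x.1, x.2, (hN (⟨y, hy⟩ - Hom.cyclesMap f x)).mp ?_⟩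
      rw [Submodule.Quotient.mk_sub, ← hx, hf, sub_self]
    · intro h y
      obtain ⟨y, rfl⟩ := Submodule.Quotient.mk_surjective _ y
      obtain ⟨x, hx, hy⟩ := h y.1 y.2
      refine ⟨Submodule.Quotient.mk ⟨x, hx⟩, ?_⟩
      rw [hf, eq_comm, ← sub_eq_zero, ← Submodule.Quotient.mk_sub]
      exact (hN (y - Hom.cyclesMap f ⟨x, hx⟩)).mpr hy
  exact and_congr h1 h2

/-- A DG module is acyclic if its homology vanishes. -/
def Acyclic (E : DGModule 𝒜) : Prop := ∀ x, E.d x = 0 → ∃ y, E.d y = x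

theorem Acyclic.exists_homogeneous {E : DGModule 𝒜} (hE : Acyclic E) {n : ℤ} {x : E.carrier}
    (hx : x ∈ E.grading n) (hdx : E.d x = 0) : ∃ y ∈ E.grading (n + 1), E.d y = x := by
  obtain ⟨y, hy⟩ := hE x hdx
  refine ⟨E.proj (n + 1) y, E.proj_mem _ _, ?_⟩
  rw [← proj_d, hy, add_sub_cancel_right, proj_of_mem hx]

theorem acyclic_of_homogeneous {E : DGModule 𝒜}
    (h : ∀ n, ∀ x ∈ E.grading n, E.d x = 0 → ∃ y, E.d y = x) : Acyclic E := by
  intro x hx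
  choose y hy using fun n => h n (E.proj n x) (E.proj_mem n x) (by rw [← proj_d, hx, map_zero])
  obtain ⟨s, hs⟩ := exists_finset_sum_proj x
  exact ⟨∑ n ∈ s, y n, by rw [map_sum, hs]; exact Finset.sum_congr rfl fun n _ => hy n⟩

theorem Acyclic.shift {E : DGModule 𝒜} (hE : Acyclic E) (s : ℤ) : Acyclic (E.shift s) := by
  intro x hx
  obtain ⟨y, hy⟩ := hE x (neg_eq_zero.mp hx)
  refine ⟨-y, ?_⟩
  change -(E.d (-y)) = x
  rw [map_neg, neg_neg, hy]

section Cone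

variable {M N : DGModule 𝒜} (f : M ⟶ N)

/-- The element of the mapping cone with given components. -/
def coneMk (y : N.carrier) (x : M.carrier) : (cone f).carrier := (y, x)

/-- The target component of an element of the mapping cone. -/
def coneFst : (cone f).carrier →ₗ[A] N.carrier := LinearMap.fst A N.carrier M.carrier

/-- The source component of an element of the mapping cone. -/
def coneSnd : (cone f).carrier →ₗ[A] M.carrier := LinearMap.snd A N.carrier M.carrier

@[simp] theorem coneFst_mk (y : N.carrier) (x : M.carrier) : coneFst f (coneMk f y x) = y := rfl

@[simp] theorem coneSnd_mk (y : N.carrier) (x : M.carrier) : coneSnd f (coneMk f y x) = x := rfl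

@[simp] theorem coneFst_d (z : (cone f).carrier) :
    coneFst f ((cone f).d z) = N.d (coneFst f z) + f.toLinearMap (coneSnd f z) := rfl

@[simp] theorem coneSnd_d (z : (cone f).carrier) :
    coneSnd f ((cone f).d z) = -M.d (coneSnd f z) := rfl

variable {f} in
theorem cone_ext {z w : (cone f).carrier} (h1 : coneFst f z = coneFst f w)
    (h2 : coneSnd f z = coneSnd f w) : z = w := Prod.ext h1 h2

theorem acyclic_cone_iff : Acyclic (cone f) ↔ quasiIso 𝒜 f := by
  rw [quasiIso_iff]
  constructor
  · refine fun h => ⟨fun x hx ⟨y, hy⟩ => ?_, fun y hy => ?_⟩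
    · obtain ⟨z, hz⟩ := h (coneMk f (-y) x) (cone_ext (by simp [hy]) (by simp [hx]))
      have h2 := congrArg (coneSnd f) hz
      exact ⟨-coneSnd f z, by rw [map_neg]; simpa using h2⟩
    · obtain ⟨z, hz⟩ := h (coneMk f y 0) (cone_ext (by simp [hy]) (by simp))
      have h1 := congrArg (coneFst f) hz
      have h2 := congrArg (coneSnd f) hz
      exact ⟨coneSnd f z, by simpa using h2, coneFst f z, eq_sub_of_add_eq (by simpa using h1)⟩
  · rintro ⟨h1, h2⟩ z hz
    have hz1 := congrArg (coneFst f) hz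
    have hz2 := congrArg (coneSnd f) hz
    simp only [coneFst_d, coneSnd_d, map_zero, neg_eq_zero] at hz1 hz2
    obtain ⟨x', hx'⟩ := h1 (coneSnd f z) hz2 ⟨-coneFst f z, by
      rw [map_neg]; exact neg_eq_of_add_eq_zero_right hz1⟩
    obtain ⟨x'', hx'', y', hy'⟩ := h2 (coneFst f z + f.toLinearMap x') (by
      rw [map_add, ← f.map_d, hx']; exact hz1)
    exact ⟨coneMk f y' (x'' - x'), cone_ext (by simp [hy']) (by simp [hx'', hx'])⟩

end Cone

end QuasiIso

/-! ### Homotopies -/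

section Homotopy

variable {A : Type u} [CommRing A] {𝒜 : ℤ → AddSubgroup A} [GradedRing 𝒜]

@[simp]
theorem comp_apply {M N K : DGModule 𝒜} (f : M ⟶ N) (g : N ⟶ K) (x : M.carrier) :
    (f ≫ g).toLinearMap x = g.toLinearMap (f.toLinearMap x) := rfl

theorem hom_ext {M N : DGModule 𝒜} {f g : M ⟶ N}
    (h : ∀ x, f.toLinearMap x = g.toLinearMap x) : f = g :=
  Hom.ext (LinearMap.ext h)

/-- Two morphisms of DG modules are homotopic if their difference is `d h + h d` for an `A`-linear
map `h` of degree `1`. -/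
def Homotopic {M N : DGModule 𝒜} (f g : M ⟶ N) : Prop :=
  ∃ h : M.carrier →ₗ[A] N.carrier, (∀ n, ∀ x ∈ M.grading n, h x ∈ N.grading (n + 1)) ∧
    ∀ x, f.toLinearMap x - g.toLinearMap x = N.d (h x) + h (M.d x)

/-- A morphism of DG modules is null-homotopic if it has the form `d h + h d` for an `A`-linear
map `h` of degree `1`. -/
def NullHomotopic {M N : DGModule 𝒜} (f : M ⟶ N) : Prop :=
  ∃ h : M.carrier →ₗ[A] N.carrier, (∀ n, ∀ x ∈ M.grading n, h x ∈ N.grading (n + 1)) ∧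
    ∀ x, f.toLinearMap x = N.d (h x) + h (M.d x)

theorem Homotopic.refl {M N : DGModule 𝒜} (f : M ⟶ N) : Homotopic f f :=
  ⟨0, fun _ _ _ => zero_mem _, fun x => by simp⟩

theorem Homotopic.symm {M N : DGModule 𝒜} {f g : M ⟶ N} : Homotopic f g → Homotopic g f := by
  rintro ⟨h, h1, h2⟩
  refine ⟨-h, fun n x hx => neg_mem (h1 n x hx), fun x => ?_⟩
  rw [← neg_sub, h2]
  simp [add_comm]

theorem Homotopic.trans {M N : DGModule 𝒜} {f g k : M ⟶ N} :
    Homotopic f g → Homotopic g k → Homotopic f k := by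
  rintro ⟨h, h1, h2⟩ ⟨h', h1', h2'⟩
  refine ⟨h + h', fun n x hx => add_mem (h1 n x hx) (h1' n x hx), fun x => ?_⟩
  rw [← sub_add_sub_cancel _ (g.toLinearMap x), h2, h2']
  simp only [LinearMap.add_apply, map_add]
  abel

theorem Homotopic.comp_right {M N K : DGModule 𝒜} {f g : M ⟶ N} (k : N ⟶ K) :
    Homotopic f g → Homotopic (f ≫ k) (g ≫ k) := by
  rintro ⟨h, h1, h2⟩
  refine ⟨k.toLinearMap ∘ₗ h, fun n x hx => k.map_mem (h1 n x hx), fun x => ?_⟩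
  rw [comp_apply, comp_apply, ← map_sub, h2, map_add, k.map_d]
  rfl

/-- The path object of a DG module `Y`: a morphism to it is a pair of morphisms to `Y` together
with a homotopy between them. -/
abbrev pathObject (Y : DGModule 𝒜) : DGModule 𝒜 where
  carrier := Y.carrier × Y.carrier × Y.carrier
  grading n := (Y.grading n).prod ((Y.grading n).prod (Y.grading (n + 1)))
  isInternal := by
    have h := prod_isInternal_shift Y.isInternal (prod_isInternal_shift Y.isInternal Y.isInternal 1) 0
    simpa using h
  smul_mem i j a x ha hx := by
    refine ⟨Y.smul_mem ha hx.1, Y.smul_mem ha hx.2.1, ?_⟩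
    have := Y.smul_mem ha hx.2.2
    rwa [← add_assoc] at this
  d := (Y.d ∘ₗ LinearMap.fst A _ _).prod ((Y.d ∘ₗ LinearMap.fst A _ _ ∘ₗ LinearMap.snd A _ _).prod
    (LinearMap.fst A _ _ - LinearMap.fst A _ _ ∘ₗ LinearMap.snd A _ _ -
      Y.d ∘ₗ LinearMap.snd A _ _ ∘ₗ LinearMap.snd A _ _))
  d_mem n x hx := by
    refine ⟨Y.d_mem hx.1, Y.d_mem hx.2.1, ?_⟩
    have := Y.d_mem hx.2.2
    rw [show n + 1 - 1 = n - 1 + 1 by ring] at this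
    refine (Y.grading _).sub_mem ((Y.grading _).sub_mem ?_ ?_) this
    · exact (sub_add_cancel n 1).symm ▸ hx.1
    · exact (sub_add_cancel n 1).symm ▸ hx.2.1
  d_d x := by simp [Y.d_d]

/-- The inclusion of the constant paths. -/
def constPath (Y : DGModule 𝒜) : Y ⟶ pathObject Y where
  toLinearMap := LinearMap.id.prod (LinearMap.id.prod 0)
  map_mem _ _ hx := ⟨hx, hx, zero_mem _⟩
  map_d x := by simp

/-- The start of a path. -/
def pathStart (Y : DGModule 𝒜) : pathObject Y ⟶ Y where
  toLinearMap := LinearMap.fst A _ _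
  map_mem _ _ hx := hx.1
  map_d _ := rfl

/-- The end of a path. -/
def pathEnd (Y : DGModule 𝒜) : pathObject Y ⟶ Y where
  toLinearMap := LinearMap.fst A _ _ ∘ₗ LinearMap.snd A _ _
  map_mem _ _ hx := hx.2.1
  map_d _ := rfl

theorem quasiIso_constPath (Y : DGModule 𝒜) : quasiIso 𝒜 (constPath Y) := by
  rw [quasiIso_iff]
  constructor
  · rintro x - ⟨y, hy⟩
    exact ⟨y.1, congrArg Prod.fst hy⟩
  · rintro ⟨y0, y1, z⟩ hy
    have h0 : Y.d y0 = 0 := congrArg Prod.fst hy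
    have h2 : y0 - y1 - Y.d z = 0 := congrArg (fun w => w.2.2) hy
    refine ⟨y0, h0, (0, -z, 0), ?_⟩
    refine Prod.ext ?_ (Prod.ext ?_ ?_)
    · change Y.d 0 = y0 - y0
      simp
    · change Y.d (-z) = y1 - y0
      rw [map_neg, ← sub_eq_zero.mp h2, neg_sub]
    · change 0 - -z - Y.d 0 = z - 0
      simp

/-- Homotopic morphisms agree in the derived category: the start and the end of a path agree there,
because both are inverse to the quasi-isomorphism given by the constant paths. -/
theorem Homotopic.map_eq {M N : DGModule 𝒜} {f g : M ⟶ N} (h : Homotopic f g) :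
    (quasiIso 𝒜).Q.map f = (quasiIso 𝒜).Q.map g := by
  obtain ⟨h, h1, h2⟩ := h
  let H : M ⟶ pathObject N :=
    { toLinearMap := f.toLinearMap.prod (g.toLinearMap.prod h)
      map_mem := fun n x hx => ⟨f.map_mem hx, g.map_mem hx, h1 n x hx⟩
      map_d := fun x => by
        refine Prod.ext (f.map_d x) (Prod.ext (g.map_d x) ?_)
        change h (M.d x) = f.toLinearMap x - g.toLinearMap x - N.d (h x)
        rw [h2, add_sub_cancel_left] }
  have hiso := (quasiIso 𝒜).Q_inverts _ (quasiIso_constPath N)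
  have he : (quasiIso 𝒜).Q.map (pathStart N) = (quasiIso 𝒜).Q.map (pathEnd N) := by
    rw [← cancel_epi ((quasiIso 𝒜).Q.map (constPath N)), ← Functor.map_comp, ← Functor.map_comp]
    rfl
  have hf : f = H ≫ pathStart N := rfl
  have hg : g = H ≫ pathEnd N := rfl
  rw [hf, hg, Functor.map_comp, Functor.map_comp, he]

end Homotopy

/-! ### K-projective DG modules -/

section KProjective

variable {A : Type u} [CommRing A] {𝒜 : ℤ → AddSubgroup A} [GradedRing 𝒜]

/-- A DG module is K-projective if each morphism from it to an acyclic DG module is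
null-homotopic. -/
def KProjective (P : DGModule 𝒜) : Prop :=
  ∀ (E : DGModule 𝒜) (f : P ⟶ E), Acyclic E → NullHomotopic f

/-- Morphisms from a K-projective DG module lift along quasi-isomorphisms up to homotopy: the lift is
the component in the source of a null-homotopy of the composite with the inclusion of the target in
the (acyclic) cone. -/
theorem KProjective.exists_lift {P X Y : DGModule 𝒜} (hP : KProjective P) {s : X ⟶ Y}
    (hs : quasiIso 𝒜 s) (f : P ⟶ Y) : ∃ g : P ⟶ X, Homotopic f (g ≫ s) := by
  let F : P ⟶ cone s :=
    { toLinearMap := f.toLinearMap.prod 0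
      map_mem := fun n x hx => ⟨f.map_mem hx, zero_mem _⟩
      map_d := fun x => by
        refine cone_ext (f := s) ?_ ?_
        · change f.toLinearMap (P.d x) = Y.d (f.toLinearMap x) + s.toLinearMap 0
          rw [map_zero, add_zero, f.map_d]
        · change 0 = -X.d 0
          rw [map_zero, neg_zero] }
  obtain ⟨h, h1, h2⟩ := hP _ F ((acyclic_cone_iff s).mpr hs)
  have hfst : ∀ x, f.toLinearMap x = Y.d (coneFst s (h x)) + s.toLinearMap (coneSnd s (h x)) +
      coneFst s (h (P.d x)) := fun x => congrArg (coneFst s) (h2 x)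
  have hsnd : ∀ x, 0 = - X.d (coneSnd s (h x)) + coneSnd s (h (P.d x)) :=
    fun x => congrArg (coneSnd s) (h2 x)
  refine ⟨⟨coneSnd s ∘ₗ h, fun n x hx => ?_, fun x => ?_⟩, coneFst s ∘ₗ h, fun n x hx =>
    (h1 n x hx).1, fun x => ?_⟩
  · simpa using! (h1 n x hx).2
  · exact (eq_of_sub_eq_zero ((neg_add_eq_sub _ _).symm.trans (hsnd x).symm))
  · rw [hfst]
    simp only [comp_apply, LinearMap.comp_apply]
    abel

/-- The lift of a morphism along a quasi-isomorphism is unique up to homotopy. -/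
theorem KProjective.homotopic_of_comp {P X Y : DGModule 𝒜} (hP : KProjective P) {s : X ⟶ Y}
    (hs : quasiIso 𝒜 s) {f g : P ⟶ X} (h : Homotopic (f ≫ s) (g ≫ s)) : Homotopic f g := by
  obtain ⟨k, k1, k2⟩ := h
  -- The homotopy `k` and `g - f` together form a morphism to the shifted cone.
  let F : P ⟶ (cone s).shift 1 :=
    { toLinearMap := k.prod (g.toLinearMap - f.toLinearMap)
      map_mem := fun n x hx => ⟨k1 n x hx, by
        have := sub_mem (g.map_mem hx) (f.map_mem hx)
        exact (add_sub_cancel_right n 1).symm ▸ this⟩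
      map_d := fun x => by
        refine cone_ext (f := s) ?_ ?_
        · change k (P.d x) = -(Y.d (k x) + s.toLinearMap (g.toLinearMap x - f.toLinearMap x))
          have := k2 x
          simp only [comp_apply] at this
          rw [map_sub, ← neg_sub (s.toLinearMap (f.toLinearMap x)), this]
          abel
        · change g.toLinearMap (P.d x) - f.toLinearMap (P.d x) =
            - -(X.d (g.toLinearMap x - f.toLinearMap x))
          rw [neg_neg, map_sub, f.map_d, g.map_d] }
  obtain ⟨h, h1, h2⟩ := hP _ F (((acyclic_cone_iff s).mpr hs).shift 1)
  refine ⟨- coneSnd s ∘ₗ h, fun n x hx => neg_mem ?_, fun x => ?_⟩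
  · simpa using! (h1 n x hx).2
  · have h3 : g.toLinearMap x - f.toLinearMap x =
        - -(X.d (coneSnd s (h x))) + coneSnd s (h (P.d x)) := congrArg (coneSnd s) (h2 x)
    rw [← neg_sub, h3]
    simp only [LinearMap.comp_apply, LinearMap.neg_apply, map_neg]
    abel

/-- Each morphism in the derived category that starts at a K-projective DG module comes from a
morphism of DG modules. -/
theorem KProjective.exists_map_eq {P Y : DGModule 𝒜} (hP : KProjective P)
    (φ : toDerived 𝒜 P ⟶ toDerived 𝒜 Y) : ∃ f : P ⟶ Y, (quasiIso 𝒜).Q.map f = φ := by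
  -- Composition with the zigzags that generate the derived category preserves morphisms that come
  -- from morphisms of DG modules.
  let im : ∀ X : Derived 𝒜, (toDerived 𝒜 P ⟶ X) → Prop := fun X f =>
    ∃ f' : P ⟶ X.toDGModule, (quasiIso 𝒜).Q.map f' = f
  let Φ : MorphismProperty (Derived 𝒜) := fun X Y φ => ∀ f, im X f → im Y (f ≫ φ)
  have : Φ.IsStableUnderComposition := ⟨fun a b ha hb f hf => by
    rw [← Category.assoc]
    exact hb _ (ha f hf)⟩
  have hΦ : Φ = ⊤ := by
    refine Localization.Construction.morphismProperty_eq_top Φ ?_ ?_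
    · rintro X Y f _ ⟨g, rfl⟩
      exact ⟨g ≫ f, (quasiIso 𝒜).Q.map_comp (X := P) (Y := X) g f⟩
    · rintro X Y w hw _ ⟨f, rfl⟩
      obtain ⟨g, hg⟩ := hP.exists_lift hw f
      refine ⟨g, ?_⟩
      have h1 := hg.map_eq.trans ((quasiIso 𝒜).Q.map_comp g w)
      exact (Iso.eq_comp_inv (Localization.Construction.wIso w hw)).mpr h1.symm
  have h : Φ φ := hΦ ▸ MorphismProperty.top_apply φ
  have h1 := h (𝟙 _) ⟨𝟙 P, (quasiIso 𝒜).Q.map_id P⟩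
  rw [Category.id_comp] at h1
  exact h1

/-- The functor of homotopy classes of morphisms from a DG module. -/
def homotopyClasses (P : DGModule 𝒜) : DGModule 𝒜 ⥤ Type u where
  obj Y := Quot (Homotopic (M := P) (N := Y))
  map s := ↾(Quot.map (fun f => f ≫ s) fun _ _ h => h.comp_right s)
  map_id Y := by
    ext x
    induction x using Quot.ind
    rfl
  map_comp f g := by
    ext x
    induction x using Quot.ind
    rfl

theorem homotopic_of_quot_eq {P Y : DGModule 𝒜} {f g : P ⟶ Y}
    (h : Quot.mk Homotopic f = Quot.mk Homotopic g) : Homotopic f g :=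
  (Equivalence.mk Homotopic.refl Homotopic.symm Homotopic.trans).eqvGen_iff.mp (Quot.eqvGen_exact h)

theorem KProjective.isInvertedBy (P : DGModule 𝒜) (hP : KProjective P) :
    (quasiIso 𝒜).IsInvertedBy (homotopyClasses P) := by
  intro X Y s hs
  rw [isIso_iff_bijective]
  constructor
  · intro a b
    induction a using Quot.ind with | mk f
    induction b using Quot.ind with | mk g
    exact fun h => Quot.sound (hP.homotopic_of_comp hs (homotopic_of_quot_eq h))
  · intro b
    induction b using Quot.ind with | mk f
    obtain ⟨g, hg⟩ := hP.exists_lift hs f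
    exact ⟨Quot.mk _ g, Quot.sound hg.symm⟩

/-- Morphisms from a K-projective DG module that agree in the derived category are homotopic. -/
theorem KProjective.homotopic {P Y : DGModule 𝒜} (hP : KProjective P) {f g : P ⟶ Y}
    (h : (quasiIso 𝒜).Q.map f = (quasiIso 𝒜).Q.map g) : Homotopic f g := by
  have e := Localization.fac (homotopyClasses P) (hP.isInvertedBy P) (quasiIso 𝒜).Q
  have key : ∀ k : P ⟶ Y, (homotopyClasses P).map k = e.inv.app P ≫
      (Localization.lift (homotopyClasses P) (hP.isInvertedBy P) (quasiIso 𝒜).Q).map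
        ((quasiIso 𝒜).Q.map k) ≫ e.hom.app Y := fun k => by
    have := e.hom.naturality k
    rw [Functor.comp_map] at this
    rw [this]
    simp
  have h2 : (homotopyClasses P).map f = (homotopyClasses P).map g := by rw [key, key, h]
  exact homotopic_of_quot_eq (congrArg (fun t => t (Quot.mk _ (𝟙 P))) h2)

theorem KProjective.shift {P : DGModule 𝒜} (hP : KProjective P) (s : ℤ) :
    KProjective (P.shift s) := by
  intro E f hE
  let F : P ⟶ E.shift (-s) :=
    { toLinearMap := f.toLinearMap
      map_mem := fun n x hx => f.map_mem (n := n + -s) (by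
        change x ∈ P.grading (n + -s + s)
        rwa [neg_add_cancel_right])
      map_d := fun x => by
        change f.toLinearMap (P.d x) = -(E.d (f.toLinearMap x))
        rw [← f.map_d, ← map_neg]
        exact congrArg _ (neg_neg _).symm }
  obtain ⟨h, h1, h2⟩ := hP _ F (hE.shift _)
  refine ⟨-h, fun n x hx => ?_, fun x => ?_⟩
  · have := neg_mem (h1 _ x hx)
    change - h x ∈ E.grading (n + s + 1 + -s) at this
    rwa [show n + s + 1 + -s = n + 1 by ring] at this
  · have h3 : f.toLinearMap x = -(E.d (h x)) + h (P.d x) := h2 x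
    rw [h3]
    change _ = E.d (-(h x)) + - h (-(P.d x))
    rw [map_neg, map_neg, neg_neg]

theorem KProjective.cone {M N : DGModule 𝒜} (hM : KProjective M) (hN : KProjective N)
    (g : M ⟶ N) : KProjective (DGModule.cone g) := by
  intro E f hE
  have fadd : ∀ y x, f.toLinearMap (coneMk g y x) =
      f.toLinearMap (coneMk g y 0) + f.toLinearMap (coneMk g 0 x) := fun y x => by
    rw [← map_add]
    exact congrArg _ (cone_ext (by simp) (by simp))
  have dmk : ∀ y x, (DGModule.cone g).d (coneMk g y x) =
      coneMk g (N.d y + g.toLinearMap x) (-M.d x) := fun _ _ => rfl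
  have fneg : ∀ x, f.toLinearMap (coneMk g 0 (-x)) = -f.toLinearMap (coneMk g 0 x) := fun x => by
    rw [← map_neg]
    exact congrArg _ (cone_ext (by simp) (by simp))
  let F : N ⟶ E :=
    { toLinearMap := f.toLinearMap ∘ₗ LinearMap.inl A N.carrier M.carrier
      map_mem := fun n x hx => f.map_mem (x := coneMk g x 0) ⟨hx, zero_mem _⟩
      map_d := fun x => by
        have := f.map_d (coneMk g x 0)
        rw [dmk, map_zero, map_zero, neg_zero, add_zero] at this
        exact this }
  obtain ⟨h, h1, h2⟩ := hN _ F hE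
  have h3 : ∀ y, f.toLinearMap (coneMk g y 0) = E.d (h y) + h (N.d y) := h2
  let G : M ⟶ E.shift 1 :=
    { toLinearMap := f.toLinearMap ∘ₗ LinearMap.inr A N.carrier M.carrier - h ∘ₗ g.toLinearMap
      map_mem := fun n x hx => sub_mem (f.map_mem (x := coneMk g 0 x) (n := n + 1)
        ⟨zero_mem _, by rwa [add_sub_cancel_right]⟩) (h1 _ _ (g.map_mem hx))
      map_d := fun x => by
        change f.toLinearMap (coneMk g 0 (M.d x)) - h (g.toLinearMap (M.d x)) =
          -(E.d (f.toLinearMap (coneMk g 0 x) - h (g.toLinearMap x)))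
        have := f.map_d (coneMk g 0 x)
        rw [dmk, map_zero, zero_add, fadd, fneg, h3] at this
        rw [map_sub, ← this, g.map_d]
        abel }
  obtain ⟨k, k1, k2⟩ := hM _ G (hE.shift _)
  have k3 : ∀ x, f.toLinearMap (coneMk g 0 x) - h (g.toLinearMap x) =
    -(E.d (k x)) + k (M.d x) := k2
  refine ⟨h ∘ₗ coneFst g - k ∘ₗ coneSnd g, fun n x hx => sub_mem (h1 _ _ hx.1) ?_, fun z => ?_⟩
  · have := k1 _ _ hx.2
    change k (coneSnd g x) ∈ E.grading (n - 1 + 1 + 1) at this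
    rwa [sub_add_cancel] at this
  · have hz : z = coneMk g (coneFst g z) (coneSnd g z) := rfl
    rw [hz, fadd, h3, sub_eq_iff_eq_add.mp (k3 _), ← hz]
    simp only [LinearMap.sub_apply, LinearMap.comp_apply, coneFst_d, coneSnd_d, map_add, map_neg,
      map_sub]
    abel

theorem kProjective_coprod {J : Type u} {Y : J → DGModule 𝒜} (hY : ∀ j, KProjective (Y j)) :
    KProjective (coprod Y) := by
  intro E f hE
  choose h h1 h2 using fun j => hY j E (coprodι Y j ≫ f) hE
  refine ⟨coprodLift h, coprodLift_mem h h1, fun x => ?_⟩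
  induction x using coprod_induction with
  | zero => simp
  | ι j y => rw [← (coprodι Y j).map_d, coprodLift_ι, coprodLift_ι, ← h2, comp_apply]
  | add y z hy hz =>
    simp only [map_add, hy, hz]
    abel

/-- Recursion on the generators of a semifree module: the value at `j` may depend on the linear
extension of the values at the generators that occur in the boundary of `j`. -/
theorem exists_rec_of_support_lt {J X : Type*} [AddCommGroup X] [Module A X] (δ : J → (J →₀ A))
    (r : J → ℕ) (hr : ∀ j, ∀ i ∈ (δ j).support, r i < r j) (Φ : J → X → X) :
    ∃ h : J → X, ∀ j, h j = Φ j (Finsupp.linearCombination A h (δ j)) := by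
  let wf : WellFounded fun i j : J => r i < r j := (measure r).wf
  let F : ∀ j, (∀ i, r i < r j → X) → X := fun j ih =>
    Φ j (∑ i ∈ (δ j).support.attach, δ j i • ih i (hr j i i.2))
  refine ⟨wf.fix F, fun j => ?_⟩
  rw [wf.fix_eq, Finsupp.linearCombination_apply, Finsupp.sum, ← Finset.sum_attach]

/-- A semifree DG module is K-projective if its generators have ranks such that the boundary of each
generator involves only generators of smaller rank: a null-homotopy is built by recursion on the
rank. -/
theorem kProjective_semifree {J : Type u} {deg : J → ℤ} {δ : J → (J →₀ A)}
    (hδ : ∀ j, δ j ∈ freeGrading 𝒜 deg (deg j - 1))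
    (hδδ : ∀ j, Finsupp.linearCombination A δ (δ j) = 0)
    (r : J → ℕ) (hr : ∀ j, ∀ i ∈ (δ j).support, r i < r j) :
    KProjective (semifree deg δ hδ hδδ) := by
  classical
  intro E f hE
  obtain ⟨h, hh⟩ := exists_rec_of_support_lt (X := E.carrier) δ r hr fun j y =>
    if H : ∃ z ∈ E.grading (deg j + 1), E.d z = f.toLinearMap (Finsupp.single j 1) - y
    then H.choose else 0
  have hfd : ∀ x : J →₀ A, f.toLinearMap (Finsupp.linearCombination A δ x) =
    E.d (f.toLinearMap x) := f.map_d
  -- The cycle `f (e j) - h (δ j)` in the acyclic target is a boundary.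
  have key : ∀ n j, r j = n → h j ∈ E.grading (deg j + 1) ∧ E.d (h j) =
      f.toLinearMap (Finsupp.single j 1) - Finsupp.linearCombination A h (δ j) := by
    intro n
    induction n using Nat.strong_induction_on with
    | _ n ih =>
    rintro j rfl
    have hd : ∀ x : J →₀ A, (∀ i ∈ x.support, r i < r j) →
        E.d (Finsupp.linearCombination A h x) = f.toLinearMap x -
          Finsupp.linearCombination A h (Finsupp.linearCombination A δ x) := by
      intro x hx
      have h4 : E.d (Finsupp.linearCombination A h x) = x.sum fun i a =>
          a • (f.toLinearMap (Finsupp.single i 1) - Finsupp.linearCombination A h (δ i)) := by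
        rw [Finsupp.linearCombination_apply, Finsupp.sum, Finsupp.sum, map_sum]
        exact Finset.sum_congr rfl fun i hi => by rw [map_smul, (ih _ (hx i hi) i rfl).2]
      have h5 : ∀ y : J →₀ A, (y.sum fun i a =>
          a • (f.toLinearMap (Finsupp.single i 1) - Finsupp.linearCombination A h (δ i))) =
          f.toLinearMap y -
            Finsupp.linearCombination A h (Finsupp.linearCombination A δ y) := by
        intro y
        rw [← Finsupp.linearCombination_apply]
        induction y using Finsupp.induction_linear with
        | zero => simp
        | add x y hx hy => simp only [map_add, hx, hy]; abel
        | single i a =>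
          rw [Finsupp.linearCombination_single, Finsupp.linearCombination_single, map_smul,
            smul_sub, ← map_smul, Finsupp.smul_single, smul_eq_mul, mul_one]
      rw [h4, h5]
    have hex : ∃ z ∈ E.grading (deg j + 1), E.d z =
        f.toLinearMap (Finsupp.single j 1) - Finsupp.linearCombination A h (δ j) := by
      refine hE.exists_homogeneous (sub_mem (f.map_mem ?_) ?_) ?_
      · exact single_mem_freeGrading deg (by simpa using SetLike.GradedOne.one_mem (A := 𝒜))
      · rw [Finsupp.linearCombination_apply]
        refine sum_mem fun i hi => ?_
        have := E.smul_mem (hδ j i) (ih _ (hr j i hi) i rfl).1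
        rwa [show deg j - 1 - deg i + (deg i + 1) = deg j by ring] at this
      · rw [map_sub, hd _ (hr j), hδδ, map_zero, sub_zero, ← hfd, Finsupp.linearCombination_single,
          one_smul, sub_self]
    have hj := hh j
    rw [dif_pos hex] at hj
    rw [hj]
    exact hex.choose_spec
  refine ⟨Finsupp.linearCombination A h, fun n x hx =>
    linearCombination_mem_grading deg (fun j => (key _ j rfl).1) hx, fun x => ?_⟩
  change _ = _ + Finsupp.linearCombination A h (Finsupp.linearCombination A δ x)
  induction x using Finsupp.induction_linear with
  | zero => simp
  | add x y hx hy => simp only [map_add, hx, hy]; abel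
  | single j a =>
    rw [Finsupp.linearCombination_single, Finsupp.linearCombination_single, map_smul, map_smul,
      (key _ j rfl).2, ← smul_add, sub_add_cancel, ← map_smul, Finsupp.smul_single, smul_eq_mul,
      mul_one]

end KProjective

/-! ### Semifree resolutions -/

/-- The cells of the semifree resolution of a module `M`: a cell of degree `n` is attached along
`∑ i, a i • c i` and mapped to `m`. -/
inductive Cell (A M : Type u) : Type u
  | mk (n : ℤ) (m : M) (k : ℕ) (a : Fin k → A) (c : Fin k → Cell A M) : Cell A M

namespace Cell

variable {A : Type u} [CommRing A] {𝒜 : ℤ → AddSubgroup A} [GradedRing 𝒜]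

/-- The degree of a cell. -/
def degree {A M : Type u} : Cell A M → ℤ
  | mk n _ _ _ _ => n

/-- The number of steps needed to build a cell. -/
def rank {A M : Type u} : Cell A M → ℕ
  | mk _ _ _ _ c => (Finset.univ.sup fun i => rank (c i)) + 1

open Classical in
/-- The value of a cell in `M`, and its boundary.  A cell whose data are not compatible with the
gradings and the differentials is given the value and the boundary zero. -/
noncomputable def attach (M : DGModule 𝒜) :
    Cell A M.carrier → M.carrier × (Cell A M.carrier →₀ A)
  | mk n m _ a c =>
    if m ∈ M.grading n ∧ (∑ i, Finsupp.single (c i) (a i)) ∈ freeGrading 𝒜 degree (n - 1) ∧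
        ∑ i, a i • attach M (c i) = (M.d m, 0) then
      (m, ∑ i, Finsupp.single (c i) (a i))
    else 0

variable (M : DGModule 𝒜)

theorem attach_fst_mem (c : Cell A M.carrier) : (attach M c).1 ∈ M.grading c.degree := by
  obtain ⟨n, m, k, a, c⟩ := c
  rw [attach]
  split_ifs with h
  · exact h.1
  · exact zero_mem _

theorem attach_snd_mem (c : Cell A M.carrier) :
    (attach M c).2 ∈ freeGrading 𝒜 degree (c.degree - 1) := by
  obtain ⟨n, m, k, a, c⟩ := c
  rw [attach]
  split_ifs with h
  · exact h.2.1
  · exact zero_mem _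

theorem linearCombination_attach (c : Cell A M.carrier) :
    Finsupp.linearCombination A (attach M) (attach M c).2 = (M.d (attach M c).1, 0) := by
  obtain ⟨n, m, k, a, c⟩ := c
  rw [attach]
  split_ifs with h
  · rw [← h.2.2, map_sum]
    simp only [Finsupp.linearCombination_single]
  · rw [Prod.fst_zero, Prod.snd_zero, map_zero, map_zero]
    rfl

theorem linearCombination_fst (x : Cell A M.carrier →₀ A) :
    Finsupp.linearCombination A (fun c => (attach M c).1) x =
      (Finsupp.linearCombination A (attach M) x).1 :=
  ((LinearMap.fst A M.carrier (Cell A M.carrier →₀ A)).map_finsupp_linearCombination _).symm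

theorem linearCombination_snd (x : Cell A M.carrier →₀ A) :
    Finsupp.linearCombination A (fun c => (attach M c).2) x =
      (Finsupp.linearCombination A (attach M) x).2 :=
  ((LinearMap.snd A M.carrier (Cell A M.carrier →₀ A)).map_finsupp_linearCombination _).symm

theorem rank_lt (c : Cell A M.carrier) : ∀ i ∈ (attach M c).2.support, rank i < rank c := by
  classical
  obtain ⟨n, m, k, a, c⟩ := c
  intro i hi
  rw [attach] at hi
  split_ifs at hi with h
  · obtain ⟨j, -, hj⟩ := Finset.mem_biUnion.mp (Finsupp.support_finsetSum hi)
    have hij : i = c j := Finset.mem_singleton.mp (Finsupp.support_single_subset hj)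
    rw [rank, hij]
    exact Nat.lt_succ_of_le (Finset.le_sup (f := fun i => rank (c i)) (Finset.mem_univ j))
  · simp at hi

/-- The semifree resolution of a DG module. -/
noncomputable abbrev resolution : DGModule 𝒜 :=
  semifree degree (fun c => (attach M c).2) (attach_snd_mem M) fun c => by
    rw [linearCombination_snd, linearCombination_attach]

/-- The quasi-isomorphism from the semifree resolution of a DG module. -/
noncomputable def resolutionMap : resolution M ⟶ M :=
  semifreeDesc (fun c => (attach M c).1) (attach_fst_mem M) fun c => by
    rw [linearCombination_fst, linearCombination_attach]

theorem kProjective_resolution : KProjective (resolution M) :=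
  kProjective_semifree _ _ rank (rank_lt M)

/-- The cone of the resolution map is acyclic, because each homogeneous cycle `(y, x)` of the cone
is the boundary of a cell with value `y` and boundary `-x`. -/
theorem quasiIso_resolutionMap : quasiIso 𝒜 (resolutionMap M) := by
  classical
  refine (acyclic_cone_iff (resolutionMap M)).mp (acyclic_of_homogeneous fun n z hz hdz => ?_)
  let y : M.carrier := coneFst (resolutionMap M) z
  let x : Cell A M.carrier →₀ A := coneSnd (resolutionMap M) z
  have h1 : M.d y + Finsupp.linearCombination A (fun c => (attach M c).1) x = 0 :=
    congrArg (coneFst (resolutionMap M)) hdz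
  have h2 : - Finsupp.linearCombination A (fun c => (attach M c).2) x = 0 :=
    congrArg (coneSnd (resolutionMap M)) hdz
  let e := x.support.equivFin
  have hx : ∀ {X : Type u} [AddCommGroup X] (g : Cell A M.carrier → A → X),
      ∑ i, g (e.symm i) (x (e.symm i)) = x.sum g := fun g => by
    exact (e.symm.sum_comp fun i : x.support => g i (x i)).trans
      (Finset.sum_coe_sort x.support fun i => g i (x i))
  have hsum : ∑ i, Finsupp.single (e.symm i : Cell A M.carrier) (- x (e.symm i)) = -x := by
    rw [hx fun c a => Finsupp.single c (-a)]
    simp only [Finsupp.single_neg, Finsupp.sum_neg, Finsupp.sum_single]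
  let c : Cell A M.carrier := mk n y _ (fun i => - x (e.symm i)) fun i => e.symm i
  have hc : attach M c = (y, -x) := by
    rw [attach, hsum, if_pos]
    refine ⟨hz.1, neg_mem hz.2, ?_⟩
    have hneg : (x.sum fun c a => (-a) • attach M c) =
        -Finsupp.linearCombination A (attach M) x := by
      rw [Finsupp.linearCombination_apply, Finsupp.sum, Finsupp.sum, ← Finset.sum_neg_distrib]
      exact Finset.sum_congr rfl fun c _ => Prod.ext (neg_smul _ _) (neg_smul _ _)
    rw [hx fun c a => (-a) • attach M c, hneg]
    refine Prod.ext ?_ ?_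
    · rw [Prod.fst_neg, ← linearCombination_fst]
      exact (eq_neg_of_add_eq_zero_left h1).symm
    · rw [Prod.snd_neg, ← linearCombination_snd]
      exact h2
  refine ⟨coneMk (resolutionMap M) 0 (Finsupp.single c 1), cone_ext (f := resolutionMap M) ?_ ?_⟩
  · change M.d 0 + Finsupp.linearCombination A (fun c => (attach M c).1) (Finsupp.single c 1) = y
    rw [map_zero, zero_add, Finsupp.linearCombination_single, hc, one_smul]
  · change -Finsupp.linearCombination A (fun c => (attach M c).2) (Finsupp.single c 1) = x
    rw [Finsupp.linearCombination_single, hc, one_smul, neg_neg]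

end Cell

/-! ### Direct sums are coproducts in the derived category -/

section Coproducts

variable {A : Type u} [CommRing A] {𝒜 : ℤ → AddSubgroup A} [GradedRing 𝒜]

/-- The zero morphism. -/
def zeroHom (M N : DGModule 𝒜) : M ⟶ N where
  toLinearMap := 0
  map_mem _ _ _ := zero_mem _
  map_d _ := by simp

theorem nullHomotopic_of_homotopic {M N : DGModule 𝒜} {f : M ⟶ N}
    (h : Homotopic f (zeroHom M N)) : NullHomotopic f := by
  obtain ⟨h, h1, h2⟩ := h
  exact ⟨h, h1, fun x => by rw [← h2]; exact (sub_zero _).symm⟩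

variable {J : Type u}

theorem homotopic_of_coprodι {Y : J → DGModule 𝒜} {N : DGModule 𝒜} {f g : coprod Y ⟶ N}
    (h : ∀ j, Homotopic (coprodι Y j ≫ f) (coprodι Y j ≫ g)) : Homotopic f g := by
  choose h h1 h2 using h
  refine ⟨coprodLift h, coprodLift_mem h h1, fun x => ?_⟩
  induction x using coprod_induction with
  | zero => simp
  | ι j y =>
    rw [← (coprodι Y j).map_d, coprodLift_ι, coprodLift_ι, ← h2, comp_apply, comp_apply]
  | add y z hy hz =>
    simp only [map_add]
    rw [add_sub_add_comm, hy, hz]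
    abel

/-- The direct sum of a family of morphisms. -/
noncomputable def coprodMap {S T : J → DGModule 𝒜} (s : ∀ j, S j ⟶ T j) : coprod S ⟶ coprod T :=
  coprodDesc fun j => s j ≫ coprodι T j

theorem coprodMap_apply {S T : J → DGModule 𝒜} (s : ∀ j, S j ⟶ T j) (x : (coprod S).carrier)
    (j : J) : (coprodMap s).toLinearMap x j = (s j).toLinearMap (x j) := by
  classical
  induction x using coprod_induction with
  | zero => rw [map_zero]; exact (map_zero (s j).toLinearMap).symm
  | ι i y =>
    have h : (coprodMap s).toLinearMap ((coprodι S i).toLinearMap y) =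
      (coprodι T i).toLinearMap ((s i).toLinearMap y) :=
        congrArg (fun f => Hom.toLinearMap f y) (ι_desc (fun j => s j ≫ coprodι T j) i)
    rw [h]
    change DirectSum.lof A J (fun j => (T j).carrier) i _ j =
      (s j).toLinearMap (DirectSum.lof A J (fun j => (S j).carrier) i y j)
    by_cases hij : i = j
    · subst hij; rw [DirectSum.lof_apply, DirectSum.lof_apply]
    · rw [DirectSum.lof_eq_of, DirectSum.lof_eq_of, DirectSum.of_eq_of_ne _ _ _ (Ne.symm hij),
        DirectSum.of_eq_of_ne _ _ _ (Ne.symm hij), map_zero]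
  | add y z hy hz =>
    rw [map_add, DirectSum.add_apply, DirectSum.add_apply, map_add, hy, hz]

theorem coprod_exists_d_eq (T : J → DGModule 𝒜) (x : (coprod T).carrier)
    (h : ∀ j, ∃ y, (T j).d y = x j) : ∃ y, (coprod T).d y = x := by
  classical
  choose y hy using h
  refine ⟨∑ j ∈ DFinsupp.support x, (coprodι T j).toLinearMap (y j), ?_⟩
  rw [map_sum]
  conv_rhs => rw [← DirectSum.sum_support_of x]
  exact Finset.sum_congr rfl fun j _ => by rw [← (coprodι T j).map_d, hy]; rfl

theorem quasiIso_coprodMap {S T : J → DGModule 𝒜} {s : ∀ j, S j ⟶ T j}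
    (hs : ∀ j, quasiIso 𝒜 (s j)) : quasiIso 𝒜 (coprodMap s) := by
  classical
  have h := fun j => (quasiIso_iff (s j)).mp (hs j)
  refine (quasiIso_iff _).mpr ⟨fun x hx ⟨y, hy⟩ => ?_, fun y hy => ?_⟩
  · refine coprod_exists_d_eq S x fun j => (h j).1 _ ?_ ⟨y j, ?_⟩
    · rw [← coprod_d_apply, hx]; rfl
    · rw [← coprod_d_apply, hy, coprodMap_apply]
  · choose x hx z hz using fun j => (h j).2 (y j) (by rw [← coprod_d_apply, hy]; rfl)
    refine ⟨∑ j ∈ DFinsupp.support y, (coprodι S j).toLinearMap (x j), ?_, ?_⟩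
    · rw [map_sum]
      exact Finset.sum_eq_zero fun j _ => by rw [← (coprodι S j).map_d, hx, map_zero]
    · refine ⟨∑ j ∈ DFinsupp.support y, (coprodι T j).toLinearMap (z j), ?_⟩
      have hsum : y = ∑ j ∈ DFinsupp.support y, (coprodι T j).toLinearMap (y j) :=
        (DirectSum.sum_support_of y).symm
      conv_rhs => lhs; rw [hsum]
      rw [map_sum, map_sum, ← Finset.sum_sub_distrib]
      refine Finset.sum_congr rfl fun j _ => ?_
      have h1 : (coprodMap s).toLinearMap ((coprodι S j).toLinearMap (x j)) =
        (coprodι T j).toLinearMap ((s j).toLinearMap (x j)) :=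
          congrArg (fun f => Hom.toLinearMap f (x j)) (ι_desc (fun j => s j ≫ coprodι T j) j)
      rw [← (coprodι T j).map_d, hz, h1, map_sub]

variable (J) in
/-- The cofan in the derived category on a direct sum of DG modules. -/
noncomputable abbrev derivedCofan (T : J → DGModule 𝒜) : Cofan fun j => toDerived 𝒜 (T j) :=
  Cofan.mk (toDerived 𝒜 (coprod T)) fun j => (quasiIso 𝒜).Q.map (coprodι T j)

theorem nonempty_isColimit_of_kProjective (S : J → DGModule 𝒜) (hS : ∀ j, KProjective (S j)) :
    Nonempty (IsColimit (derivedCofan J S)) := by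
  have hex : ∀ t : Cofan fun j => toDerived 𝒜 (S j), ∃ f : ∀ j, S j ⟶ Derived.toDGModule t.pt,
      ∀ j, (quasiIso 𝒜).Q.map (f j) = t.inj j := fun t =>
    Classical.axiomOfChoice (r := fun j (f : S j ⟶ Derived.toDGModule t.pt) =>
      (quasiIso 𝒜).Q.map f = t.inj j) fun j =>
      (hS j).exists_map_eq (Y := Derived.toDGModule t.pt) (t.inj j)
  choose f hf using hex
  refine ⟨Cofan.IsColimit.mk _ (fun t => (quasiIso 𝒜).Q.map (coprodDesc (f t))) (fun t j => ?_)
    fun t m hm => ?_⟩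
  · exact ((quasiIso 𝒜).Q.map_comp _ _).symm.trans ((congrArg _ (ι_desc (f t) j)).trans (hf t j))
  · obtain ⟨g, rfl⟩ := (kProjective_coprod hS).exists_map_eq (Y := Derived.toDGModule t.pt) m
    refine (homotopic_of_coprodι fun j => (hS j).homotopic ?_).map_eq
    exact ((quasiIso 𝒜).Q.map_comp _ _).trans ((hm j).trans
      ((hf t j).symm.trans (congrArg _ (ι_desc (f t) j).symm)))

/-- Direct sums of DG modules are coproducts in the derived category. -/
theorem nonempty_isColimit_derivedCofan (T : J → DGModule 𝒜) :
    Nonempty (IsColimit (derivedCofan J T)) := by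
  let s := fun j => Cell.resolutionMap (T j)
  obtain ⟨hS⟩ := nonempty_isColimit_of_kProjective _ fun j => Cell.kProjective_resolution (T j)
  have hiso : IsIso ((quasiIso 𝒜).Q.map (coprodMap s)) := (quasiIso 𝒜).Q_inverts _
    (quasiIso_coprodMap fun j => Cell.quasiIso_resolutionMap (T j))
  have hisoj : ∀ j, IsIso ((quasiIso 𝒜).Q.map (s j)) := fun j => (quasiIso 𝒜).Q_inverts _
    (Cell.quasiIso_resolutionMap (T j))
  have hcomm : ∀ j, (quasiIso 𝒜).Q.map (s j) ≫ (quasiIso 𝒜).Q.map (coprodι T j) =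
      (quasiIso 𝒜).Q.map (coprodι _ j) ≫ (quasiIso 𝒜).Q.map (coprodMap s) := fun j => by
    rw [← Functor.map_comp, ← Functor.map_comp]
    exact congrArg _ (ι_desc (fun j => s j ≫ coprodι T j) j).symm
  refine ⟨Cofan.IsColimit.mk _ (fun t => inv ((quasiIso 𝒜).Q.map (coprodMap s)) ≫
    Cofan.IsColimit.desc hS fun j => (quasiIso 𝒜).Q.map (s j) ≫ t.inj j) (fun t j => ?_)
    fun t m hm => ?_⟩
  · have h1 := Cofan.IsColimit.fac hS (fun j => (quasiIso 𝒜).Q.map (s j) ≫ t.inj j) j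
    rw [← cancel_epi ((quasiIso 𝒜).Q.map (s j)), ← h1, ← Category.assoc]
    change ((quasiIso 𝒜).Q.map (s j) ≫ (quasiIso 𝒜).Q.map (coprodι T j)) ≫ _ = _
    rw [hcomm, Category.assoc, IsIso.hom_inv_id_assoc]
    rfl
  · rw [IsIso.eq_inv_comp]
    refine Cofan.IsColimit.hom_ext hS _ _ fun j => ?_
    rw [Cofan.IsColimit.fac]
    change (quasiIso 𝒜).Q.map (coprodι _ j) ≫ _ ≫ _ = _
    rw [← Category.assoc, ← hcomm, Category.assoc]
    exact congrArg _ (hm j)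

end Coproducts

/-! ### Small objects -/

section Small

variable {A : Type u} [CommRing A] {𝒜 : ℤ → AddSubgroup A} [GradedRing 𝒜]

theorem isSmallObject_of_iso {D : Type*} [Category D] {X Y : D} (e : X ≅ Y)
    (h : IsSmallObject.{u} X) : IsSmallObject.{u} Y := by
  intro J Z c hc f
  obtain ⟨F, cF, hcF, g, hg⟩ := h J Z c hc (e.hom ≫ f)
  exact ⟨F, cF, hcF, e.inv ≫ g, by rw [Category.assoc, hg, Iso.inv_hom_id_assoc]⟩

theorem isSmallObject_iff_of_quasiIso {M N : DGModule 𝒜} {s : M ⟶ N} (hs : quasiIso 𝒜 s) :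
    IsSmallObject.{u} (toDerived 𝒜 M) ↔ IsSmallObject.{u} (toDerived 𝒜 N) :=
  have := (quasiIso 𝒜).Q_inverts _ hs
  ⟨isSmallObject_of_iso (asIso ((quasiIso 𝒜).Q.map s)),
    isSmallObject_of_iso (asIso ((quasiIso 𝒜).Q.map s)).symm⟩

variable {J : Type u}

/-- The inclusion of the direct sum over a finite set of indices. -/
noncomputable def coprodIncl (T : J → DGModule 𝒜) (F : Finset J) :
    coprod (fun j : (F : Set J) => T j) ⟶ coprod T :=
  coprodDesc fun j => coprodι T j

open Classical in
/-- The projection to the direct sum over a finite set of indices. -/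
noncomputable def coprodRestrict (T : J → DGModule 𝒜) (F : Finset J) :
    coprod T ⟶ coprod (fun j : (F : Set J) => T j) :=
  coprodDesc fun j => if h : j ∈ F then coprodι (fun j : (F : Set J) => T j) ⟨j, h⟩
    else zeroHom _ _

theorem coprodIncl_coprodRestrict (T : J → DGModule 𝒜) (F : Finset J) (x : (coprod T).carrier)
    (hx : ∀ j ∉ F, x j = 0) :
    (coprodIncl T F).toLinearMap ((coprodRestrict T F).toLinearMap x) = x := by
  classical
  have hsum : x = ∑ j ∈ DFinsupp.support x, (coprodι T j).toLinearMap (x j) :=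
    (DirectSum.sum_support_of x).symm
  conv_lhs => rw [hsum]
  conv_rhs => rw [hsum]
  rw [map_sum, map_sum]
  refine Finset.sum_congr rfl fun j hj => ?_
  have hjF : j ∈ F := by
    by_contra h
    exact (DFinsupp.mem_support_iff.mp hj) (hx j h)
  have h1 : coprodι T j ≫ coprodRestrict T F =
      coprodι (fun j : (F : Set J) => T j) ⟨j, hjF⟩ := by
    rw [coprodRestrict, ι_desc, dif_pos hjF]
  have h2 : coprodι (fun j : (F : Set J) => T j) ⟨j, hjF⟩ ≫ coprodIncl T F = coprodι T j :=
    ι_desc (fun j : (F : Set J) => coprodι T j) ⟨j, hjF⟩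
  have h3 : coprodι T j ≫ coprodRestrict T F ≫ coprodIncl T F = coprodι T j := by
    rw [← Category.assoc, h1, h2]
  exact congrArg (fun f => Hom.toLinearMap f (x j)) h3

/-- Finitely generated K-projective DG modules are small in the derived category. -/
theorem KProjective.isSmallObject {P : DGModule 𝒜} (hP : KProjective P)
    [hfin : Module.Finite A P.carrier] : IsSmallObject.{u} (toDerived 𝒜 P) := by
  classical
  intro J Y c hc f
  -- The objects of the derived category are the DG modules.
  obtain ⟨T, rfl⟩ : ∃ T : J → DGModule 𝒜, Y = fun j => toDerived 𝒜 (T j) :=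
    ⟨fun j => (Y j).toDGModule, rfl⟩
  obtain ⟨hT⟩ := nonempty_isColimit_derivedCofan T
  let θ : toDerived 𝒜 (coprod T) ⟶ c.pt := Cofan.IsColimit.desc hT c.inj
  let θ' : c.pt ⟶ toDerived 𝒜 (coprod T) := Cofan.IsColimit.desc hc (derivedCofan J T).inj
  have hθ : θ' ≫ θ = 𝟙 _ := Cofan.IsColimit.hom_ext hc _ _ fun j => by
    rw [← Category.assoc, Cofan.IsColimit.fac, Cofan.IsColimit.fac, Category.comp_id]
  obtain ⟨f₀, hf₀⟩ := hP.exists_map_eq (f ≫ θ')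
  obtain ⟨G, hG⟩ := hfin.fg_top
  -- The images of finitely many generators lie in a finite direct sum.
  let F : Finset J := G.biUnion fun x => DFinsupp.support (f₀.toLinearMap x)
  have hF : ∀ x, ∀ j ∉ F, f₀.toLinearMap x j = 0 := by
    intro x j hj
    have hle : Submodule.span A (G : Set P.carrier) ≤
        LinearMap.ker (DirectSum.component A J (fun j => (T j).carrier) j ∘ₗ f₀.toLinearMap) := by
      refine Submodule.span_le.mpr fun y hy => ?_
      by_contra h
      exact hj (Finset.mem_biUnion.mpr ⟨y, hy, DFinsupp.mem_support_iff.mpr h⟩)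
    exact hle (hG ▸ Submodule.mem_top (x := x))
  obtain ⟨hTF⟩ := nonempty_isColimit_derivedCofan fun j : (F : Set J) => T j
  refine ⟨F, _, hTF, (quasiIso 𝒜).Q.map (f₀ ≫ coprodRestrict T F), ?_⟩
  have h1 : Cofan.IsColimit.desc hTF (fun j : (F : Set J) => c.inj (j : J)) =
      (quasiIso 𝒜).Q.map (coprodIncl T F) ≫ θ := by
    refine Cofan.IsColimit.hom_ext hTF _ _ fun j => ?_
    rw [Cofan.IsColimit.fac, ← Category.assoc]
    have h2 : (quasiIso 𝒜).Q.map (coprodι (fun j : (F : Set J) => T j) j) ≫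
        (quasiIso 𝒜).Q.map (coprodIncl T F) = (derivedCofan J T).inj j := by
      rw [← Functor.map_comp]
      exact congrArg _ (ι_desc (fun j : (F : Set J) => coprodι T j) j)
    change _ = ((quasiIso 𝒜).Q.map (coprodι (fun j : (F : Set J) => T j) j) ≫
        (quasiIso 𝒜).Q.map (coprodIncl T F)) ≫ θ
    rw [h2, Cofan.IsColimit.fac]
  have h3 : (f₀ ≫ coprodRestrict T F) ≫ coprodIncl T F = f₀ :=
    hom_ext fun x => coprodIncl_coprodRestrict T F _ (hF x)
  refine (congrArg _ h1).trans ?_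
  rw [← Category.assoc, ← Functor.map_comp, h3, hf₀, Category.assoc, hθ, Category.comp_id]

/-- The projection of a direct sum to a summand. -/
noncomputable def coprodπ (T : J → DGModule 𝒜) (j : J) : coprod T ⟶ T j where
  toLinearMap := DirectSum.component A J (fun j => (T j).carrier) j
  map_mem _ _ hx := hx j
  map_d x := coprod_d_apply T x j

theorem ι_π_self (T : J → DGModule 𝒜) (j : J) : coprodι T j ≫ coprodπ T j = 𝟙 _ := by
  classical
  exact hom_ext fun x => DirectSum.lof_apply A (M := fun j => (T j).carrier) j x

theorem ι_π_of_ne (T : J → DGModule 𝒜) {i j : J} (h : i ≠ j) :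
    coprodι T i ≫ coprodπ T j = zeroHom _ _ := by
  classical
  exact hom_ext fun x => DirectSum.of_eq_of_ne (β := fun j => (T j).carrier) i j x (Ne.symm h)

/-- All but finitely many components of a morphism from a small K-projective DG module to a direct
sum are null-homotopic. -/
theorem KProjective.exists_nullHomotopic {P : DGModule 𝒜} (hP : KProjective P)
    (h : IsSmallObject.{u} (toDerived 𝒜 P)) (T : J → DGModule 𝒜) (f : P ⟶ coprod T) :
    ∃ F : Finset J, ∀ j ∉ F, NullHomotopic (f ≫ coprodπ T j) := by
  obtain ⟨hT⟩ := nonempty_isColimit_derivedCofan T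
  obtain ⟨F, cF, hcF, g, hg⟩ := h J _ _ hT ((quasiIso 𝒜).Q.map f)
  refine ⟨F, fun j hj => nullHomotopic_of_homotopic (hP.homotopic ?_)⟩
  have h1 : Cofan.IsColimit.desc hcF (fun j : F => (derivedCofan J T).inj (j : J)) ≫
      (quasiIso 𝒜).Q.map (coprodπ T j) =
      Cofan.IsColimit.desc hcF (fun j : F => (derivedCofan J T).inj (j : J)) ≫
      (quasiIso 𝒜).Q.map (zeroHom _ _) := by
    refine Cofan.IsColimit.hom_ext hcF _ _ fun i => ?_
    rw [← Category.assoc, ← Category.assoc, Cofan.IsColimit.fac]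
    change (quasiIso 𝒜).Q.map (coprodι T i) ≫ _ = (quasiIso 𝒜).Q.map (coprodι T i) ≫ _
    rw [← Functor.map_comp, ← Functor.map_comp, ι_π_of_ne T fun h : (i : J) = j => hj (h ▸ i.2)]
    rfl
  have h2 : f ≫ zeroHom (coprod T) (T j) = zeroHom _ _ := rfl
  rw [← h2, Functor.map_comp, Functor.map_comp, ← hg]
  exact (Category.assoc _ _ _).trans ((congrArg _ h1).trans (Category.assoc _ _ _).symm)

end Small

end DGModule

/-! ### Relations that vanish at a prime -/

section LocalKernel

/-- A minimal free cover of a projective module over a local ring is injective. -/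
theorem ker_eq_bot_of_projective {S F M : Type*} [CommRing S] [IsLocalRing S] [IsNoetherianRing S]
    [AddCommGroup F] [Module S F] [Module.Finite S F] [AddCommGroup M] [Module S M]
    [Module.Projective S M] {g : F →ₗ[S] M} (hg : Function.Surjective g)
    (hker : LinearMap.ker g ≤ IsLocalRing.maximalIdeal S • (⊤ : Submodule S F)) :
    LinearMap.ker g = ⊥ := by
  obtain ⟨σ, hσ⟩ := Module.projective_lifting_property g LinearMap.id hg
  -- `r` is a retraction of `F` onto the kernel, so the kernel `L` satisfies `L = 𝔪 L`.
  let r : F →ₗ[S] F := LinearMap.id - σ ∘ₗ g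
  have hr : ∀ x, g x = 0 → r x = x := fun x hx => by simp [r, hx]
  have hrange : Submodule.map r ⊤ ≤ LinearMap.ker g := by
    rintro _ ⟨x, -, rfl⟩
    have : g (σ (g x)) = g x := LinearMap.congr_fun hσ (g x)
    simp [r, this]
  refine Submodule.eq_bot_of_le_smul_of_le_jacobson_bot (IsLocalRing.maximalIdeal S) _
    (IsNoetherian.noetherian _) (fun x hx => ?_) (IsLocalRing.maximalIdeal_le_jacobson _)
  have h1 : r x ∈ Submodule.map r (IsLocalRing.maximalIdeal S • (⊤ : Submodule S F)) :=
    Submodule.mem_map_of_mem (hker hx)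
  rw [Submodule.map_smul'', hr x hx] at h1
  exact Submodule.smul_mono le_rfl hrange h1

theorem exact_lTensor_ker_subtype {A F H : Type*} [CommRing A] [AddCommGroup F] [Module A F]
    [AddCommGroup H] [Module A H] (S : Type*) [AddCommGroup S] [Module A S] {π : F →ₗ[A] H}
    (hπ : Function.Surjective π) :
    Function.Exact ((LinearMap.ker π).subtype.lTensor S) (π.lTensor S) :=
  lTensor_exact S (LinearMap.exact_subtype_ker_map π) hπ

/-- If a module `H` is projective locally at a prime `m`, then the relations between
generators of `H` with all coefficients in `m` vanish locally at `m`. -/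
theorem exists_notMem_smul_eq_zero {A J H : Type u} [CommRing A] [IsNoetherianRing A] [Finite J]
    [AddCommGroup H] [Module A H] (m : Ideal A) [m.IsPrime] (S : Type u) [CommRing S] [Algebra A S]
    [IsLocalization.AtPrime S m] [Module.Projective S (S ⊗[A] H)]
    {π : (J →₀ A) →ₗ[A] H} (hπ : Function.Surjective π)
    (hker : ∀ x, π x = 0 → ∀ j, x j ∈ m) {x : J →₀ A} (hx : π x = 0) :
    ∃ s ∉ m, s • x = 0 := by
  have hloc : IsLocalRing S := IsLocalization.AtPrime.isLocalRing S m
  have hnoeth : IsNoetherianRing S :=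
    IsLocalization.isNoetherianRing m.primeCompl S inferInstance
  have hexact : Function.Exact ((LinearMap.ker π).subtype.lTensor S) (π.lTensor S) :=
    exact_lTensor_ker_subtype S hπ
  have hmem : ∀ z : S ⊗[A] LinearMap.ker π, (LinearMap.ker π).subtype.lTensor S z ∈
      IsLocalRing.maximalIdeal S • (⊤ : Submodule S (S ⊗[A] (J →₀ A))) := by
    intro z
    induction z using TensorProduct.induction_on with
    | zero => rw [map_zero]; exact zero_mem _
    | add z w hz hw =>
      rw [map_add]
      exact add_mem hz hw
    | tmul s k =>
      rw [LinearMap.lTensor_tmul, Submodule.subtype_apply]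
      have hk : s ⊗ₜ[A] k.1 = ∑ j ∈ k.1.support, s ⊗ₜ[A] Finsupp.single j (k.1 j) := by
        rw [← TensorProduct.tmul_sum]
        exact congrArg _ (Finsupp.sum_single k.1).symm
      rw [hk]
      refine sum_mem fun j _ => ?_
      have h1 : s ⊗ₜ[A] Finsupp.single j (k.1 j) =
          algebraMap A S (k.1 j) • (s ⊗ₜ[A] Finsupp.single j (1 : A)) := by
        rw [algebraMap_smul, ← TensorProduct.tmul_smul, Finsupp.smul_single, smul_eq_mul, mul_one]
      rw [h1]
      refine Submodule.smul_mem_smul ?_ Submodule.mem_top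
      exact (IsLocalization.AtPrime.to_map_mem_maximal_iff S m _).mpr (hker _ k.2 j)
  have hbot : LinearMap.ker (π.baseChange S) = ⊥ := by
    refine ker_eq_bot_of_projective (LinearMap.lTensor_surjective S hπ) fun y hy => ?_
    obtain ⟨z, rfl⟩ := (hexact y).mp hy
    exact hmem z
  have h0 : TensorProduct.mk A S (J →₀ A) 1 x = 0 := by
    have : (1 : S) ⊗ₜ[A] x ∈ LinearMap.ker (π.baseChange S) := by
      rw [LinearMap.mem_ker, LinearMap.baseChange_tmul, hx, TensorProduct.tmul_zero]
    rw [hbot] at this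
    exact this
  obtain ⟨s, hs⟩ := (IsLocalizedModule.eq_zero_iff m.primeCompl
    (TensorProduct.mk A S (J →₀ A) 1)).mp h0
  exact ⟨s, s.2, hs⟩

end LocalKernel

namespace DGModule

/-! ### Finite resolutions of DG modules -/

section FiniteResolution

variable {A : Type u} [CommRing A] {𝒜 : ℤ → AddSubgroup A} [GradedRing 𝒜]

theorem homology_mk_eq_zero_iff {M : DGModule 𝒜} (x : M.cycles) :
    (Submodule.Quotient.mk x : M.homology) = 0 ↔ ∃ y, M.d y = x.1 :=
  Submodule.Quotient.mk_eq_zero _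

theorem span_homogeneous_classes (M : DGModule 𝒜) :
    Submodule.span A {h : M.homology | ∃ (n : ℤ) (z : M.cycles), z.1 ∈ M.grading n ∧
      Submodule.Quotient.mk z = h} = ⊤ := by
  rw [eq_top_iff]
  rintro h -
  obtain ⟨z, rfl⟩ := Submodule.Quotient.mk_surjective _ h
  have hz : ∀ n, M.d (M.proj n z.1) = 0 := fun n => by
    rw [← proj_d, show M.d z.1 = 0 from z.2, map_zero]
  obtain ⟨s, hs⟩ := exists_finset_sum_proj z.1
  have h1 : z = ∑ n ∈ s, (⟨M.proj n z.1, hz n⟩ : M.cycles) := Subtype.ext (by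
    rw [AddSubmonoidClass.coe_finsetSum]; exact hs)
  rw [h1, ← Submodule.mkQ_apply, map_sum]
  exact sum_mem fun n _ => Submodule.subset_span ⟨n, _, M.proj_mem n z.1, rfl⟩

/-- If the cone of a morphism from a K-projective DG module has a finitely generated
K-projective resolution, then so does its target. -/
theorem exists_resolution_of_cone {F N P : DGModule 𝒜} (hF : KProjective F) (hP : KProjective P)
    [Module.Finite A F.carrier] [Module.Finite A P.carrier] (φ : F ⟶ N) (q : P ⟶ cone φ)
    (hq : quasiIso 𝒜 q) : ∃ (Q : DGModule 𝒜) (s : Q ⟶ N), KProjective Q ∧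
      Module.Finite A Q.carrier ∧ quasiIso 𝒜 s := by
  let α : P.carrier →ₗ[A] N.carrier := coneFst φ ∘ₗ q.toLinearMap
  let b : P.carrier →ₗ[A] F.carrier := coneSnd φ ∘ₗ q.toLinearMap
  have hα : ∀ p, α (P.d p) = N.d (α p) + φ.toLinearMap (b p) := fun p =>
    congrArg (coneFst φ) (q.map_d p)
  have hb : ∀ p, b (P.d p) = - F.d (b p) := fun p => congrArg (coneSnd φ) (q.map_d p)
  have hq1 : ∀ p, P.d p = 0 → ∀ y x, α p = N.d y + φ.toLinearMap x → b p = - F.d x →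
      ∃ p', P.d p' = p := fun p hp y x h1 h2 =>
    ((quasiIso_iff q).mp hq).1 p hp ⟨coneMk φ y x, cone_ext h1.symm h2.symm⟩
  have hq2 : ∀ y x, N.d y + φ.toLinearMap x = 0 → F.d x = 0 → ∃ p, P.d p = 0 ∧ ∃ y' x',
      N.d y' + φ.toLinearMap x' = y - α p ∧ - F.d x' = x - b p := by
    intro y x h1 h2
    obtain ⟨p, hp, z, hz⟩ := ((quasiIso_iff q).mp hq).2 (coneMk φ y x)
      (cone_ext h1 (by simp [h2]))
    exact ⟨p, hp, coneFst φ z, coneSnd φ z, congrArg (coneFst φ) hz, congrArg (coneSnd φ) hz⟩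
  -- The resolution is the cone of the component of `q` in `F`, a morphism from a shift of `P`.
  let β : P.shift 1 ⟶ F :=
    { toLinearMap := b
      map_mem := fun n x hx => by
        have h1 : b x ∈ F.grading (n + 1 - 1) := (q.map_mem hx).2
        rwa [add_sub_cancel_right] at h1
      map_d := fun x => by
        change b (-(P.d x)) = F.d (b x)
        rw [map_neg, hb, neg_neg] }
  have dmk : ∀ x p, (cone β).d (coneMk β x p) = coneMk β (F.d x + b p) (P.d p) := fun x p =>
    cone_ext rfl (neg_neg (P.d p))
  let s : cone β ⟶ N :=
    { toLinearMap := α ∘ₗ coneSnd β - φ.toLinearMap ∘ₗ coneFst β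
      map_mem := fun n z hz => by
        have h1 : coneSnd β z ∈ P.grading (n - 1 + 1) := hz.2
        rw [sub_add_cancel] at h1
        exact sub_mem (q.map_mem h1).1 (φ.map_mem hz.1)
      map_d := fun z => by
        change α (coneSnd β ((cone β).d (coneMk β (coneFst β z) (coneSnd β z)))) -
          φ.toLinearMap (coneFst β ((cone β).d (coneMk β (coneFst β z) (coneSnd β z)))) =
            N.d (α (coneSnd β z) - φ.toLinearMap (coneFst β z))
        rw [dmk, coneFst_mk, coneSnd_mk, hα, map_add, map_sub, φ.map_d]
        abel }
  have sapply : ∀ x p, s.toLinearMap (coneMk β x p) = α p - φ.toLinearMap x := fun _ _ => rfl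
  refine ⟨cone β, s, (hP.shift 1).cone hF β,
    inferInstanceAs (Module.Finite A (F.carrier × P.carrier)), ?_⟩
  refine (quasiIso_iff s).mpr ⟨fun z hz ⟨y, hy⟩ => ?_, fun y hy => ?_⟩
  · obtain ⟨x, p, rfl⟩ : ∃ x p, z = coneMk β x p := ⟨coneFst β z, coneSnd β z, rfl⟩
    rw [dmk] at hz
    rw [sapply] at hy
    have hz1 : F.d x + b p = 0 := congrArg (coneFst β) hz
    have hz2 : P.d p = 0 := congrArg (coneSnd β) hz
    obtain ⟨p', rfl⟩ := hq1 p hz2 y x (by rw [hy, sub_add_cancel]) (eq_neg_of_add_eq_zero_right hz1)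
    obtain ⟨p'', hp'', y', x', h1, h2⟩ := hq2 (α p' - y) (b p' - x) (by
      rw [map_sub, map_sub, hy, hα]; abel) (by
      rw [map_sub, sub_eq_zero, ← neg_inj, ← hb, eq_neg_iff_add_eq_zero, add_comm, hz1])
    refine ⟨coneMk β x' (p' - p''), ?_⟩
    rw [dmk, map_sub, map_sub, hp'', sub_zero]
    congr 1
    rw [← neg_neg (F.d x'), h2]
    abel
  · obtain ⟨p, hp, y', x', h1, h2⟩ := hq2 y 0 (by simp [hy]) (map_zero _)
    refine ⟨coneMk β (-x') p, ?_, y', ?_⟩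
    · rw [dmk, map_neg, h2, hp, zero_sub, neg_add_cancel]
      rfl
    · rw [sapply, map_neg, sub_neg_eq_add, ← sub_sub, ← h1, add_sub_cancel_right]

/-- The free DG module with zero differential on homogeneous generators. -/
noncomputable abbrev free {J : Type u} (deg : J → ℤ) : DGModule 𝒜 :=
  semifree deg (fun _ => 0) (fun _ => zero_mem _) fun _ => map_zero _

theorem free_d {J : Type u} (deg : J → ℤ) (x : J →₀ A) :
    (free (𝒜 := 𝒜) deg).d x = 0 := by
  change Finsupp.linearCombination A (fun _ : J => (0 : J →₀ A)) x = 0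
  rw [Finsupp.linearCombination_apply]
  simp

theorem kProjective_free {J : Type u} (deg : J → ℤ) : KProjective (free (𝒜 := 𝒜) deg) :=
  kProjective_semifree _ _ (fun _ => 0) fun _ _ h => by simp at h

/-- If the homogeneous elements outside `m` are units, then nonzero homogeneous elements are not
killed by elements outside `m`. -/
theorem eq_zero_of_smul_eq_zero {m : Ideal A}
    (hm : ∀ i, ∀ a ∈ 𝒜 i, a ∉ m → IsUnit a) {M : DGModule 𝒜} {n : ℤ} {x : M.carrier}
    (hx : x ∈ M.grading n) {s : A} (hs : s ∉ m) (hsx : s • x = 0) : x = 0 := by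
  classical
  obtain ⟨i, hi⟩ : ∃ i, ((DirectSum.decompose 𝒜 s i : 𝒜 i) : A) ∉ m := by
    by_contra! h
    exact hs (DirectSum.sum_support_decompose 𝒜 s ▸ sum_mem fun i _ => h i)
  have h1 : ((DirectSum.decompose 𝒜 s i : 𝒜 i) : A) • x = M.proj (i + n) (s • x) := by
    conv_rhs => rw [← DirectSum.sum_support_decompose 𝒜 s, Finset.sum_smul, map_sum]
    by_cases his : i ∈ (DirectSum.decompose 𝒜 s).support
    · rw [Finset.sum_eq_single_of_mem i his fun j _ hj =>
        proj_of_mem_ne (M.smul_mem (SetLike.coe_mem _) hx) (by omega),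
        proj_of_mem (M.smul_mem (SetLike.coe_mem _) hx)]
    · exact absurd (by rw [DFinsupp.notMem_support_iff.mp his]; exact m.zero_mem) hi
  rw [hsx, map_zero] at h1
  exact ((hm i _ (SetLike.coe_mem _) hi).smul_eq_zero).mp h1

/-- The homology of the cone of a morphism `φ : F ⟶ N` that is surjective on homology, for a DG
module `F` with zero differential, is the kernel of the map on homology. -/
theorem exists_homology_cone_equiv {F N : DGModule 𝒜} (hF : ∀ x, F.d x = 0) (φ : F ⟶ N)
    {π : F.carrier →ₗ[A] N.homology}
    (hker : ∀ x, π x = 0 ↔ ∃ y, N.d y = φ.toLinearMap x)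
    (hπ : ∀ y, N.d y = 0 → ∃ x y', N.d y' = y - φ.toLinearMap x) :
    Nonempty ((cone φ).homology ≃ₗ[A] LinearMap.ker π) := by
  let g : (cone φ).cycles →ₗ[A] LinearMap.ker π :=
    (coneSnd φ ∘ₗ (cone φ).cycles.subtype).codRestrict _ fun z => (hker _).mpr
      ⟨-coneFst φ z.1, by
        have h1 : N.d (coneFst φ z.1) + φ.toLinearMap (coneSnd φ z.1) = 0 :=
          congrArg (coneFst φ) z.2
        rw [map_neg]
        exact (eq_neg_of_add_eq_zero_right h1).symm⟩
  have hg : Function.Surjective g := by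
    rintro ⟨x, hx⟩
    obtain ⟨y, hy⟩ := (hker x).mp hx
    exact ⟨⟨coneMk φ (-y) x, cone_ext (by simp [hy]) (by simp [hF])⟩, rfl⟩
  have hgk : (cone φ).boundaries = LinearMap.ker g := by
    ext z
    constructor
    · rintro ⟨w, hw⟩
      refine Subtype.ext ?_
      change coneSnd φ z.1 = 0
      rw [← show (cone φ).d w = z.1 from hw, coneSnd_d, hF, neg_zero]
    · intro hz
      have hz2 : coneSnd φ z.1 = 0 := congrArg Subtype.val hz
      have h1 : N.d (coneFst φ z.1) + φ.toLinearMap (coneSnd φ z.1) = 0 :=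
        congrArg (coneFst φ) z.2
      rw [hz2, map_zero, add_zero] at h1
      obtain ⟨x, y, hy⟩ := hπ _ h1
      exact ⟨coneMk φ y x, cone_ext (f := φ) (by simp [hy]) (by simp [hF, hz2])⟩
  exact ⟨(Submodule.quotEquivOfEq _ _ hgk).trans (g.quotKerEquivOfSurjective hg)⟩

/-- A DG module with finitely generated homology receives a morphism from a free DG module with
zero differential that is surjective on homology, such that the coefficients of all relations
between the classes of the generators lie in `m`. -/
theorem exists_minimal_homology_cover (m : Ideal A) [m.IsPrime]
    (hm : ∀ i, ∀ a ∈ 𝒜 i, a ∉ m → IsUnit a) (N : DGModule 𝒜) [Module.Finite A N.homology] :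
    ∃ (J : Type u) (_ : Finite J) (deg : J → ℤ) (φ : free (𝒜 := 𝒜) deg ⟶ N)
      (π : (J →₀ A) →ₗ[A] N.homology), Function.Surjective π ∧
      (∀ x, ∃ h : N.d (φ.toLinearMap x) = 0,
        π x = Submodule.Quotient.mk ⟨φ.toLinearMap x, h⟩) ∧
      ∀ x, π x = 0 → ∀ j, x j ∈ m := by
  classical
  obtain ⟨T, hT, hspan, hirr⟩ := exists_irredundant_generators _ (span_homogeneous_classes N)
  choose n z hz hcl using fun t : T => hT t.2
  let φ : free (𝒜 := 𝒜) n ⟶ N := semifreeDesc (fun t => (z t).1) hz fun t => by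
    rw [map_zero, show N.d (z t).1 = 0 from (z t).2]
  let ψ : (T →₀ A) →ₗ[A] N.cycles := Finsupp.linearCombination A z
  let π : (T →₀ A) →ₗ[A] N.homology := N.boundaries.mkQ ∘ₗ ψ
  have hψ : ∀ x, (ψ x).1 = φ.toLinearMap x := fun x =>
    N.cycles.subtype.map_finsupp_linearCombination x
  have hπ : ∀ x, π x = x.sum fun t a => a • (t : N.homology) := fun x => by
    change N.boundaries.mkQ (Finsupp.linearCombination A z x) = _
    rw [LinearMap.map_finsupp_linearCombination, Finsupp.linearCombination_apply]
    exact Finsupp.sum_congr fun t _ => congrArg _ (hcl t)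
  have hπφ : ∀ x, ∃ h : N.d (φ.toLinearMap x) = 0,
      π x = Submodule.Quotient.mk ⟨φ.toLinearMap x, h⟩ := fun x =>
    ⟨by rw [← hψ]; exact (ψ x).2, congrArg Submodule.Quotient.mk (Subtype.ext (hψ x))⟩
  have hπ0 : ∀ x, π x = 0 ↔ ∃ y, N.d y = φ.toLinearMap x := fun x => by
    obtain ⟨h, h'⟩ := hπφ x
    rw [h', homology_mk_eq_zero_iff]
  refine ⟨T, inferInstance, n, φ, π, ?_, hπφ, fun x hx j => ?_⟩
  · have h1 : π = Finsupp.linearCombination A Subtype.val :=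
      LinearMap.ext fun x => (hπ x).trans (Finsupp.linearCombination_apply _ _).symm
    rw [← LinearMap.range_eq_top, h1, Finsupp.range_linearCombination, Subtype.range_val]
    exact hspan
  · by_contra hxj
    -- A homogeneous component of the relation `x` has a unit as its coefficient at `j`.
    obtain ⟨s, hs⟩ := exists_finset_sum_proj (M := free (𝒜 := 𝒜) n) x
    obtain ⟨k, hk⟩ : ∃ k, ((free (𝒜 := 𝒜) n).proj k x : T →₀ A) j ∉ m := by
      by_contra! h
      refine hxj ?_
      have h1 := congrArg (fun w : T →₀ A => w j) hs
      simp only [Finsupp.finsetSum_apply] at h1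
      rw [h1]
      exact sum_mem fun k _ => h k
    obtain ⟨w, hwdef⟩ : ∃ w : T →₀ A, w = (free (𝒜 := 𝒜) n).proj k x := ⟨_, rfl⟩
    rw [← hwdef] at hk
    have hunit : IsUnit (w j) := by
      refine hm (k - n j) _ ?_ hk
      rw [hwdef]
      exact (free (𝒜 := 𝒜) n).proj_mem k x j
    have hw : π w = 0 := by
      obtain ⟨y, hy⟩ := (hπ0 x).mp hx
      refine (hπ0 w).mpr ⟨N.proj (k + 1) y, ?_⟩
      rw [← proj_d, add_sub_cancel_right, hy, hwdef]
      exact φ.proj_map k x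
    apply hirr j j.2
    have hsupp : j ∈ w.support := Finsupp.mem_support_iff.mpr fun h => hk (h ▸ m.zero_mem)
    rw [hπ, Finsupp.sum, ← Finset.add_sum_erase _ _ hsupp] at hw
    rw [← Submodule.smul_mem_iff_of_isUnit _ hunit, eq_neg_of_add_eq_zero_left hw]
    refine neg_mem (sum_mem fun s hs => Submodule.smul_mem _ _ (Submodule.subset_span ⟨s.2, ?_⟩))
    exact fun h => Finset.ne_of_mem_erase hs (Subtype.ext h)

variable [IsNoetherianRing A]

/-- A coefficient-finitely generated DG module whose homology has finite projective dimension at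
`m` has a finitely generated K-projective resolution, if the homogeneous elements outside `m` are
units. -/
theorem exists_finite_kProjective_resolution (m : Ideal A) [m.IsPrime]
    (hm : ∀ i, ∀ a ∈ 𝒜 i, a ∉ m → IsUnit a) (S : Type u) [CommRing S] [Algebra A S]
    [IsLocalization.AtPrime S m] (n : ℕ) (N : DGModule 𝒜)
    [Module.Finite A N.homology] (h : PdLE S (S ⊗[A] N.homology) n) :
    ∃ (P : DGModule 𝒜) (s : P ⟶ N), KProjective P ∧ Module.Finite A P.carrier ∧
      quasiIso 𝒜 s := by
  induction n generalizing N with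
  | zero =>
    have hproj := pdLE_zero_iff.mp h
    obtain ⟨J, hJ, deg, φ, π, hπ, hπφ, hm'⟩ := exists_minimal_homology_cover m hm N
    have hπ0 : ∀ x, π x = 0 ↔ ∃ y, N.d y = φ.toLinearMap x := fun x => by
      obtain ⟨h, h'⟩ := hπφ x
      rw [h', homology_mk_eq_zero_iff]
    refine ⟨_, φ, kProjective_free deg, inferInstanceAs (Module.Finite A (J →₀ A)),
      (quasiIso_iff φ).mpr ⟨fun x _ ⟨y, hy⟩ => ⟨0, ?_⟩, fun y hy => ?_⟩⟩
    · -- The homogeneous components of a relation are relations, and they vanish locally at `m`.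
      have hx0 : x = 0 := by
        refine ext_proj fun k => ?_
        rw [map_zero]
        obtain ⟨s, hs, hsx⟩ := exists_notMem_smul_eq_zero m S hπ hm'
          (x := (free (𝒜 := 𝒜) deg).proj k x) ((hπ0 _).mpr ⟨N.proj (k + 1) y, by
            rw [← proj_d, add_sub_cancel_right, hy]
            exact φ.proj_map k x⟩)
        exact eq_zero_of_smul_eq_zero hm ((free (𝒜 := 𝒜) deg).proj_mem k x) hs hsx
      rw [map_zero, hx0]
    · obtain ⟨x, hx⟩ := hπ (Submodule.Quotient.mk ⟨y, hy⟩)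
      obtain ⟨h1, h2⟩ := hπφ x
      refine ⟨x, free_d deg x, ?_⟩
      have h3 := sub_eq_zero.mpr (hx.symm.trans h2)
      rw [← Submodule.Quotient.mk_sub, homology_mk_eq_zero_iff] at h3
      exact h3
  | succ n ih =>
    obtain ⟨J, hJ, deg, φ, π, hπ, hπφ, -⟩ := exists_minimal_homology_cover m hm N
    obtain ⟨e⟩ := exists_homology_cone_equiv (free_d deg) φ (π := π) (fun x => by
      obtain ⟨h, h'⟩ := hπφ x
      rw [h', homology_mk_eq_zero_iff]) fun y hy => by
      obtain ⟨x, hx⟩ := hπ (Submodule.Quotient.mk ⟨y, hy⟩)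
      obtain ⟨h1, h2⟩ := hπφ x
      have h3 := sub_eq_zero.mpr (hx.symm.trans h2)
      rw [← Submodule.Quotient.mk_sub, homology_mk_eq_zero_iff] at h3
      exact ⟨x, h3⟩
    have hfin : Module.Finite A (DGModule.cone φ).homology :=
      Module.Finite.equiv e.symm
    have hflat : Module.Flat A S := IsLocalization.flat S m.primeCompl
    have hexact : Function.Exact ((LinearMap.ker π).subtype.lTensor S) (π.lTensor S) :=
      exact_lTensor_ker_subtype S hπ
    have h1 : PdLE S (S ⊗[A] LinearMap.ker π) n :=
      (pdLE_succ_iff_of_exact (i := (LinearMap.ker π).subtype.baseChange S)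
        (f := π.baseChange S)
        (Module.Flat.lTensor_preserves_injective_linearMap _ (Submodule.injective_subtype _))
        hexact (LinearMap.lTensor_surjective S hπ)).mp h
    obtain ⟨P, q, hP, hPfin, hq⟩ := ih _ (h1.of_equiv (e.symm.baseChange A S _ _))
    obtain ⟨Q, s, hQ⟩ := exists_resolution_of_cone (kProjective_free deg) hP φ q hq
    exact ⟨Q, s, hQ⟩

end FiniteResolution

/-! ### Small graded modules have finite projective dimension -/

section Syzygies

variable {A : Type u} [CommRing A] {𝒜 : ℤ → AddSubgroup A} [GradedRing 𝒜]

/-- The homogeneous elements of a DG module, together with a degree. -/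
abbrev HomogeneousElement (Z : DGModule 𝒜) : Type u := Σ n : ℤ, Z.grading n

/-- The map to a DG module from the free module on its homogeneous elements. -/
noncomputable def freeCover (Z : DGModule 𝒜) : (HomogeneousElement Z →₀ A) →ₗ[A] Z.carrier :=
  Finsupp.linearCombination A fun b => b.2.1

theorem freeCover_single (Z : DGModule 𝒜) (b : HomogeneousElement Z) (a : A) :
    freeCover Z (Finsupp.single b a) = a • b.2.1 :=
  Finsupp.linearCombination_single _ _ _

theorem freeCover_surjective (Z : DGModule 𝒜) : Function.Surjective (freeCover Z) := by
  intro x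
  induction x using homogeneous_induction with
  | zero => exact ⟨0, map_zero _⟩
  | hom n y hy => exact ⟨Finsupp.single ⟨n, y, hy⟩ 1, by rw [freeCover_single, one_smul]⟩
  | add y z hy hz =>
    obtain ⟨y', rfl⟩ := hy
    obtain ⟨z', rfl⟩ := hz
    exact ⟨y' + z', map_add _ _ _⟩

theorem freeCover_mem (Z : DGModule 𝒜) {n : ℤ} {x : HomogeneousElement Z →₀ A}
    (hx : x ∈ freeGrading 𝒜 (fun b : HomogeneousElement Z => b.1) n) :
    freeCover Z x ∈ Z.grading n := by
  have h1 := linearCombination_mem_grading (N := Z) (φ := fun b : HomogeneousElement Z => b.2.1)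
    (s := 0) _ (fun b => by rw [add_zero]; exact b.2.2) hx
  rwa [add_zero] at h1

/-- The first syzygy of a graded module with respect to its free cover by homogeneous elements,
with zero differential. -/
noncomputable def firstSyzygy (Z : DGModule 𝒜) : DGModule 𝒜 where
  carrier := LinearMap.ker (freeCover Z)
  grading n := (freeGrading 𝒜 (fun b : HomogeneousElement Z => b.1) n).comap
    (LinearMap.ker (freeCover Z)).subtype.toAddMonoidHom
  isInternal := by
    refine isInternal_of_jointly_injective _
      (fun _ : Unit => freeGrading 𝒜 fun b : HomogeneousElement Z => b.1)
      (fun _ => freeGrading_isInternal _) (fun _ => 0)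
      (fun _ => (LinearMap.ker (freeCover Z)).subtype.toAddMonoidHom)
      (fun _ n x hx => by rw [add_zero]; exact hx) (fun x hx => Subtype.ext (hx ())) fun x => ?_
    let F : DGModule 𝒜 := free fun b : HomogeneousElement Z => b.1
    have hproj : ∀ k, freeCover Z (F.proj k x.1) = 0 := fun k => by
      have h1 := proj_map_of_degree (M := F) (N := Z) (s := 0) (freeCover Z).toAddMonoidHom
        (fun n y hy => by rw [add_zero]; exact freeCover_mem Z hy) k x.1
      have h2 : (freeCover Z).toAddMonoidHom x.1 = 0 := x.2
      rw [h2, map_zero] at h1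
      exact h1.symm
    obtain ⟨s, hs⟩ := exists_finset_sum_proj (M := F) x.1
    have hx : x = ∑ k ∈ s, (⟨F.proj k x.1, hproj k⟩ : LinearMap.ker (freeCover Z)) :=
      Subtype.ext (by rw [AddSubmonoidClass.coe_finsetSum]; exact hs)
    rw [hx]
    exact sum_mem fun k _ => AddSubgroup.mem_iSup_of_mem k (F.proj_mem k x.1)
  smul_mem i j a x ha hx := (free fun b : HomogeneousElement Z => b.1).smul_mem ha hx
  d := 0
  d_mem _ _ _ := zero_mem _
  d_d _ := rfl

/-- The iterated syzygies of a graded module. -/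
noncomputable def syzygy (N : DGModule 𝒜) : ℕ → DGModule 𝒜
  | 0 => N
  | i + 1 => firstSyzygy (syzygy N i)

variable (N : DGModule 𝒜)

/-- The inclusion of a syzygy in the free cover of the preceding one. -/
noncomputable def syzygyIncl (i : ℕ) :
    (syzygy N (i + 1)).carrier →ₗ[A] (HomogeneousElement (syzygy N i) →₀ A) :=
  (LinearMap.ker (freeCover (syzygy N i))).subtype

theorem syzygyIncl_injective (i : ℕ) : Function.Injective (syzygyIncl N i) :=
  Submodule.injective_subtype (LinearMap.ker (freeCover (syzygy N i)))

theorem freeCover_syzygyIncl (i : ℕ) (x : (syzygy N (i + 1)).carrier) :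
    freeCover (syzygy N i) (syzygyIncl N i x) = 0 :=
  Subtype.property (p := fun x => x ∈ LinearMap.ker (freeCover (syzygy N i))) x

theorem exists_syzygyIncl_eq {i : ℕ} {x : HomogeneousElement (syzygy N i) →₀ A}
    (hx : freeCover (syzygy N i) x = 0) : ∃ y, syzygyIncl N i y = x :=
  ⟨(⟨x, hx⟩ : LinearMap.ker (freeCover (syzygy N i))), rfl⟩

theorem syzygyIncl_mem {i : ℕ} {n : ℤ} {x : (syzygy N (i + 1)).carrier}
    (hx : x ∈ (syzygy N (i + 1)).grading n) : syzygyIncl N i x ∈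
      freeGrading 𝒜 (fun b : HomogeneousElement (syzygy N i) => b.1) n := hx

theorem syzygy_d (hN : ∀ x, N.d x = 0) (i : ℕ) (x : (syzygy N i).carrier) :
    (syzygy N i).d x = 0 := by
  cases i with
  | zero => exact hN x
  | succ i => rfl

theorem pdLE_of_pdLE_syzygy {i n : ℕ} (h : PdLE A (syzygy N i).carrier n) :
    PdLE A N.carrier (n + i) := by
  induction i generalizing n with
  | zero => exact h
  | succ i ih =>
    have h1 : PdLE A (syzygy N i).carrier (n + 1) :=
      (pdLE_succ_iff_of_exact (syzygyIncl_injective N i)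
        (fun x => ⟨exists_syzygyIncl_eq N, by
          rintro ⟨y, rfl⟩; exact freeCover_syzygyIncl N i y⟩)
        (freeCover_surjective (syzygy N i))).mpr h
    have h2 := ih h1
    rwa [add_assoc, add_comm 1 i] at h2

/-- The generators of the total complex of the free resolution by homogeneous elements. -/
abbrev ResolutionGenerator : Type u := Σ i : ℕ, HomogeneousElement (syzygy N i)

/-- The degree of a generator in the total complex: its internal degree plus its homological
degree. -/
def generatorDegree (g : ResolutionGenerator N) : ℤ := g.2.1 + g.1

/-- The generator of the total complex given by a homogeneous element of the `i`-th syzygy. -/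
abbrev mkGenerator (i : ℕ) (b : HomogeneousElement (syzygy N i)) : ResolutionGenerator N := ⟨i, b⟩

theorem mkGenerator_injective (i : ℕ) : Function.Injective (mkGenerator N i) :=
  sigma_mk_injective (β := fun i => HomogeneousElement (syzygy N i))

/-- The inclusion of a term of the resolution in the total complex. -/
noncomputable def termIncl (i : ℕ) :
    (HomogeneousElement (syzygy N i) →₀ A) →ₗ[A] (ResolutionGenerator N →₀ A) :=
  Finsupp.lmapDomain A A (mkGenerator N i)

/-- The projection of the total complex to a term of the resolution. -/
noncomputable def termProj (i : ℕ) :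
    (ResolutionGenerator N →₀ A) →ₗ[A] (HomogeneousElement (syzygy N i) →₀ A) :=
  Finsupp.lcomapDomain (mkGenerator N i) (mkGenerator_injective N i)

theorem termProj_single_same (i : ℕ) (b : HomogeneousElement (syzygy N i)) (a : A) :
    termProj N i (Finsupp.single ⟨i, b⟩ a) = Finsupp.single b a :=
  Finsupp.comapDomain_single (mkGenerator N i) b a (mkGenerator_injective N i).injOn

theorem termProj_single_of_ne {i j : ℕ} (h : j ≠ i) (b : HomogeneousElement (syzygy N j)) (a : A) :
    termProj N i (Finsupp.single ⟨j, b⟩ a) = 0 :=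
  Finsupp.ext fun c => Finsupp.single_eq_of_ne (a := mkGenerator N j b) (a' := mkGenerator N i c)
    fun h' => h (congrArg Sigma.fst h').symm

theorem termIncl_single (i : ℕ) (b : HomogeneousElement (syzygy N i)) (a : A) :
    termIncl N i (Finsupp.single b a) = Finsupp.single ⟨i, b⟩ a :=
  Finsupp.mapDomain_single (f := mkGenerator N i)

theorem termProj_termIncl_same (i : ℕ) (x : HomogeneousElement (syzygy N i) →₀ A) :
    termProj N i (termIncl N i x) = x := by
  induction x using Finsupp.induction_linear with
  | zero => simp
  | add x y hx hy => rw [map_add, map_add, hx, hy]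
  | single b a => rw [termIncl_single, termProj_single_same]

theorem termProj_termIncl_of_ne {i j : ℕ} (h : j ≠ i)
    (x : HomogeneousElement (syzygy N j) →₀ A) : termProj N i (termIncl N j x) = 0 := by
  induction x using Finsupp.induction_linear with
  | zero => simp
  | add x y hx hy => rw [map_add, map_add, hx, hy, add_zero]
  | single b a => rw [termIncl_single, termProj_single_of_ne N h]

theorem exists_sum_termIncl (x : ResolutionGenerator N →₀ A) :
    ∃ s : Finset ℕ, x = ∑ i ∈ s, termIncl N i (termProj N i x) := by
  classical
  refine ⟨x.support.image Sigma.fst, ?_⟩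
  have hsub : ∀ (s : Finset ℕ) (y : ResolutionGenerator N →₀ A), y.support.image Sigma.fst ⊆ s →
      y = ∑ i ∈ s, termIncl N i (termProj N i y) := by
    intro s y hy
    have key : ∀ y : ResolutionGenerator N →₀ A, ∀ j, ∀ b,
        (∑ i ∈ s, termIncl N i (termProj N i (Finsupp.single ⟨j, b⟩ (y ⟨j, b⟩)))) =
          if j ∈ s then Finsupp.single ⟨j, b⟩ (y ⟨j, b⟩) else 0 := by
      intro y j b
      split_ifs with h
      · rw [Finset.sum_eq_single_of_mem j h fun i _ hi => by
          rw [termProj_single_of_ne N (Ne.symm hi), map_zero], termProj_single_same,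
          termIncl_single]
      · exact Finset.sum_eq_zero fun i hi => by
          rw [termProj_single_of_ne N (fun hj : j = i => h (hj ▸ hi)), map_zero]
    have h1 : y = ∑ g ∈ y.support, Finsupp.single g (y g) := (Finsupp.sum_single y).symm
    conv_rhs => rw [h1]
    simp only [map_sum]
    rw [Finset.sum_comm]
    conv_lhs => rw [h1]
    refine Finset.sum_congr rfl fun g hg => ?_
    have := key y g.1 g.2
    rw [if_pos (hy (Finset.mem_image_of_mem _ hg))] at this
    exact this.symm
  exact hsub _ x subset_rfl

/-- The differential of a generator of the total complex. -/
noncomputable def generatorBoundary : ResolutionGenerator N → (ResolutionGenerator N →₀ A)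
  | ⟨0, _⟩ => 0
  | ⟨i + 1, b⟩ => termIncl N i (syzygyIncl N i b.2.1)

theorem linearCombination_termIncl_zero (x : HomogeneousElement (syzygy N 0) →₀ A) :
    Finsupp.linearCombination A (generatorBoundary N) (termIncl N 0 x) = 0 := by
  induction x using Finsupp.induction_linear with
  | zero => simp
  | add x y hx hy => rw [map_add, map_add, hx, hy, add_zero]
  | single b a =>
    rw [termIncl_single, Finsupp.linearCombination_single]
    exact smul_zero a

theorem linearCombination_termIncl_succ (i : ℕ) (x : HomogeneousElement (syzygy N (i + 1)) →₀ A) :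
    Finsupp.linearCombination A (generatorBoundary N) (termIncl N (i + 1) x) =
      termIncl N i (syzygyIncl N i (freeCover _ x)) := by
  induction x using Finsupp.induction_linear with
  | zero => simp
  | add x y hx hy => simp only [map_add, hx, hy]
  | single b a =>
    rw [termIncl_single, Finsupp.linearCombination_single, freeCover_single, map_smul, map_smul]
    rfl

theorem termIncl_mem {i : ℕ} {n : ℤ} {x : HomogeneousElement (syzygy N i) →₀ A}
    (hx : x ∈ freeGrading 𝒜 (fun b : HomogeneousElement (syzygy N i) => b.1) n) :
    termIncl N i x ∈ freeGrading 𝒜 (generatorDegree N) (n + i) := by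
  rintro ⟨j, b⟩
  by_cases h : j = i
  · subst h
    have h1 : termIncl N j x ⟨j, b⟩ = x b := Finsupp.mapDomain_apply (mkGenerator_injective N j) x b
    rw [h1, generatorDegree]
    have := hx b
    rwa [show n - b.1 = n + j - (b.1 + j) by ring] at this
  · have h1 : termIncl N i x ⟨j, b⟩ = 0 := Finsupp.mapDomain_of_notMem_range (f := mkGenerator N i) x _ (by
      rintro ⟨c, hc⟩
      exact h (congrArg Sigma.fst hc).symm)
    rw [h1]
    exact zero_mem _

/-- The total complex of the free resolution of a graded module by homogeneous elements. -/
noncomputable abbrev totalComplex : DGModule 𝒜 :=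
  semifree (generatorDegree N) (generatorBoundary N) (by
    rintro ⟨i | i, b⟩
    · exact zero_mem _
    · have := termIncl_mem N (syzygyIncl_mem N b.2.2)
      rwa [show b.1 + (i : ℤ) = generatorDegree N ⟨i + 1, b⟩ - 1 by
        rw [generatorDegree]; push_cast; ring] at this) (by
    rintro ⟨i | i, b⟩
    · exact map_zero _
    · change Finsupp.linearCombination A (generatorBoundary N)
        (termIncl N i (syzygyIncl N i b.2.1)) = 0
      cases i with
      | zero => exact linearCombination_termIncl_zero N _
      | succ i =>
        rw [linearCombination_termIncl_succ, freeCover_syzygyIncl, map_zero, map_zero])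

theorem kProjective_totalComplex : KProjective (totalComplex N) :=
  kProjective_semifree _ _ (fun g => g.1) (by
    classical
    rintro ⟨i | i, b⟩ g hg
    · simp [generatorBoundary] at hg
    · obtain ⟨c, -, rfl⟩ := Finset.mem_image.mp
        (Finsupp.mapDomain_support (f := mkGenerator N i) hg)
      exact Nat.lt_succ_self i)

/-- In the total complex, the component of `d x` in a term is the image of the next component of `x`
under the differential of the resolution. -/
theorem termProj_d (i : ℕ) (x : ResolutionGenerator N →₀ A) :
    termProj N i ((totalComplex N).d x) =
      syzygyIncl N i (freeCover _ (termProj N (i + 1) x)) := by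
  change termProj N i (Finsupp.linearCombination A (generatorBoundary N) x) = _
  induction x using Finsupp.induction_linear with
  | zero => simp
  | add x y hx hy => simp only [map_add, hx, hy]
  | single g a =>
    obtain ⟨j, b⟩ := g
    rw [Finsupp.linearCombination_single, map_smul]
    cases j with
    | zero =>
      rw [termProj_single_of_ne N (Nat.succ_ne_zero i).symm, map_zero, map_zero]
      exact (congrArg _ (map_zero _)).trans (smul_zero a)
    | succ j =>
      change a • termProj N i (termIncl N j (syzygyIncl N j b.2.1)) = _
      by_cases h : j = i
      · subst h
        rw [termProj_termIncl_same, termProj_single_same, freeCover_single, map_smul]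
      · rw [termProj_termIncl_of_ne N h, termProj_single_of_ne N (by omega), map_zero, map_zero,
          smul_zero]

/-- The augmentation of the total complex. -/
noncomputable def augmentation (hN : ∀ x, N.d x = 0) : totalComplex N ⟶ syzygy N 0 where
  toLinearMap := freeCover (syzygy N 0) ∘ₗ termProj N 0
  map_mem n x hx := freeCover_mem (syzygy N 0) fun b => by
    have := hx ⟨0, b⟩
    rwa [generatorDegree, Nat.cast_zero, add_zero] at this
  map_d x := by
    rw [syzygy_d N hN]
    exact (congrArg _ (termProj_d N 0 x)).trans (freeCover_syzygyIncl N 0 _)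

variable {N}

theorem quasiIso_augmentation (hN : ∀ x, N.d x = 0) : quasiIso 𝒜 (augmentation N hN) := by
  refine (quasiIso_iff _).mpr ⟨fun x hx ⟨y, hy⟩ => ?_, fun y _ => ?_⟩
  · rw [syzygy_d N hN] at hy
    have h0 : ∀ i, freeCover (syzygy N i) (termProj N i x) = 0 := by
      rintro (- | i)
      · exact hy.symm
      · refine syzygyIncl_injective N i ?_
        rw [← termProj_d, hx, map_zero, map_zero]
    choose z hz using fun i => exists_syzygyIncl_eq N (h0 i)
    choose w hw using fun i => freeCover_surjective (syzygy N (i + 1)) (z i)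
    obtain ⟨s, hs⟩ := exists_sum_termIncl N x
    refine ⟨∑ i ∈ s, termIncl N (i + 1) (w i), ?_⟩
    rw [map_sum]
    refine (Finset.sum_congr rfl fun i _ => ?_).trans hs.symm
    rw [← hz, ← hw]
    exact linearCombination_termIncl_succ N i (w i)
  · obtain ⟨x, rfl⟩ := freeCover_surjective (syzygy N 0) y
    refine ⟨termIncl N 0 x, linearCombination_termIncl_zero N x, 0, ?_⟩
    have h1 : (augmentation N hN).toLinearMap (termIncl N 0 x) = freeCover (syzygy N 0) x :=
      congrArg (freeCover (syzygy N 0)) (termProj_termIncl_same N 0 x)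
    rw [h1, sub_self, map_zero]

variable (N) in
/-- The shifted syzygies, to which the total complex maps. -/
noncomputable abbrev shiftedSyzygy (j : ULift.{u} ℕ) : DGModule 𝒜 :=
  (syzygy N j.down).shift (-(j.down : ℤ))

/-- The morphism from the total complex to the direct sum of the shifted syzygies. -/
noncomputable def toCoprodSyzygy (hN : ∀ x, N.d x = 0) : totalComplex N ⟶ coprod (shiftedSyzygy N) :=
  semifreeDesc (fun g => (coprodι (shiftedSyzygy N) ⟨g.1⟩).toLinearMap g.2.2.1)
    (fun g => (coprodι (shiftedSyzygy N) ⟨g.1⟩).map_mem (by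
      change g.2.2.1 ∈ (syzygy N g.1).grading (g.2.1 + g.1 + -(g.1 : ℤ))
      rw [add_neg_cancel_right]
      exact g.2.2.2)) (by
    have hterm : ∀ (i : ℕ) (x : HomogeneousElement (syzygy N i) →₀ A),
        Finsupp.linearCombination A (fun g : ResolutionGenerator N =>
          (coprodι (shiftedSyzygy N) ⟨g.1⟩).toLinearMap g.2.2.1) (termIncl N i x) =
          (coprodι (shiftedSyzygy N) ⟨i⟩).toLinearMap (freeCover (syzygy N i) x) := by
      intro i x
      induction x using Finsupp.induction_linear with
      | zero => simp
      | add x y hx hy => rw [map_add, map_add, map_add, map_add, hx, hy]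
      | single b a =>
        rw [termIncl_single, Finsupp.linearCombination_single, freeCover_single, map_smul]
    rintro ⟨i, b⟩
    rw [← (coprodι (shiftedSyzygy N) ⟨i⟩).map_d]
    have h1 : (shiftedSyzygy N ⟨i⟩).d b.2.1 = 0 := by
      change -((syzygy N i).d b.2.1) = 0
      rw [syzygy_d N hN, neg_zero]
    rw [h1, map_zero]
    cases i with
    | zero => exact map_zero _
    | succ i =>
      change Finsupp.linearCombination A _ (termIncl N i (syzygyIncl N i b.2.1)) = 0
      rw [hterm, freeCover_syzygyIncl, map_zero])

/-- A graded module, with zero differential, that is small in the derived category has finite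
projective dimension. -/
theorem exists_pdLE_of_isSmallObject {N : DGModule 𝒜} (hN : ∀ x, N.d x = 0)
    (h : IsSmallObject.{u} (toDerived 𝒜 N)) :
    ∃ n, PdLE A N.carrier n := by
  obtain ⟨F, hF⟩ := (kProjective_totalComplex N).exists_nullHomotopic
    ((isSmallObject_iff_of_quasiIso (quasiIso_augmentation hN)).mpr h) _ (toCoprodSyzygy hN)
  obtain ⟨i, hi⟩ : ∃ i : ℕ, (⟨i + 1⟩ : ULift.{u} ℕ) ∉ F := by
    by_contra! hcon
    exact Set.infinite_of_injective_forall_mem (f := fun i : ℕ => (⟨i + 1⟩ : ULift.{u} ℕ))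
      (fun i j hij => by simpa using congrArg ULift.down hij) hcon F.finite_toSet
  obtain ⟨k, -, hk⟩ := hF _ hi
  -- The null-homotopy restricts to a retraction of the inclusion of the syzygy.
  let r : (HomogeneousElement (syzygy N i) →₀ A) →ₗ[A] (syzygy N (i + 1)).carrier :=
    k ∘ₗ termIncl N i
  have hr : r ∘ₗ syzygyIncl N i = LinearMap.id := by
    refine LinearMap.ext fun x => ?_
    induction x using homogeneous_induction with
    | zero => simp
    | add y z hy hz => rw [map_add, map_add, hy, hz]
    | hom n y hy =>
      have h1 := hk (Finsupp.single ⟨i + 1, n, y, hy⟩ 1)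
      have h2 : ∀ z, (shiftedSyzygy N ⟨i + 1⟩).d z = 0 := fun z => neg_zero
      rw [h2, zero_add] at h1
      have h3 : (totalComplex N).d (Finsupp.single ⟨i + 1, n, y, hy⟩ 1) =
          termIncl N i (syzygyIncl N i y) :=
        (Finsupp.linearCombination_single _ _ _).trans (one_smul _ _)
      have h4 : (toCoprodSyzygy hN).toLinearMap (Finsupp.single ⟨i + 1, n, y, hy⟩ 1) =
          (coprodι (shiftedSyzygy N) ⟨i + 1⟩).toLinearMap y :=
        (Finsupp.linearCombination_single _ _ _).trans (one_smul _ _)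
      rw [h3, comp_apply, h4] at h1
      have h5 := congrArg (fun f : shiftedSyzygy N ⟨i + 1⟩ ⟶ shiftedSyzygy N ⟨i + 1⟩ =>
        f.toLinearMap y) (ι_π_self (shiftedSyzygy N) ⟨i + 1⟩)
      exact h1.symm.trans h5
  have hproj : Module.Projective A (syzygy N (i + 1)).carrier :=
    Module.Projective.of_split (syzygyIncl N i) r hr
  exact ⟨_, pdLE_of_pdLE_syzygy N (pdLE_zero_iff.mpr hproj)⟩

end Syzygies

end DGModule

/-! ### Homogeneous localization -/

namespace GradedLocalization

section

variable {R : Type u} [CommRing R] (𝒜 : ℤ → AddSubgroup R) [GradedRing 𝒜] (p : Ideal R) [p.IsPrime]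

/-- The extension of `p` to the homogeneous localization at `p`. -/
abbrev extension : Ideal (GradedLocalization 𝒜 p) := p.map (algebraMap R (GradedLocalization 𝒜 p))

theorem disjoint_homogeneousCompl : Disjoint (homogeneousCompl 𝒜 p : Set R) (p : Set R) :=
  Set.disjoint_left.mpr fun _ hx hxp => hx.2 hxp

instance isPrime_extension : (extension 𝒜 p).IsPrime :=
  IsLocalization.isPrime_of_isPrime_disjoint (homogeneousCompl 𝒜 p) _ p inferInstance
    (disjoint_homogeneousCompl 𝒜 p)

theorem algebraMap_mem_extension_iff {r : R} :
    algebraMap R (GradedLocalization 𝒜 p) r ∈ extension 𝒜 p ↔ r ∈ p := by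
  have h := IsLocalization.under_map_of_isPrime_disjoint (homogeneousCompl 𝒜 p)
    (GradedLocalization 𝒜 p) (I := p) inferInstance (disjoint_homogeneousCompl 𝒜 p)
  exact iff_of_eq (congrArg (r ∈ ·) h)

theorem isUnit_of_notMem_extension {i : ℤ} {a : GradedLocalization 𝒜 p}
    (ha : a ∈ grading 𝒜 p i) (ham : a ∉ extension 𝒜 p) : IsUnit a := by
  obtain ⟨k, s, hs, -, b, hb, h⟩ := ha
  rw [Algebra.linearMap_apply, Algebra.smul_def] at h
  have hbp : b ∉ p := fun hbp => by
    have h1 : algebraMap R (GradedLocalization 𝒜 p) s * a ∈ extension 𝒜 p :=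
      h ▸ Ideal.mem_map_of_mem _ hbp
    rcases (isPrime_extension 𝒜 p).mem_or_mem h1 with h2 | h2
    · exact hs.2 ((algebraMap_mem_extension_iff 𝒜 p).mp h2)
    · exact ham h2
  have hu : IsUnit (algebraMap R (GradedLocalization 𝒜 p) b) :=
    IsLocalization.map_units _ (⟨b, ⟨_, hb⟩, hbp⟩ : homogeneousCompl 𝒜 p)
  rw [← h] at hu
  exact isUnit_of_mul_isUnit_right hu

/-- The localization of `R_(p)` at the extension of `p` is the ungraded localization `R_p`. -/
theorem nonempty_localization_ringEquiv :
    Nonempty (Localization.AtPrime (extension 𝒜 p) ≃+* Localization.AtPrime p) := by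
  have h1 := IsLocalization.isLocalization_isLocalization_atPrime_isLocalization
    (homogeneousCompl 𝒜 p) (Localization.AtPrime (extension 𝒜 p)) (extension 𝒜 p)
  have h2 : (extension 𝒜 p).comap (algebraMap R (GradedLocalization 𝒜 p)) = p :=
    Ideal.ext fun r => algebraMap_mem_extension_iff 𝒜 p
  have h3 : IsLocalization p.primeCompl (Localization.AtPrime (extension 𝒜 p)) := by
    have h4 : ((extension 𝒜 p).comap (algebraMap R (GradedLocalization 𝒜 p))).primeCompl =
        p.primeCompl := by
      ext r
      exact not_congr (algebraMap_mem_extension_iff 𝒜 p)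
    exact h4 ▸ h1
  exact ⟨(IsLocalization.algEquiv p.primeCompl (Localization.AtPrime (extension 𝒜 p))
    (Localization.AtPrime p)).toRingEquiv⟩

end

end GradedLocalization

/-! ### Singular support -/

namespace DGModule

section

variable {R : Type u} [CommRing R] (𝒜 : ℤ → AddSubgroup R) [GradedRing 𝒜] (p : Ideal R) [p.IsPrime]

/-- Localization preserves coefficient-finitely generated DG modules: up to a unit, each homology
class of the localization comes from `M`. -/
theorem coefficientFinite_localization (M : DGModule 𝒜) (hM : M.CoefficientFinite) :
    (M.localization 𝒜 p).CoefficientFinite := by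
  let N := M.localization 𝒜 p
  let A := GradedLocalization 𝒜 p
  let L : M.carrier →ₗ[R] A ⊗[R] M.carrier := TensorProduct.mk R A M.carrier 1
  have hdL : ∀ x, N.d (L x) = L (M.d x) := fun x => LinearMap.baseChange_tmul _ _ _
  let cls : M.cycles → N.homology := fun z => Submodule.Quotient.mk ⟨L z.1, by
    change N.d (L z.1) = 0
    rw [hdL, show M.d z.1 = 0 from z.2, map_zero]
    rfl⟩
  have hcls : ∀ z z' : M.cycles, (∃ y, M.d y = z.1 - z'.1) → cls z = cls z' := by
    rintro z z' ⟨y, hy⟩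
    rw [← sub_eq_zero]
    refine (homology_mk_eq_zero_iff (M := N) _).mpr ⟨L y, ?_⟩
    rw [hdL, hy, map_sub]
    rfl
  have hadd : ∀ z z', cls (z + z') = cls z + cls z' := fun z z' =>
    congrArg Submodule.Quotient.mk (Subtype.ext (map_add L z.1 z'.1))
  have hsmul : ∀ (a : R) z, cls (a • z) = algebraMap R A a • cls z := fun a z =>
    congrArg Submodule.Quotient.mk (Subtype.ext (by
      change L (a • z.1) = algebraMap R A a • L z.1
      rw [map_smul, algebraMap_smul]))
  obtain ⟨G, hG⟩ := Module.Finite.fg_top (R := R) (M := M.homology) (self := hM)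
  choose g hg using fun h : M.homology => Submodule.Quotient.mk_surjective M.boundaries h
  classical
  let V : Submodule A N.homology := Submodule.span A (G.image fun h => cls (g h) : Finset N.homology)
  have hV : ∀ z, cls z ∈ V := by
    have h1 : ∀ h ∈ Submodule.span R (G : Set M.homology),
        ∃ z : M.cycles, Submodule.Quotient.mk z = h ∧ cls z ∈ V := by
      intro h hh
      induction hh using Submodule.span_induction with
      | mem h hh => exact ⟨g h, hg h, Submodule.subset_span (Finset.mem_coe.mpr
          (Finset.mem_image_of_mem (fun h => cls (g h)) hh))⟩
      | zero =>
        refine ⟨0, rfl, ?_⟩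
        have : cls 0 = 0 := (homology_mk_eq_zero_iff (M := N) _).mpr ⟨0, by
          rw [map_zero]; exact (map_zero L).symm⟩
        rw [this]
        exact zero_mem _
      | add h h' _ _ ih ih' =>
        obtain ⟨z, rfl, hz⟩ := ih
        obtain ⟨z', rfl, hz'⟩ := ih'
        exact ⟨z + z', rfl, hadd z z' ▸ add_mem hz hz'⟩
      | smul a h _ ih =>
        obtain ⟨z, rfl, hz⟩ := ih
        exact ⟨a • z, rfl, hsmul a z ▸ V.smul_mem _ hz⟩
    intro z
    obtain ⟨z', h2, hz'⟩ := h1 (Submodule.Quotient.mk z) (hG ▸ Submodule.mem_top)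
    rw [hcls z z']
    · exact hz'
    · have h3 := sub_eq_zero.mpr h2.symm
      rw [← Submodule.Quotient.mk_sub, homology_mk_eq_zero_iff] at h3
      exact h3
  have htop : ∀ h : N.homology, h ∈ V := by
    intro h
    obtain ⟨n, rfl⟩ := Submodule.Quotient.mk_surjective _ h
    let n' : A ⊗[R] M.carrier := n.1
    obtain ⟨⟨x, s⟩, hx⟩ := IsLocalizedModule.surj (homogeneousCompl 𝒜 p) L n'
    have hx' : algebraMap R A s • n.1 = L x := (algebraMap_smul A (s : R) n').trans hx
    have h1 : L (M.d x) = 0 := by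
      rw [← hdL, ← hx', map_smul, show N.d n.1 = 0 from n.2, smul_zero]
      rfl
    obtain ⟨t, ht⟩ := (IsLocalizedModule.eq_zero_iff (homogeneousCompl 𝒜 p) L).mp h1
    let z : M.cycles := ⟨(t : R) • x, by
      change M.d ((t : R) • x) = 0
      rw [map_smul]
      exact ht⟩
    have h2 : (algebraMap R A t * algebraMap R A s) • (Submodule.Quotient.mk n : N.homology) =
        cls z := by
      rw [← Submodule.Quotient.mk_smul]
      refine congrArg Submodule.Quotient.mk (Subtype.ext ?_)
      change (algebraMap R A t * algebraMap R A s) • n.1 = L ((t : R) • x)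
      rw [mul_smul, hx', map_smul]
      exact algebraMap_smul A (t : R) (L x)
    have hu : IsUnit (algebraMap R A t * algebraMap R A s) :=
      (IsLocalization.map_units A t).mul (IsLocalization.map_units A s)
    rw [← Submodule.smul_mem_iff_of_isUnit _ hu, h2]
    exact hV z
  exact ⟨⟨G.image fun h => cls (g h), eq_top_iff.mpr fun h _ => htop h⟩⟩

/-- If `R_p` is regular, the localizations at `p` of all coefficient-finitely generated DG modules
are small. -/
theorem isSmallObject_localization [IsNoetherianRing R]
    [hreg : IsRegularLocalRing (Localization.AtPrime p)] (M : DGModule 𝒜)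
    (hM : M.CoefficientFinite) : IsSmallObject.{u} (toDerived _ (M.localization 𝒜 p)) := by
  let m := GradedLocalization.extension 𝒜 p
  obtain ⟨e⟩ := GradedLocalization.nonempty_localization_ringEquiv 𝒜 p
  have hreg' : IsRegularLocalRing (Localization.AtPrime m) := IsRegularLocalRing.of_ringEquiv e.symm
  have hnoeth : IsNoetherianRing (GradedLocalization 𝒜 p) :=
    IsLocalization.isNoetherianRing (homogeneousCompl 𝒜 p) _ inferInstance
  have hfin : Module.Finite (GradedLocalization 𝒜 p) (M.localization 𝒜 p).homology :=
    coefficientFinite_localization 𝒜 p M hM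
  obtain ⟨n, hn⟩ := IsRegularLocalRing.exists_pdLE (S := Localization.AtPrime m)
    (Localization.AtPrime m ⊗[GradedLocalization 𝒜 p] (M.localization 𝒜 p).homology)
  obtain ⟨P, s, hP, hPfin, hs⟩ := exists_finite_kProjective_resolution m
    (fun i a ha ham => GradedLocalization.isUnit_of_notMem_extension 𝒜 p ha ham)
    (Localization.AtPrime m) n _ hn
  exact (isSmallObject_iff_of_quasiIso hs).mp hP.isSmallObject

end

section

variable {R : Type u} [CommRing R] (𝒜 : ℤ → AddSubgroup R) [GradedRing 𝒜] {p : Ideal R}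

theorem isInternal_quotient (hp : p.IsHomogeneous 𝒜) : DirectSum.IsInternal fun n =>
    (𝒜 n).map (Ideal.Quotient.mk p).toAddMonoidHom := by
  classical
  refine ⟨(injective_iff_map_eq_zero _).mpr fun z hz => ?_, fun x => ?_⟩
  · choose a ha haz using fun n => (z n).2
    have h1 : ∑ n ∈ z.support, a n ∈ p := by
      rw [← Ideal.Quotient.eq_zero_iff_mem, map_sum]
      rw [DirectSum.coeAddMonoidHom_eq_dfinsuppSum, DFinsupp.sum] at hz
      exact (Finset.sum_congr rfl fun n _ => haz n).trans hz
    ext n : 2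
    by_cases hn : n ∈ z.support
    · have h2 := hp n h1
      rw [DirectSum.decompose_sum, DirectSum.sum_apply, AddSubmonoidClass.coe_finsetSum,
        Finset.sum_eq_single_of_mem n hn fun j _ hjn =>
          DirectSum.decompose_of_mem_ne 𝒜 (ha j) hjn, DirectSum.decompose_of_mem_same 𝒜 (ha n)] at h2
      exact (haz n).symm.trans (Ideal.Quotient.eq_zero_iff_mem.mpr h2)
    · rw [DFinsupp.notMem_support_iff.mp hn]
      rfl
  · obtain ⟨r, rfl⟩ := Ideal.Quotient.mk_surjective x
    induction r using DirectSum.Decomposition.inductionOn 𝒜 with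
    | zero => exact ⟨0, (map_zero _).trans (map_zero _).symm⟩
    | @homogeneous n r =>
      exact ⟨DirectSum.of (fun n => (𝒜 n).map (Ideal.Quotient.mk p).toAddMonoidHom) n
        ⟨Ideal.Quotient.mk p r, r, r.2, rfl⟩, DirectSum.coeAddMonoidHom_of _ _ _⟩
    | add r r' h h' =>
      obtain ⟨w, hw⟩ := h
      obtain ⟨w', hw'⟩ := h'
      exact ⟨w + w', by rw [map_add, hw, hw', map_add]⟩

/-- The quotient of a graded ring by a homogeneous ideal, as a DG module with zero
differential. -/
noncomputable def quotient (hp : p.IsHomogeneous 𝒜) : DGModule 𝒜 where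
  carrier := R ⧸ p
  grading n := (𝒜 n).map (Ideal.Quotient.mk p).toAddMonoidHom
  isInternal := isInternal_quotient 𝒜 hp
  smul_mem := by
    rintro i j a _ ha ⟨b, hb, rfl⟩
    exact ⟨a * b, SetLike.GradedMul.mul_mem ha hb, rfl⟩
  d := 0
  d_mem _ _ _ := zero_mem _
  d_d _ := rfl

theorem coefficientFinite_quotient [IsNoetherianRing R] (hp : p.IsHomogeneous 𝒜) :
    (quotient 𝒜 hp).CoefficientFinite := by
  have : IsNoetherian R (quotient 𝒜 hp).carrier := inferInstanceAs (IsNoetherian R (R ⧸ p))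
  exact inferInstanceAs (Module.Finite R (_ ⧸ (quotient 𝒜 hp).boundaries))

/-- If the localization of `R ⧸ p` at `p` is small, then `R_p` is regular. -/
theorem isRegularLocalRing_of_isSmallObject [IsNoetherianRing R] [p.IsPrime]
    (hp : p.IsHomogeneous 𝒜)
    (h : IsSmallObject.{u} (toDerived _ ((quotient 𝒜 hp).localization 𝒜 p))) :
    IsRegularLocalRing (Localization.AtPrime p) := by
  let m := GradedLocalization.extension 𝒜 p
  let A := GradedLocalization 𝒜 p
  let S := Localization.AtPrime m
  have hnoeth : IsNoetherianRing A :=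
    IsLocalization.isNoetherianRing (homogeneousCompl 𝒜 p) _ inferInstance
  have hnoethS : IsNoetherianRing S := IsLocalization.isNoetherianRing m.primeCompl _ inferInstance
  have hflat : Module.Flat A S := IsLocalization.flat S m.primeCompl
  obtain ⟨n, hn⟩ := exists_pdLE_of_isSmallObject (fun x =>
    LinearMap.congr_fun (LinearMap.baseChange_zero (R := R) (A := A) (M := R ⧸ p) (N := R ⧸ p)) x) h
  have hn1 : PdLE A (A ⊗[R] (R ⧸ p)) n := hn
  have hn2 : PdLE S (S ⊗[A] (A ⊗[R] (R ⧸ p))) n := hn1.baseChange S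
  let b : A ⊗[R] (R ⧸ p) := 1 ⊗ₜ Ideal.Quotient.mk p 1
  have hb : ∀ r : R, algebraMap R A r • b = 1 ⊗ₜ Ideal.Quotient.mk p r := fun r => by
    rw [algebraMap_smul, ← TensorProduct.tmul_smul, Algebra.smul_def, mul_comm, map_one, one_mul]
    rfl
  have hbspan : ∀ y : A ⊗[R] (R ⧸ p), ∃ a : A, a • b = y := by
    intro y
    induction y using TensorProduct.induction_on with
    | zero => exact ⟨0, zero_smul _ _⟩
    | add y z hy hz =>
      obtain ⟨a, rfl⟩ := hy
      obtain ⟨a', rfl⟩ := hz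
      exact ⟨a + a', add_smul _ _ _⟩
    | tmul a r =>
      obtain ⟨r, rfl⟩ := Ideal.Quotient.mk_surjective r
      refine ⟨a * algebraMap R A r, ?_⟩
      rw [mul_smul, hb, TensorProduct.smul_tmul', smul_eq_mul, mul_one]
  have hreg : IsRegularLocalRing S := by
    -- The residue field of `S` is the localization of `A ⊗ R ⧸ p` at `m`.
    refine isRegularLocalRing_of_pdLE_residueField hn2 (1 ⊗ₜ b) (fun y => ?_) (fun a ha => ?_) ?_
    · induction y using TensorProduct.induction_on with
      | zero => exact ⟨0, zero_smul _ _⟩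
      | add y z hy hz =>
        obtain ⟨a, rfl⟩ := hy
        obtain ⟨a', rfl⟩ := hz
        exact ⟨a + a', add_smul _ _ _⟩
      | tmul s y =>
        obtain ⟨a, rfl⟩ := hbspan y
        refine ⟨a • s, ?_⟩
        rw [TensorProduct.smul_tmul', smul_eq_mul, mul_one, TensorProduct.smul_tmul]
    · rw [← Localization.AtPrime.map_eq_maximalIdeal] at ha
      induction ha using Submodule.span_induction with
      | mem a ha =>
        obtain ⟨a, ha, rfl⟩ := ha
        rw [algebraMap_smul, ← TensorProduct.tmul_smul]
        have hab : a • b = 0 := by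
          induction ha using Submodule.span_induction with
          | mem a ha =>
            obtain ⟨r, hr, rfl⟩ := ha
            rw [hb, Ideal.Quotient.eq_zero_iff_mem.mpr hr, TensorProduct.tmul_zero]
          | zero => exact zero_smul _ _
          | add a a' _ _ h h' => rw [add_smul, h, h', add_zero]
          | smul c a _ h => rw [smul_assoc, h, smul_zero]
        rw [hab, TensorProduct.tmul_zero]
      | zero => exact zero_smul _ _
      | add a a' _ _ h h' => rw [add_smul, h, h', add_zero]
      | smul c a _ h => rw [smul_assoc, h, smul_zero]
    · intro h0
      obtain ⟨s, hs⟩ := (IsLocalizedModule.eq_zero_iff m.primeCompl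
        (TensorProduct.mk A S (A ⊗[R] (R ⧸ p)) 1)).mp h0
      obtain ⟨⟨r, t⟩, hrt⟩ := IsLocalization.surj (homogeneousCompl 𝒜 p) (s : A)
      have hs' : (s : A) • b = 0 := hs
      have hr : r ∉ p := fun hr => by
        have h1 : (s : A) * algebraMap R A t ∈ m := hrt ▸ Ideal.mem_map_of_mem _ hr
        rcases (GradedLocalization.isPrime_extension 𝒜 p).mem_or_mem h1 with h2 | h2
        · exact s.2 h2
        · exact t.2.2 ((GradedLocalization.algebraMap_mem_extension_iff 𝒜 p).mp h2)
      have h1 : TensorProduct.mk R A (R ⧸ p) 1 (Ideal.Quotient.mk p r) = 0 := by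
        rw [TensorProduct.mk_apply, ← hb, ← hrt, mul_comm, mul_smul, hs', smul_zero]
      obtain ⟨t', ht'⟩ := (IsLocalizedModule.eq_zero_iff (homogeneousCompl 𝒜 p)
        (TensorProduct.mk R A (R ⧸ p) 1)).mp h1
      have h2 : (t' : R) * r ∈ p := Ideal.Quotient.eq_zero_iff_mem.mp ht'
      rcases (inferInstance : p.IsPrime).mem_or_mem h2 with h3 | h3
      · exact t'.2.2 h3
      · exact hr h3
  obtain ⟨e⟩ := GradedLocalization.nonempty_localization_ringEquiv 𝒜 p
  exact IsRegularLocalRing.of_ringEquiv e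

end

end DGModule

theorem theorem4p5 {R : Type u} [CommRing R] [IsNoetherianRing R]
    (𝒜 : ℤ → AddSubgroup R) [GradedRing 𝒜] :
    singularityCategorySupport 𝒜 = singularLocus R ∩ homogeneousSpectrum 𝒜 := by
  ext p
  rw [singularityCategorySupport, Set.mem_iUnion]
  constructor
  · rintro ⟨X, hp, hX⟩
    refine ⟨fun hreg => hX ?_, hp⟩
    exact DGModule.isSmallObject_localization 𝒜 p.asIdeal _
      ((Localization.Construction.objEquiv (boundedSmallCone 𝒜)).symm X).property
  · rintro ⟨hsing, hp⟩
    let Y : BoundedDerived 𝒜 := ⟨DGModule.toDerived 𝒜 (DGModule.quotient 𝒜 hp),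
      DGModule.coefficientFinite_quotient 𝒜 hp⟩
    exact ⟨Localization.Construction.objEquiv (boundedSmallCone 𝒜) Y, hp, fun h =>
      hsing (DGModule.isRegularLocalRing_of_isSmallObject 𝒜 hp h)⟩
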